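/- Let $k$ be a field with $2\neq 0$ in $k$ and let $\mathcal O$ be a cyclic operad in $k$-vector spaces, with $\mathcal O((S))$ the space of operations whose inputs and output are labelled by the finite set $S$. An oriented graph is a finite graph (loops and multiple edges allowed), all of whose vertices have valence at least $3$, with an ordering of its vertices and a direction of each edge. Let $\mathcal G^{\mathcal O}$ be the $k$-vector space spanned by the (isomorphism classes of) oriented graphs with a label in $\mathcal O((H(v)))$ at each vertex $v$, where $H(v)$ is the set of half-edges at $v$, modulo multilinearity in the labels and modulo the relation that a transposition in the ordering of the vertices, or a reversal of the direction of one edge, changes the sign. It is graded by the number of vertices and is a graded commutative algebra under disjoint union $(X,Y)\mapsto X\cdot Y$ (the vertices of $X$ preceding those of $Y$). Let $P\mathcal G^{\mathcal O}$ be the span of the connected graphs, so that $\mathcal G^{\mathcal O}\cong S(P\mathcal G^{\mathcal O})$ (graded symmetric algebra), with $S^i(P\mathcal G^{\mathcal O})$ corresponding to the span $\mathcal G^{\mathcal O}_{(i)}$ of the graphs with exactly $i$ components, and let $\pi_i:\mathcal G^{\mathcal O}\to \mathcal G^{\mathcal O}_{(i)}$ be the projection. For an edge $e$ of $G$ that is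 not a loop, $G_e$ denotes the graph obtained by contracting $e$ and composing the labels of its endpoints along $e$; if the endpoints of $e$ are the first and the second vertex and $e$ is directed from the first to the second, the new vertex becomes the first one and all other orderings and directions are kept. If $e$ is a loop, put $G_e=0$. For directed edges $e_1$ (from $a$ to $b$) and $e_2$ (from $c$ to $d$) of $G$ that belong to different edges, $G\langle e_1,e_2\rangle$ denotes the graph obtained by gluing a square to $e_1,e_2$ and deleting these two edges, that is, by replacing $e_1,e_2$ by an edge from $a$ to $d$ and an edge $e$ from $c$ to $b$ (with this orientation if the directions of $e_1,e_2$ are those of the orientation of $G$). Define $$\phi_2(X\odot Y)=\sum_{(e_1,e_2)} (X\cdot Y)\langle e_1,e_2\rangle_e,\qquad \partial_2(X)=\sum_{(e_1,e_2)} X\langle e_1,e_2\rangle_e,\qquad \theta_2=\tfrac12\,\pi_2\circ\partial_2,$$ where the first sum is over all ordered pairs of directed edges of $X\cdot Y$, one of which lies in $X$ and the other in $Y$, and the second one over all ordered pairs of directed edges of $X$ that belong to different edges. Thus $\phi_2$ is a bilinear map $\mathcal G^{\mathcal O}\times \mathcal G^{\mathcal O}\to \mathcal G^{\mathcal O}$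 and $\theta_2$ maps $P\mathcal G^{\mathcal O}$ to $\mathcal G^{\mathcal O}_{(2)}\cong S^2(P\mathcal G^{\mathcal O})$. Let $P^{irred}\mathcal G^{\mathcal O}$ be the span of the connected graphs with no separating edges. **Theorem.** For all $X,Y\in P^{irred}\mathcal G^{\mathcal O}$, homogeneous with respect to the number of vertices, and with $x$ the degree of $X$, $$\theta_2\phi_2(X\odot Y)+\phi_2(\theta_2(X)\odot Y)+(-1)^x\phi_2(X\odot\theta_2(Y))=0 .$$ Here, in the last two terms, $\theta_2(X)$ and $\theta_2(Y)$ are regarded as elements of $\mathcal G^{\mathcal O}$ through $S^2(P\mathcal G^{\mathcal O})\cong\mathcal G^{\mathcal O}_{(2)}\subset\mathcal G^{\mathcal O}$, $A\odot B$ being the disjoint union $A\cdot B$. -/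

import Mathlib

universe u w

noncomputable section

open scoped Classical

/-! ### Cyclic operads -/

/-- The canonical identification of `((S - a) + (T - b)) - b' + (U - c)` with
`(S - a) + (((T - b') + (U - c)) - b)`, for distinct `b, b'` in `T`. -/
def gluingAssoc {S T U : Type} (a : S) (b b' : T) (hb : b ≠ b') (c : U) :
    {z : {s : S // s ≠ a} ⊕ {t : T // t ≠ b} // z ≠ Sum.inr ⟨b', hb.symm⟩} ⊕ {r : U // r ≠ c} ≃
      {s : S // s ≠ a} ⊕
        {z : {t : T // t ≠ b'} ⊕ {r : U // r ≠ c} // z ≠ Sum.inl ⟨b, hb⟩} where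
  toFun
    | Sum.inl ⟨Sum.inl s, _⟩ => Sum.inl s
    | Sum.inl ⟨Sum.inr t, h⟩ =>
        Sum.inr ⟨Sum.inl ⟨t.1, fun e => h (congrArg Sum.inr (Subtype.ext e))⟩,
          fun e => t.2 (congrArg Subtype.val (Sum.inl.inj e))⟩
    | Sum.inr r => Sum.inr ⟨Sum.inr r, fun e => nomatch e⟩
  invFun
    | Sum.inl s => Sum.inl ⟨Sum.inl s, fun e => nomatch e⟩
    | Sum.inr ⟨Sum.inl t, h⟩ =>
        Sum.inl ⟨Sum.inr ⟨t.1, fun e => h (congrArg Sum.inl (Subtype.ext e))⟩,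
          fun e => t.2 (congrArg Subtype.val (Sum.inr.inj e))⟩
    | Sum.inr ⟨Sum.inr r, _⟩ => Sum.inr r
  left_inv := by rintro (⟨_ | _, _⟩ | _) <;> rfl
  right_inv := by rintro (_ | ⟨_ | _, _⟩) <;> rfl

/-- A cyclic operad in `k`-vector spaces, in coordinate-free form: `obj S` is the space
`𝒪((S))` of operations whose inputs and output (on an equal footing) are labelled by the finite
set `S`, so that `𝒪(n) = obj (Fin (n + 1))`, with its action of the symmetric group
on `{0, …, n}`, the root being labelled by `0`.  `comp a b x y` is the composition of `x` and `y`
along the edge joining the leg `a` of `x` to the leg `b` of `y`.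
No unit is required. -/
structure CyclicOperad (k : Type u) [Field k] where
  obj : (S : Type) → [Finite S] → Type w
  [addCommGroup : ∀ (S : Type) [Finite S], AddCommGroup (obj S)]
  [module : ∀ (S : Type) [Finite S], Module k (obj S)]
  map : ∀ {S T : Type} [Finite S] [Finite T], (S ≃ T) → (obj S →ₗ[k] obj T)
  map_refl : ∀ {S : Type} [Finite S] (x : obj S), map (Equiv.refl S) x = x
  map_trans : ∀ {S T U : Type} [Finite S] [Finite T] [Finite U] (f : S ≃ T) (g : T ≃ U)
    (x : obj S), map (f.trans g) x = map g (map f x)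
  comp : ∀ {S T : Type} [Finite S] [Finite T] (a : S) (b : T),
    obj S →ₗ[k] obj T →ₗ[k] obj ({s : S // s ≠ a} ⊕ {t : T // t ≠ b})
  comp_map : ∀ {S T S' T' : Type} [Finite S] [Finite T] [Finite S'] [Finite T']
    (f : S ≃ S') (g : T ≃ T') (a : S) (b : T) (x : obj S) (y : obj T),
    comp (f a) (g b) (map f x) (map g y) =
      map (Equiv.sumCongr
        (f.subtypeEquiv (p := fun s => s ≠ a) (q := fun s => s ≠ f a)
          fun _ => f.injective.ne_iff.symm)
        (g.subtypeEquiv (p := fun t => t ≠ b) (q := fun t => t ≠ g b)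
          fun _ => g.injective.ne_iff.symm)) (comp a b x y)
  comp_comm : ∀ {S T : Type} [Finite S] [Finite T] (a : S) (b : T) (x : obj S) (y : obj T),
    comp b a y x = map (Equiv.sumComm _ _) (comp a b x y)
  comp_assoc : ∀ {S T U : Type} [Finite S] [Finite T] [Finite U] (a : S) (b b' : T)
    (hb : b ≠ b') (c : U) (x : obj S) (y : obj T) (z : obj U),
    map (gluingAssoc a b b' hb c)
        (comp (Sum.inr ⟨b', hb.symm⟩ : {s : S // s ≠ a} ⊕ {t : T // t ≠ b}) c (comp a b x y) z) =
      comp a (Sum.inl ⟨b, hb⟩ : {t : T // t ≠ b'} ⊕ {r : U // r ≠ c}) x (comp b' c y z)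

attribute [instance] CyclicOperad.addCommGroup CyclicOperad.module

namespace CyclicOperad

variable {k : Type u} [Field k] (O : CyclicOperad.{u, w} k)

theorem map_map_eq {S T T' U : Type} [Finite S] [Finite T] [Finite T'] [Finite U]
    (f : S ≃ T) (g : T ≃ U) (f' : S ≃ T') (g' : T' ≃ U) (h : ∀ s, g (f s) = g' (f' s))
    (x : O.obj S) : O.map g (O.map f x) = O.map g' (O.map f' x) := by
  rw [← O.map_trans, ← O.map_trans]
  have : f.trans g = f'.trans g' := Equiv.ext h
  rw [this]

theorem map_comp_eq {S T S' T' U U' : Type} [Finite S] [Finite T] [Finite S'] [Finite T']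
    [Finite U] [Finite U'] (f : S ≃ S') (g : T ≃ T') (a : S) (b : T) (a' : S') (b' : T')
    (ha : f a = a') (hb : g b = b') (E : {s : S // s ≠ a} ⊕ {t : T // t ≠ b} ≃ U)
    (E' : {s : S' // s ≠ a'} ⊕ {t : T' // t ≠ b'} ≃ U') (G : U ≃ U')
    (h1 : ∀ (s : {s : S // s ≠ a}) (hs : f s.1 ≠ a'),
      E' (Sum.inl ⟨f s.1, hs⟩) = G (E (Sum.inl s)))
    (h2 : ∀ (t : {t : T // t ≠ b}) (ht : g t.1 ≠ b'),
      E' (Sum.inr ⟨g t.1, ht⟩) = G (E (Sum.inr t)))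
    (x : O.obj S) (y : O.obj T) :
    O.map E' (O.comp a' b' (O.map f x) (O.map g y)) = O.map G (O.map E (O.comp a b x y)) := by
  subst ha
  subst hb
  rw [O.comp_map]
  refine O.map_map_eq _ _ _ _ ?_ _
  rintro (s | t)
  · exact h1 s _
  · exact h2 t _

end CyclicOperad

/-! ### Oriented graphs -/

/-- A finite graph, all of whose vertices have valence at least `3`, together with an ordering of
its vertices and a direction of each edge.  The graph is given by its vertices `V`, its half-edges
`H`, the vertex `att h` which a half-edge is incident to, and the other half `opp h` of the edge
that `h` belongs to.  The edge of `h` is directed from `h` to `opp h` if `out h` is true,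
and from `opp h` to `h` otherwise.  Loops and multiple edges are allowed. -/
structure OGraph where
  V : Type
  H : Type
  [fintypeV : Fintype V]
  [fintypeH : Fintype H]
  att : H → V
  opp : H → H
  opp_opp : ∀ h, opp (opp h) = h
  opp_ne : ∀ h, opp h ≠ h
  lt : V → V → Prop
  lt_order : IsStrictTotalOrder V lt
  out : H → Bool
  out_opp : ∀ h, out (opp h) = !out h
  three_le_valence : ∀ v, 3 ≤ Nat.card {h // att h = v}

attribute [instance] OGraph.fintypeV OGraph.fintypeH

namespace OGraph

/-- The set `H(v)` of half-edges incident to `v`. -/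
abbrev Star (Γ : OGraph) (v : Γ.V) : Type := {h : Γ.H // Γ.att h = v}

/-- The sign comparing the direction of the edge of `h` with the direction starting at `h`. -/
def dirSign (Γ : OGraph) (h : Γ.H) : ℤ := if Γ.out h = true then 1 else -1

/-- The set of connected components. -/
def Components (Γ : OGraph) : Type :=
  Quot fun v w : Γ.V => ∃ h, Γ.att h = v ∧ Γ.att (Γ.opp h) = w

/-- The set of connected components after deletion of (the interior of) the edge of `e`. -/
def ComponentsWithout (Γ : OGraph) (e : Γ.H) : Type :=
  Quot fun v w : Γ.V => ∃ h, h ≠ e ∧ h ≠ Γ.opp e ∧ Γ.att h = v ∧ Γ.att (Γ.opp h) = w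

/-- A graph is connected if it has exactly one component. -/
def IsConnected (Γ : OGraph) : Prop := Nat.card Γ.Components = 1

/-- The edge of `e` is separating if its deletion changes the number of components. -/
def IsSeparating (Γ : OGraph) (e : Γ.H) : Prop :=
  Nat.card (Γ.ComponentsWithout e) ≠ Nat.card Γ.Components

/-- Isomorphisms of the underlying graphs (orientations are not required to be preserved). -/
structure Iso (Γ Γ' : OGraph) where
  onV : Γ.V ≃ Γ'.V
  onH : Γ.H ≃ Γ'.H
  att_onH : ∀ h, Γ'.att (onH h) = onV (Γ.att h)
  opp_onH : ∀ h, Γ'.opp (onH h) = onH (Γ.opp h)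

/-- The pairs of vertices whose order is reversed by a bijection. -/
def inversions {V V' : Type} [Fintype V] (lt : V → V → Prop) (lt' : V' → V' → Prop)
    (f : V → V') : Finset (V × V) :=
  Finset.univ.filter fun p => lt p.1 p.2 ∧ lt' (f p.2) (f p.1)

namespace Iso

variable {Γ Γ' : OGraph}

/-- The edges, represented by their outgoing halves, whose direction is reversed. -/
def flips (f : Iso Γ Γ') : Finset Γ.H :=
  Finset.univ.filter fun h => Γ.out h = true ∧ Γ'.out (f.onH h) = false

/-- The sign by which an isomorphism changes the orientation: the sign of the permutation of
the vertices, times `-1` for each edge whose direction is reversed. -/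
def sign (f : Iso Γ Γ') : ℤ :=
  (-1) ^ (inversions Γ.lt Γ'.lt f.onV).card * (-1) ^ f.flips.card

/-- The bijection of half-edges at a vertex and at its image. -/
def star (f : Iso Γ Γ') (v : Γ.V) : Γ.Star v ≃ Γ'.Star (f.onV v) :=
  f.onH.subtypeEquiv fun h => by rw [f.att_onH]; exact f.onV.injective.eq_iff.symm

/-- The bijection of half-edges at a vertex and at a vertex equal to its image. -/
def starTo (f : Iso Γ Γ') (v : Γ.V) (w : Γ'.V) (e : w = f.onV v) : Γ.Star v ≃ Γ'.Star w :=
  f.onH.subtypeEquiv fun h => by rw [f.att_onH, e]; exact f.onV.injective.eq_iff.symm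

end Iso

/-- The half-edges at a vertex of the first part of a disjoint union. -/
def starInl (Γ Γ' : OGraph) (v : Γ.V) :
    Γ.Star v ≃ {h : Γ.H ⊕ Γ'.H // Sum.map Γ.att Γ'.att h = Sum.inl v} where
  toFun h := ⟨Sum.inl h.1, congrArg Sum.inl h.2⟩
  invFun
    | ⟨Sum.inl h, e⟩ => ⟨h, Sum.inl.inj e⟩
    | ⟨Sum.inr _, e⟩ => nomatch e
  left_inv _ := rfl
  right_inv := by
    rintro ⟨h | h, e⟩
    · rfl
    · cases e

/-- The half-edges at a vertex of the second part of a disjoint union. -/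
def starInr (Γ Γ' : OGraph) (v : Γ'.V) :
    Γ'.Star v ≃ {h : Γ.H ⊕ Γ'.H // Sum.map Γ.att Γ'.att h = Sum.inr v} where
  toFun h := ⟨Sum.inr h.1, congrArg Sum.inr h.2⟩
  invFun
    | ⟨Sum.inr h, e⟩ => ⟨h, Sum.inr.inj e⟩
    | ⟨Sum.inl _, e⟩ => nomatch e
  left_inv _ := rfl
  right_inv := by
    rintro ⟨h | h, e⟩
    · cases e
    · rfl

/-- Disjoint union; the vertices of `Γ` precede those of `Γ'`. -/
def disjUnion (Γ Γ' : OGraph) : OGraph where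
  V := Γ.V ⊕ Γ'.V
  H := Γ.H ⊕ Γ'.H
  att := Sum.map Γ.att Γ'.att
  opp := Sum.map Γ.opp Γ'.opp
  opp_opp := by rintro (h | h) <;> simp [Γ.opp_opp, Γ'.opp_opp]
  opp_ne := by rintro (h | h) <;> simp [Γ.opp_ne, Γ'.opp_ne]
  lt := Sum.Lex Γ.lt Γ'.lt
  lt_order := by
    have h1 := Γ.lt_order
    have h2 := Γ'.lt_order
    exact
      { trichotomous := fun a b => by
          rcases a with a | a <;> rcases b with b | b
          · simpa using h1.trichotomous a b
          · simp
          · simp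
          · simpa using h2.trichotomous a b
        irrefl := by
          rintro (a | a)
          · simpa using h1.irrefl a
          · simpa using h2.irrefl a
        trans := by
          rintro (a | a) (b | b) (c | c) <;> simp
          · exact h1.trans a b c
          · exact h2.trans a b c }
  out := Sum.elim Γ.out Γ'.out
  out_opp := by rintro (h | h) <;> simp [Γ.out_opp, Γ'.out_opp]
  three_le_valence := by
    rintro (v | v)
    · exact (Γ.three_le_valence v).trans_eq (Nat.card_congr (starInl Γ Γ' v))
    · exact (Γ'.three_le_valence v).trans_eq (Nat.card_congr (starInr Γ Γ' v))

/-! #### Gluing a square along two edges -/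

/-- `e₁` and `e₂` belong to different edges. -/
def Indep (Γ : OGraph) (e₁ e₂ : Γ.H) : Prop := e₂ ≠ e₁ ∧ e₂ ≠ Γ.opp e₁

/-- The pairing of half-edges after gluing a square along the directed edges `e₁` and `e₂`:
if `e₁` runs from `a` to `b` and `e₂` from `c` to `d`, these two edges are replaced by an edge
from `a` to `d`, which consists of the half-edges `e₁` and `opp e₂`, and an edge
from `c` to `b`, which consists of the half-edges `e₂` and `opp e₁`. -/
def glueOpp (Γ : OGraph) (e₁ e₂ h : Γ.H) : Γ.H :=
  if h = e₁ then Γ.opp e₂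
  else if h = Γ.opp e₂ then e₁
  else if h = e₂ then Γ.opp e₁
  else if h = Γ.opp e₁ then e₂
  else Γ.opp h

/-- The directions of the edges after gluing a square: the new edges run from `a` to `d` and
from `c` to `b`. -/
def glueOut (Γ : OGraph) (e₁ e₂ h : Γ.H) : Bool :=
  if h = e₁ ∨ h = e₂ then true
  else if h = Γ.opp e₁ ∨ h = Γ.opp e₂ then false
  else Γ.out h

/-- The graph `Γ⟨e₁, e₂⟩` obtained by gluing a square along two directed edges and deleting
the two edges along which it was glued.  If the edges `e₁`, `e₂` are directed in this way in `Γ`,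
this is the induced orientation. -/
def glue (Γ : OGraph) (e₁ e₂ : Γ.H) (he : Γ.Indep e₁ e₂) : OGraph where
  V := Γ.V
  H := Γ.H
  att := Γ.att
  opp := Γ.glueOpp e₁ e₂
  opp_opp := by
    obtain ⟨h1, h2⟩ := he
    have := Γ.opp_ne
    have := Γ.opp_opp
    intro h
    unfold glueOpp
    grind
  opp_ne := by
    obtain ⟨h1, h2⟩ := he
    have := Γ.opp_ne
    have := Γ.opp_opp
    intro h
    unfold glueOpp
    grind
  lt := Γ.lt
  lt_order := Γ.lt_order
  out := Γ.glueOut e₁ e₂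
  out_opp := by
    obtain ⟨h1, h2⟩ := he
    have := Γ.opp_ne
    have := Γ.opp_opp
    have := Γ.out_opp
    intro h
    unfold glueOpp glueOut
    grind
  three_le_valence := Γ.three_le_valence

/-! #### Contracting an edge -/

/-- The vertices different from the two endpoints of the edge of `e`. -/
abbrev Rest (Γ : OGraph) (e : Γ.H) : Type := {v // v ≠ Γ.att e ∧ v ≠ Γ.att (Γ.opp e)}

/-- The half-edges that do not belong to the edge of `e`. -/
abbrev HalfRest (Γ : OGraph) (e : Γ.H) : Type := {h // h ≠ e ∧ h ≠ Γ.opp e}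

/-- Incidence after contraction of the edge of `e`, the new vertex being `none`. -/
def contractAtt (Γ : OGraph) (e : Γ.H) (h : Γ.HalfRest e) : Option (Γ.Rest e) :=
  if hv : Γ.att h.1 ≠ Γ.att e ∧ Γ.att h.1 ≠ Γ.att (Γ.opp e) then some ⟨Γ.att h.1, hv⟩ else none

theorem contractAtt_eq_none {Γ : OGraph} {e : Γ.H} {h : Γ.HalfRest e} :
    Γ.contractAtt e h = none ↔ Γ.att h.1 = Γ.att e ∨ Γ.att h.1 = Γ.att (Γ.opp e) := by
  unfold contractAtt
  split_ifs with hv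
  · simp only [false_iff, not_or]
    exact hv
  · simp only [true_iff]
    tauto

theorem contractAtt_eq_some {Γ : OGraph} {e : Γ.H} {h : Γ.HalfRest e} {v : Γ.Rest e} :
    Γ.contractAtt e h = some v ↔ Γ.att h.1 = v.1 := by
  unfold contractAtt
  split_ifs with hv
  · simp [Subtype.ext_iff]
  · simp only [false_iff]
    intro h'
    exact hv (h' ▸ v.2)

/-- The half-edges at a vertex which is not affected by the contraction. -/
def starSome (Γ : OGraph) (e : Γ.H) (v : Γ.Rest e) :
    Γ.Star v.1 ≃ {h : Γ.HalfRest e // Γ.contractAtt e h = some v} where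
  toFun h := ⟨⟨h.1, fun h' => v.2.1 (h.2.symm.trans (congrArg Γ.att h')),
      fun h' => v.2.2 (h.2.symm.trans (congrArg Γ.att h'))⟩,
    contractAtt_eq_some.2 h.2⟩
  invFun h := ⟨h.1.1, contractAtt_eq_some.1 h.2⟩
  left_inv _ := rfl
  right_inv _ := rfl

/-- The half-edges at the vertex which results from the contraction of an edge that is
not a loop. -/
def starNone (Γ : OGraph) (e : Γ.H) (he : Γ.att e ≠ Γ.att (Γ.opp e)) :
    {h : Γ.Star (Γ.att e) // h ≠ ⟨e, rfl⟩} ⊕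
        {h : Γ.Star (Γ.att (Γ.opp e)) // h ≠ ⟨Γ.opp e, rfl⟩} ≃
      {h : Γ.HalfRest e // Γ.contractAtt e h = none} where
  toFun
    | Sum.inl h => ⟨⟨h.1.1, fun h' => h.2 (Subtype.ext h'),
        fun h' => he (by rw [← h', h.1.2])⟩, contractAtt_eq_none.2 (Or.inl h.1.2)⟩
    | Sum.inr h => ⟨⟨h.1.1, fun h' => he (by rw [← h.1.2, h']),
        fun h' => h.2 (Subtype.ext h')⟩, contractAtt_eq_none.2 (Or.inr h.1.2)⟩
  invFun h :=
    if hv : Γ.att h.1.1 = Γ.att e then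
      Sum.inl ⟨⟨h.1.1, hv⟩, fun h' => h.1.2.1 (congrArg Subtype.val h')⟩
    else
      Sum.inr ⟨⟨h.1.1, (contractAtt_eq_none.1 h.2).resolve_left hv⟩,
        fun h' => h.1.2.2 (congrArg Subtype.val h')⟩
  left_inv := by
    rintro (⟨⟨h, h1⟩, h2⟩ | ⟨⟨h, h1⟩, h2⟩)
    · simp [h1]
    · have : Γ.att h ≠ Γ.att e := fun h' => he (h'.symm.trans h1)
      simp [this]
  right_inv := by
    rintro ⟨⟨h, h1⟩, h2⟩
    dsimp only
    by_cases hv : Γ.att h = Γ.att e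
    · rw [dif_pos hv]
    · rw [dif_neg hv]

/-- The order of the vertices after a contraction: the new vertex is the first one. -/
def firstLt {W : Type} (lt : W → W → Prop) : Option W → Option W → Prop
  | _, none => False
  | none, some _ => True
  | some a, some b => lt a b

/-- Contraction of the edge of `e`, which must not be a loop.  If the endpoints of `e` are the
first two vertices of `Γ` and if the edge is directed from the first to the second, then
this is the induced orientation. -/
def contract (Γ : OGraph) (e : Γ.H) (he : Γ.att e ≠ Γ.att (Γ.opp e)) : OGraph where
  V := Option (Γ.Rest e)
  H := Γ.HalfRest e
  att := Γ.contractAtt e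
  opp h := ⟨Γ.opp h.1, fun h' => h.2.2 ((Γ.opp_opp h.1).symm.trans (congrArg Γ.opp h')),
    fun h' => h.2.1 ((Γ.opp_opp h.1).symm.trans ((congrArg Γ.opp h').trans (Γ.opp_opp e)))⟩
  opp_opp h := Subtype.ext (Γ.opp_opp h.1)
  opp_ne h h' := Γ.opp_ne h.1 (congrArg Subtype.val h')
  lt := firstLt fun v w => Γ.lt v.1 w.1
  lt_order := by
    have h1 := Γ.lt_order
    exact
      { trichotomous := by
          rintro (_ | a) (_ | b) <;> simp [firstLt]
          intro hab hba
          exact Subtype.ext (h1.trichotomous a.1 b.1 hab hba)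
        irrefl := by
          rintro (_ | a) <;> simp [firstLt]
          exact h1.irrefl a.1
        trans := by
          rintro (_ | a) (_ | b) (_ | c) <;> simp [firstLt]
          exact h1.trans a.1 b.1 c.1 }
  out h := Γ.out h.1
  out_opp h := Γ.out_opp h.1
  three_le_valence := by
    rintro (_ | v)
    · have h1 := Nat.card_congr (Γ.starNone e he)
      have h2 := Γ.three_le_valence (Γ.att e)
      have h3 := Γ.three_le_valence (Γ.att (Γ.opp e))
      rw [Nat.card_sum] at h1
      have h4 : ∀ {S : Type} [Finite S] (a : S), Nat.card {s : S // s ≠ a} + 1 = Nat.card S := by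
        intro S _ a
        have := Fintype.ofFinite S
        have : 0 < Fintype.card S := Fintype.card_pos_iff.2 ⟨a⟩
        simp only [Nat.card_eq_fintype_card, ne_eq, Fintype.card_subtype_compl,
          Fintype.card_subtype_eq]
        omega
      have h5 : Nat.card {h : Γ.Star (Γ.att e) // h ≠ ⟨e, rfl⟩} + 1 =
          Nat.card {h // Γ.att h = Γ.att e} := h4 _
      have h6 : Nat.card {h : Γ.Star (Γ.att (Γ.opp e)) // h ≠ ⟨Γ.opp e, rfl⟩} + 1 =
          Nat.card {h // Γ.att h = Γ.att (Γ.opp e)} := h4 _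
      change 3 ≤ Nat.card {h : Γ.HalfRest e // Γ.contractAtt e h = none}
      omega
    · exact (Γ.three_le_valence v.1).trans_eq (Nat.card_congr (Γ.starSome e v))

/-- The number of steps needed to make the endpoints of `e` the first and second vertex: the
number of vertices before the starting point, plus the number of vertices before the end point
other than the starting point. -/
def frontCount (Γ : OGraph) (e : Γ.H) : ℕ :=
  (Finset.univ.filter fun v => Γ.lt v (Γ.att e)).card +
    (Finset.univ.filter fun v => v ≠ Γ.att e ∧ Γ.lt v (Γ.att (Γ.opp e))).card

/-- The sign by which the orientation of `Γ` differs from one for which the edge of `e` is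
directed from the first to the second vertex, the order of the other vertices and the other
directions being unchanged. -/
def contractSign (Γ : OGraph) (e : Γ.H) : ℤ := Γ.dirSign e * (-1) ^ Γ.frontCount e

/-! #### Behaviour of the signs under isomorphisms -/

theorem prod_sign_eq {W : Type} (s : Finset W) (P : W → Prop) [DecidablePred P] :
    ((-1 : ℤ)) ^ (s.filter P).card = ∏ v ∈ s, if P v then -1 else 1 := by
  rw [Finset.prod_ite]
  simp

theorem sign_inversions {V V' : Type} [Fintype V] (lt : V → V → Prop) (lt' : V' → V' → Prop)
    (f : V → V') :
    ((-1 : ℤ)) ^ (inversions lt lt' f).card =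
      ∏ v, ∏ w, if lt v w ∧ lt' (f w) (f v) then -1 else 1 := by
  unfold inversions
  rw [prod_sign_eq, ← Finset.univ_product_univ, Finset.prod_product]

/-- Removing one vertex from an inversion count. -/
theorem prod_inversions_insert {V V' : Type} {lt : V → V → Prop} {lt' : V' → V' → Prop}
    (h : IsStrictTotalOrder V lt) (h' : IsStrictTotalOrder V' lt') (f : V ≃ V')
    (S : Finset V) (a : V) (ha : a ∉ S) :
    (∏ v ∈ insert a S, ∏ w ∈ insert a S, if lt v w ∧ lt' (f w) (f v) then (-1 : ℤ) else 1) =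
      (∏ v ∈ S, ∏ w ∈ S, if lt v w ∧ lt' (f w) (f v) then (-1 : ℤ) else 1) *
        ((∏ v ∈ S, if lt v a then (-1 : ℤ) else 1) *
          ∏ v ∈ S, if lt' (f v) (f a) then (-1 : ℤ) else 1) := by
  have key : ∀ w ∈ S, (if lt a w ∧ lt' (f w) (f a) then (-1 : ℤ) else 1) *
      (if lt w a ∧ lt' (f a) (f w) then (-1 : ℤ) else 1) =
      (if lt w a then (-1 : ℤ) else 1) * (if lt' (f w) (f a) then (-1 : ℤ) else 1) := by
    intro w hw
    have hwa : w ≠ a := fun e => ha (e ▸ hw)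
    have hfwa : f w ≠ f a := fun e => hwa (f.injective e)
    have t1 := h.trichotomous w a
    have t2 := h'.trichotomous (f w) (f a)
    have u1 : ¬ (lt w a ∧ lt a w) := fun e => h.irrefl w (h.trans _ _ _ e.1 e.2)
    have u2 : ¬ (lt' (f w) (f a) ∧ lt' (f a) (f w)) :=
      fun e => h'.irrefl _ (h'.trans _ _ _ e.1 e.2)
    by_cases c1 : lt w a <;> by_cases c2 : lt a w <;> by_cases c3 : lt' (f w) (f a) <;>
      by_cases c4 : lt' (f a) (f w) <;> simp_all
  have haa : ¬ lt a a := h.irrefl a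
  rw [← Finset.prod_mul_distrib, ← Finset.prod_congr rfl key, Finset.prod_mul_distrib,
    Finset.prod_insert ha, Finset.prod_insert ha]
  simp only [Finset.prod_insert ha, Finset.prod_mul_distrib, haa, false_and, if_false, one_mul]
  ring

namespace Iso

variable {Γ Γ' : OGraph}

/-- The identity isomorphism. -/
def refl (Γ : OGraph) : Iso Γ Γ := ⟨Equiv.refl _, Equiv.refl _, fun _ => rfl, fun _ => rfl⟩

theorem sign_eq (f : Iso Γ Γ') : f.sign =
    (∏ v, ∏ w, if Γ.lt v w ∧ Γ'.lt (f.onV w) (f.onV v) then (-1 : ℤ) else 1) *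
      ∏ h, if Γ.out h = true ∧ Γ'.out (f.onH h) = false then (-1 : ℤ) else 1 := by
  unfold sign flips
  rw [sign_inversions, prod_sign_eq]

theorem sign_refl (Γ : OGraph) : (refl Γ).sign = 1 := by
  rw [sign_eq]
  have h1 := Γ.lt_order
  have : ∀ v w : Γ.V, ¬ (Γ.lt v w ∧ Γ.lt w v) :=
    fun v w e => h1.irrefl v (h1.trans _ _ _ e.1 e.2)
  simp [refl, this]

/-- The disjoint union of two isomorphisms. -/
def disjUnion {Δ Δ' : OGraph} (f : Iso Γ Γ') (g : Iso Δ Δ') :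
    Iso (Γ.disjUnion Δ) (Γ'.disjUnion Δ') where
  onV := Equiv.sumCongr f.onV g.onV
  onH := Equiv.sumCongr f.onH g.onH
  att_onH := by
    rintro (h | h)
    · exact congrArg Sum.inl (f.att_onH h)
    · exact congrArg Sum.inr (g.att_onH h)
  opp_onH := by
    rintro (h | h)
    · exact congrArg Sum.inl (f.opp_onH h)
    · exact congrArg Sum.inr (g.opp_onH h)

theorem disjUnion_lt (Γ Γ' : OGraph) (v w : Γ.V ⊕ Γ'.V) :
    (Γ.disjUnion Γ').lt v w ↔ Sum.Lex Γ.lt Γ'.lt v w := Iff.rfl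

theorem disjUnion_onV_inl {Δ Δ' : OGraph} (f : Iso Γ Γ') (g : Iso Δ Δ') (v : Γ.V) :
    (f.disjUnion g).onV (Sum.inl v) = Sum.inl (f.onV v) := rfl

theorem disjUnion_onV_inr {Δ Δ' : OGraph} (f : Iso Γ Γ') (g : Iso Δ Δ') (v : Δ.V) :
    (f.disjUnion g).onV (Sum.inr v) = Sum.inr (g.onV v) := rfl

theorem sign_disjUnion {Δ Δ' : OGraph} (f : Iso Γ Γ') (g : Iso Δ Δ') :
    (f.disjUnion g).sign = f.sign * g.sign := by
  simp only [sign_eq]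
  have hV : (∏ v, ∏ w, if (Γ.disjUnion Δ).lt v w ∧
        (Γ'.disjUnion Δ').lt ((f.disjUnion g).onV w) ((f.disjUnion g).onV v)
        then (-1 : ℤ) else 1) =
      (∏ v, ∏ w, if Γ.lt v w ∧ Γ'.lt (f.onV w) (f.onV v) then (-1 : ℤ) else 1) *
      (∏ v, ∏ w, if Δ.lt v w ∧ Δ'.lt (g.onV w) (g.onV v) then (-1 : ℤ) else 1) := by
    refine (Fintype.prod_sum_type _).trans ?_
    congr 1 <;> refine Finset.prod_congr rfl fun v _ => (Fintype.prod_sum_type _).trans ?_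
    all_goals simp only [disjUnion_lt, disjUnion_onV_inl, disjUnion_onV_inr, Sum.lex_inl_inl,
      Sum.lex_inr_inr, Sum.lex_inr_inl, Sum.Lex.sep, and_false, false_and, if_false,
      Finset.prod_const_one, one_mul, mul_one]
  have hH : (∏ h, if (Γ.disjUnion Δ).out h = true ∧
        (Γ'.disjUnion Δ').out ((f.disjUnion g).onH h) = false then (-1 : ℤ) else 1) =
      (∏ h, if Γ.out h = true ∧ Γ'.out (f.onH h) = false then (-1 : ℤ) else 1) *
      (∏ h, if Δ.out h = true ∧ Δ'.out (g.onH h) = false then (-1 : ℤ) else 1) :=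
    Fintype.prod_sum_type _
  rw [hV, hH]
  ring

theorem indep {f : Iso Γ Γ'} {e₁ e₂ : Γ.H} :
    Γ'.Indep (f.onH e₁) (f.onH e₂) ↔ Γ.Indep e₁ e₂ := by
  unfold Indep
  rw [f.opp_onH, f.onH.injective.ne_iff, f.onH.injective.ne_iff]

/-- The isomorphism induced on the result of gluing a square. -/
def glue (f : Iso Γ Γ') (e₁ e₂ : Γ.H) (he : Γ.Indep e₁ e₂) :
    Iso (Γ.glue e₁ e₂ he) (Γ'.glue (f.onH e₁) (f.onH e₂) (f.indep.2 he)) where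
  onV := f.onV
  onH := f.onH
  att_onH := f.att_onH
  opp_onH := fun (h : Γ.H) => by
    change Γ'.glueOpp (f.onH e₁) (f.onH e₂) (f.onH h) = f.onH (Γ.glueOpp e₁ e₂ h)
    unfold glueOpp
    simp only [f.opp_onH, f.onH.injective.eq_iff]
    split_ifs <;> rfl

theorem dirSign_mul_dirSign (f : Iso Γ Γ') (e : Γ.H) :
    (if Γ.out e = true ∧ Γ'.out (f.onH e) = false then (-1 : ℤ) else 1) *
      (if Γ.out (Γ.opp e) = true ∧ Γ'.out (f.onH (Γ.opp e)) = false then (-1 : ℤ) else 1) =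
      Γ.dirSign e * Γ'.dirSign (f.onH e) := by
  rw [← f.opp_onH, Γ.out_opp, Γ'.out_opp]
  unfold dirSign
  cases Γ.out e <;> cases Γ'.out (f.onH e) <;> simp

theorem dirSign_mul_self (Γ : OGraph) (e : Γ.H) : Γ.dirSign e * Γ.dirSign e = 1 := by
  unfold dirSign
  split_ifs <;> rfl

theorem sign_glue (f : Iso Γ Γ') (e₁ e₂ : Γ.H) (he : Γ.Indep e₁ e₂) :
    Γ.dirSign e₁ * Γ.dirSign e₂ * (f.glue e₁ e₂ he).sign =
      f.sign * (Γ'.dirSign (f.onH e₁) * Γ'.dirSign (f.onH e₂)) := by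
  simp only [sign_eq]
  have hV : (∏ v, ∏ w, if (Γ.glue e₁ e₂ he).lt v w ∧
        (Γ'.glue _ _ (f.indep.2 he)).lt ((f.glue e₁ e₂ he).onV w) ((f.glue e₁ e₂ he).onV v)
        then (-1 : ℤ) else 1) =
      (∏ v, ∏ w, if Γ.lt v w ∧ Γ'.lt (f.onV w) (f.onV v) then (-1 : ℤ) else 1) := rfl
  rw [hV]
  let R : Finset Γ.H := {e₁, Γ.opp e₁, e₂, Γ.opp e₂}
  have h1 : e₁ ∉ ({Γ.opp e₁, e₂, Γ.opp e₂} : Finset Γ.H) := by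
    have := Γ.opp_ne
    have := Γ.opp_opp
    obtain ⟨h1, h2⟩ := he
    simp only [Finset.mem_insert, Finset.mem_singleton]
    grind
  have h2 : Γ.opp e₁ ∉ ({e₂, Γ.opp e₂} : Finset Γ.H) := by
    have := Γ.opp_opp
    obtain ⟨h1, h2⟩ := he
    simp only [Finset.mem_insert, Finset.mem_singleton]
    grind
  have h3 : e₂ ∉ ({Γ.opp e₂} : Finset Γ.H) := by
    simp only [Finset.mem_singleton]
    exact (Γ.opp_ne e₂).symm
  have hF : (∏ h, if Γ.out h = true ∧ Γ'.out (f.onH h) = false then (-1 : ℤ) else 1) =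
      (Γ.dirSign e₁ * Γ'.dirSign (f.onH e₁)) * (Γ.dirSign e₂ * Γ'.dirSign (f.onH e₂)) *
        ∏ h ∈ Rᶜ, if Γ.out h = true ∧ Γ'.out (f.onH h) = false then (-1 : ℤ) else 1 := by
    rw [← Finset.prod_mul_prod_compl R]
    congr 1
    rw [Finset.prod_insert h1, Finset.prod_insert h2, Finset.prod_insert h3,
      Finset.prod_singleton, ← f.dirSign_mul_dirSign e₁, ← f.dirSign_mul_dirSign e₂, mul_assoc]
  have hG : (∏ h, if (Γ.glue e₁ e₂ he).out h = true ∧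
        (Γ'.glue _ _ (f.indep.2 he)).out ((f.glue e₁ e₂ he).onH h) = false
        then (-1 : ℤ) else 1) =
      ∏ h ∈ Rᶜ, if Γ.out h = true ∧ Γ'.out (f.onH h) = false then (-1 : ℤ) else 1 := by
    change (∏ h : Γ.H, if Γ.glueOut e₁ e₂ h = true ∧
      Γ'.glueOut (f.onH e₁) (f.onH e₂) (f.onH h) = false then (-1 : ℤ) else 1) = _
    rw [← Finset.prod_mul_prod_compl R]
    have a1 : ∏ h ∈ R, (if Γ.glueOut e₁ e₂ h = true ∧
        Γ'.glueOut (f.onH e₁) (f.onH e₂) (f.onH h) = false then (-1 : ℤ) else 1) = 1 := by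
      refine Finset.prod_eq_one fun h hh => if_neg ?_
      unfold glueOut
      simp only [f.opp_onH, f.onH.injective.eq_iff]
      simp only [R, Finset.mem_insert, Finset.mem_singleton] at hh
      by_cases c : h = e₁ ∨ h = e₂
      · simp [c]
      · have : h = Γ.opp e₁ ∨ h = Γ.opp e₂ := by tauto
        simp [c, this]
    rw [a1, one_mul]
    refine Finset.prod_congr rfl fun h hh => ?_
    simp only [R, Finset.mem_compl, Finset.mem_insert, Finset.mem_singleton, not_or] at hh
    unfold glueOut
    simp only [f.opp_onH, f.onH.injective.eq_iff]
    simp [hh]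
  rw [hF, hG]
  have d1 := dirSign_mul_self Γ' (f.onH e₁)
  have d2 := dirSign_mul_self Γ' (f.onH e₂)
  linear_combination (- (Γ.dirSign e₁ * Γ.dirSign e₂ *
    (∏ v, ∏ w, if Γ.lt v w ∧ Γ'.lt (f.onV w) (f.onV v) then (-1 : ℤ) else 1) *
    ∏ h ∈ Rᶜ, if Γ.out h = true ∧ Γ'.out (f.onH h) = false then (-1 : ℤ) else 1)) *
      (d1 * Γ'.dirSign (f.onH e₂) * Γ'.dirSign (f.onH e₂) + d2)

theorem loop_iff {f : Iso Γ Γ'} {e : Γ.H} :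
    Γ'.att (f.onH e) = Γ'.att (Γ'.opp (f.onH e)) ↔ Γ.att e = Γ.att (Γ.opp e) := by
  rw [f.opp_onH, f.att_onH, f.att_onH, f.onV.injective.eq_iff]

/-- The isomorphism induced on the result of a contraction. -/
def contract (f : Iso Γ Γ') (e : Γ.H) (he : Γ.att e ≠ Γ.att (Γ.opp e)) :
    Iso (Γ.contract e he) (Γ'.contract (f.onH e) (f.loop_iff.not.2 he)) where
  onV := Equiv.optionCongr (f.onV.subtypeEquiv
    (p := fun v => v ≠ Γ.att e ∧ v ≠ Γ.att (Γ.opp e))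
    (q := fun v => v ≠ Γ'.att (f.onH e) ∧ v ≠ Γ'.att (Γ'.opp (f.onH e))) fun v => by
      rw [f.opp_onH, f.att_onH, f.att_onH, f.onV.injective.ne_iff, f.onV.injective.ne_iff])
  onH := f.onH.subtypeEquiv (p := fun h => h ≠ e ∧ h ≠ Γ.opp e)
    (q := fun h => h ≠ f.onH e ∧ h ≠ Γ'.opp (f.onH e)) fun h => by
      rw [f.opp_onH, f.onH.injective.ne_iff, f.onH.injective.ne_iff]
  att_onH h := by
    change Γ'.contractAtt (f.onH e) _ = _
    rcases hv : Γ.contractAtt e h with _ | v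
    · change _ = Option.map _ (Γ.contractAtt e h)
      rw [hv]
      refine contractAtt_eq_none.2 ?_
      change Γ'.att (f.onH h.1) = _ ∨ Γ'.att (f.onH h.1) = _
      rw [f.opp_onH, f.att_onH, f.att_onH, f.att_onH, f.onV.injective.eq_iff,
        f.onV.injective.eq_iff]
      exact contractAtt_eq_none.1 hv
    · change _ = Option.map _ (Γ.contractAtt e h)
      rw [hv]
      refine contractAtt_eq_some.2 ?_
      change Γ'.att (f.onH h.1) = f.onV v.1
      rw [f.att_onH, contractAtt_eq_some.1 hv]
  opp_onH h := Subtype.ext (f.opp_onH h.1)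

theorem contract_onV_none (f : Iso Γ Γ') (e : Γ.H) (he : Γ.att e ≠ Γ.att (Γ.opp e)) :
    (f.contract e he).onV (none : Option (Γ.Rest e)) =
      (none : Option (Γ'.Rest (f.onH e))) := rfl

theorem contract_lt_some (f : Iso Γ Γ') (e : Γ.H) (he : Γ.att e ≠ Γ.att (Γ.opp e))
    (v w : Γ.Rest e) :
    (Γ'.contract (f.onH e) (f.loop_iff.not.2 he)).lt
        ((f.contract e he).onV (some v : Option (Γ.Rest e)))
        ((f.contract e he).onV (some w : Option (Γ.Rest e))) ↔
      Γ'.lt (f.onV v.1) (f.onV w.1) := Iff.rfl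

theorem contract_lt (Γ : OGraph) (e : Γ.H) (he : Γ.att e ≠ Γ.att (Γ.opp e))
    (v w : Option (Γ.Rest e)) :
    (Γ.contract e he).lt v w ↔ firstLt (fun v w : Γ.Rest e => Γ.lt v.1 w.1) v w := Iff.rfl

theorem firstLt_none {W : Type} (lt : W → W → Prop) (a : Option W) :
    firstLt lt a none ↔ False := by
  cases a <;> rfl

theorem firstLt_some {W : Type} (lt : W → W → Prop) (a b : W) :
    firstLt lt (some a) (some b) ↔ lt a b := Iff.rfl

theorem sign_front (Γ : OGraph) (e : Γ.H) :
    (-1 : ℤ) ^ Γ.frontCount e =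
      (∏ v, if Γ.lt v (Γ.att e) then (-1 : ℤ) else 1) *
        ∏ v, if v ≠ Γ.att e ∧ Γ.lt v (Γ.att (Γ.opp e)) then (-1 : ℤ) else 1 := by
  unfold frontCount
  rw [pow_add, prod_sign_eq, prod_sign_eq]

theorem sign_front_mul_self (Γ : OGraph) (e : Γ.H) :
    (-1 : ℤ) ^ Γ.frontCount e * (-1 : ℤ) ^ Γ.frontCount e = 1 := by
  rw [← mul_pow]
  simp

theorem sign_contract_vertices (f : Iso Γ Γ') (e : Γ.H) (he : Γ.att e ≠ Γ.att (Γ.opp e)) :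
    (∏ v, ∏ w, if Γ.lt v w ∧ Γ'.lt (f.onV w) (f.onV v) then (-1 : ℤ) else 1) =
      (∏ v, ∏ w, if (Γ.contract e he).lt v w ∧
        (Γ'.contract (f.onH e) (f.loop_iff.not.2 he)).lt ((f.contract e he).onV w)
          ((f.contract e he).onV v) then (-1 : ℤ) else 1) *
        ((-1 : ℤ) ^ Γ.frontCount e * (-1 : ℤ) ^ Γ'.frontCount (f.onH e)) := by
  have h1 := Γ.lt_order
  have h2 := Γ'.lt_order
  let S : Finset Γ.V := Finset.univ.filter fun v => v ≠ Γ.att e ∧ v ≠ Γ.att (Γ.opp e)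
  have hS : ∀ v, v ∈ S ↔ v ≠ Γ.att e ∧ v ≠ Γ.att (Γ.opp e) := fun v => by simp [S]
  have hq : Γ.att (Γ.opp e) ∉ S := fun h => ((hS _).1 h).2 rfl
  have hp : Γ.att e ∉ insert (Γ.att (Γ.opp e)) S := fun h =>
    (Finset.mem_insert.1 h).elim he fun h => ((hS _).1 h).1 rfl
  have huniv : (Finset.univ : Finset Γ.V) =
      insert (Γ.att e) (insert (Γ.att (Γ.opp e)) S) := by
    ext v
    simp only [Finset.mem_univ, Finset.mem_insert, hS, true_iff]
    tauto
  have hC : (∏ v, ∏ w, if (Γ.contract e he).lt v w ∧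
        (Γ'.contract (f.onH e) (f.loop_iff.not.2 he)).lt ((f.contract e he).onV w)
          ((f.contract e he).onV v) then (-1 : ℤ) else 1) =
      ∏ v ∈ S, ∏ w ∈ S, if Γ.lt v w ∧ Γ'.lt (f.onV w) (f.onV v) then (-1 : ℤ) else 1 := by
    refine (Fintype.prod_option _).trans ?_
    rw [Finset.prod_subtype S hS]
    have hn : (∏ w, if (Γ.contract e he).lt (none : Option (Γ.Rest e)) w ∧
        (Γ'.contract (f.onH e) (f.loop_iff.not.2 he)).lt ((f.contract e he).onV w)
          ((f.contract e he).onV (none : Option (Γ.Rest e))) then (-1 : ℤ) else 1) = 1 := by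
      refine Finset.prod_eq_one fun w _ => if_neg fun h => ?_
      exact (firstLt_none (fun v w : Γ'.Rest (f.onH e) => Γ'.lt v.1 w.1)
        ((f.contract e he).onV w)).1 h.2
    rw [hn, one_mul]
    refine Finset.prod_congr rfl fun v _ => (Fintype.prod_option _).trans ?_
    refine Eq.trans ?_
      (Finset.prod_subtype (F := (inferInstance : Fintype (Γ.Rest e))) S hS _).symm
    simp only [contract_lt_some, contract_lt, firstLt_none, firstLt_some, false_and, if_false,
      one_mul]
  have hfront : (-1 : ℤ) ^ Γ.frontCount e =
      (∏ v ∈ insert (Γ.att (Γ.opp e)) S, if Γ.lt v (Γ.att e) then (-1 : ℤ) else 1) *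
        ∏ v ∈ S, if Γ.lt v (Γ.att (Γ.opp e)) then (-1 : ℤ) else 1 := by
    rw [sign_front, huniv]
    congr 1
    · rw [Finset.prod_insert hp, if_neg (h1.irrefl _), one_mul]
    rw [Finset.prod_insert hp, Finset.prod_insert hq, if_neg (fun h => h.1 rfl),
      if_neg (fun h => h1.irrefl _ h.2), one_mul, one_mul]
    refine Finset.prod_congr rfl fun v hv => if_congr ?_ rfl rfl
    exact and_iff_right ((hS v).1 hv).1
  have hfront' : (-1 : ℤ) ^ Γ'.frontCount (f.onH e) =
      (∏ v ∈ insert (Γ.att (Γ.opp e)) S,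
        if Γ'.lt (f.onV v) (f.onV (Γ.att e)) then (-1 : ℤ) else 1) *
        ∏ v ∈ S, if Γ'.lt (f.onV v) (f.onV (Γ.att (Γ.opp e))) then (-1 : ℤ) else 1 := by
    rw [sign_front, f.opp_onH, f.att_onH, f.att_onH, ← Equiv.prod_comp f.onV,
      ← Equiv.prod_comp f.onV (fun v => if v ≠ f.onV (Γ.att e) ∧
        Γ'.lt v (f.onV (Γ.att (Γ.opp e))) then (-1 : ℤ) else 1), huniv]
    congr 1
    · rw [Finset.prod_insert hp, if_neg (h2.irrefl _), one_mul]
    rw [Finset.prod_insert hp, Finset.prod_insert hq, if_neg (fun h => h.1 rfl),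
      if_neg (fun h => h2.irrefl _ h.2), one_mul, one_mul]
    refine Finset.prod_congr rfl fun v hv => if_congr ?_ rfl rfl
    exact and_iff_right (f.onV.injective.ne ((hS v).1 hv).1)
  rw [hC, hfront, hfront', huniv, prod_inversions_insert h1 h2 f.onV _ _ hp,
    prod_inversions_insert h1 h2 f.onV _ _ hq]
  ring

theorem sign_contract_edges (f : Iso Γ Γ') (e : Γ.H) (he : Γ.att e ≠ Γ.att (Γ.opp e)) :
    (∏ h, if Γ.out h = true ∧ Γ'.out (f.onH h) = false then (-1 : ℤ) else 1) =
      (∏ h, if (Γ.contract e he).out h = true ∧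
        (Γ'.contract (f.onH e) (f.loop_iff.not.2 he)).out ((f.contract e he).onH h) = false
        then (-1 : ℤ) else 1) * (Γ.dirSign e * Γ'.dirSign (f.onH e)) := by
  let S : Finset Γ.H := Finset.univ.filter fun h => h ≠ e ∧ h ≠ Γ.opp e
  have hS : ∀ h, h ∈ S ↔ h ≠ e ∧ h ≠ Γ.opp e := fun v => by simp [S]
  have hq : Γ.opp e ∉ S := fun h => ((hS _).1 h).2 rfl
  have hp : e ∉ insert (Γ.opp e) S := fun h =>
    (Finset.mem_insert.1 h).elim (fun h => Γ.opp_ne e h.symm) fun h => ((hS _).1 h).1 rfl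
  have huniv : (Finset.univ : Finset Γ.H) = insert e (insert (Γ.opp e) S) := by
    ext v
    simp only [Finset.mem_univ, Finset.mem_insert, hS, true_iff]
    tauto
  rw [huniv, Finset.prod_insert hp, Finset.prod_insert hq, ← mul_assoc, f.dirSign_mul_dirSign,
    mul_comm, Finset.prod_subtype S hS]
  rfl

theorem sign_contract (f : Iso Γ Γ') (e : Γ.H) (he : Γ.att e ≠ Γ.att (Γ.opp e)) :
    Γ.contractSign e * (f.contract e he).sign = f.sign * Γ'.contractSign (f.onH e) := by
  rw [sign_eq, sign_eq, sign_contract_vertices f e he, sign_contract_edges f e he]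
  unfold contractSign
  have d1 := dirSign_mul_self Γ' (f.onH e)
  have d2 := sign_front_mul_self Γ' (f.onH e)
  generalize (∏ v, ∏ w, if (Γ.contract e he).lt v w ∧
        (Γ'.contract (f.onH e) (f.loop_iff.not.2 he)).lt ((f.contract e he).onV w)
          ((f.contract e he).onV v) then (-1 : ℤ) else 1) = A
  generalize (∏ h, if (Γ.contract e he).out h = true ∧
        (Γ'.contract (f.onH e) (f.loop_iff.not.2 he)).out ((f.contract e he).onH h) = false
        then (-1 : ℤ) else 1) = B
  generalize (-1 : ℤ) ^ Γ'.frontCount (f.onH e) = C at *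
  generalize (-1 : ℤ) ^ Γ.frontCount e = D
  linear_combination (-(A * B * Γ.dirSign e * D)) *
    (d1 * C * C + d2)

end Iso

/-- Two vertices are in the same component if and only if their images are. -/
def Iso.components {Γ Γ' : OGraph} (f : Iso Γ Γ') : Γ.Components ≃ Γ'.Components :=
  Quot.congr f.onV fun v w => by
    constructor
    · rintro ⟨h, rfl, rfl⟩
      exact ⟨f.onH h, f.att_onH h, by rw [f.opp_onH, f.att_onH]⟩
    · rintro ⟨h, h1, h2⟩
      obtain ⟨h, rfl⟩ := f.onH.surjective h
      rw [f.opp_onH] at h2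
      rw [f.att_onH] at h1 h2
      exact ⟨h, f.onV.injective h1, f.onV.injective h2⟩

end OGraph

/-! ### The graph complex -/

section

variable {k : Type u} [Field k] (O : CyclicOperad.{u, w} k)

/-- An oriented graph with an element of `𝒪((H(v)))` at each vertex `v`. -/
structure LabelledGraph where
  graph : OGraph
  label : ∀ v, O.obj (graph.Star v)

/-- The relations between labelled oriented graphs: an isomorphism of labelled graphs which
changes the orientation by a sign identifies a graph with that sign times the other one
(in particular `(G, -or) = -(G, or)`), and a graph depends linearly on the label of each vertex. -/
inductive GraphRelation : (LabelledGraph O →₀ k) → Prop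
  | iso {Γ Γ' : OGraph} (f : Γ.Iso Γ') (x : ∀ v, O.obj (Γ.Star v)) (y : ∀ v, O.obj (Γ'.Star v))
      (h : ∀ v, y (f.onV v) = O.map (f.star v) (x v)) :
      GraphRelation (Finsupp.single ⟨Γ, x⟩ 1 - f.sign • Finsupp.single ⟨Γ', y⟩ 1)
  | add (Γ : OGraph) (x : ∀ v, O.obj (Γ.Star v)) (v : Γ.V) (a b : O.obj (Γ.Star v)) :
      GraphRelation (Finsupp.single ⟨Γ, Function.update x v (a + b)⟩ 1 -
        Finsupp.single ⟨Γ, Function.update x v a⟩ 1 - Finsupp.single ⟨Γ, Function.update x v b⟩ 1)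
  | smul (Γ : OGraph) (x : ∀ v, O.obj (Γ.Star v)) (v : Γ.V) (c : k) (a : O.obj (Γ.Star v)) :
      GraphRelation (Finsupp.single ⟨Γ, Function.update x v (c • a)⟩ 1 -
        c • Finsupp.single ⟨Γ, Function.update x v a⟩ 1)

/-- The space `𝒢^𝒪` spanned by `𝒪`-labelled oriented graphs. -/
abbrev GraphSpace : Type _ :=
  (LabelledGraph O →₀ k) ⧸ Submodule.span k {r | GraphRelation O r}

end

section

variable {k : Type u} [Field k] {O : CyclicOperad.{u, w} k}

/-- The class of a labelled oriented graph in `𝒢^𝒪`. -/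
def graphClass (X : LabelledGraph O) : GraphSpace O :=
  Submodule.Quotient.mk (Finsupp.single X 1)

/-- A function on labelled graphs which is compatible with the relations of `𝒢^𝒪`. -/
structure Respects {M : Type*} [AddCommGroup M] [Module k M] (F : LabelledGraph O → M) :
    Prop where
  iso : ∀ {Γ Γ' : OGraph} (f : Γ.Iso Γ') (x : ∀ v, O.obj (Γ.Star v))
    (y : ∀ v, O.obj (Γ'.Star v)), (∀ v, y (f.onV v) = O.map (f.star v) (x v)) →
      F ⟨Γ, x⟩ = f.sign • F ⟨Γ', y⟩
  add : ∀ (Γ : OGraph) (x : ∀ v, O.obj (Γ.Star v)) (v : Γ.V) (a b : O.obj (Γ.Star v)),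
    F ⟨Γ, Function.update x v (a + b)⟩ =
      F ⟨Γ, Function.update x v a⟩ + F ⟨Γ, Function.update x v b⟩
  smul : ∀ (Γ : OGraph) (x : ∀ v, O.obj (Γ.Star v)) (v : Γ.V) (c : k) (a : O.obj (Γ.Star v)),
    F ⟨Γ, Function.update x v (c • a)⟩ = c • F ⟨Γ, Function.update x v a⟩

/-- The linear map on `𝒢^𝒪` with prescribed values on labelled graphs. -/
def graphLift {M : Type*} [AddCommGroup M] [Module k M] (F : LabelledGraph O → M)
    (hF : Respects F) : GraphSpace O →ₗ[k] M :=
  Submodule.liftQ _ (Finsupp.linearCombination k F) <| by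
    rw [Submodule.span_le]
    rintro r (⟨f, x, y, h⟩ | ⟨Γ, x, v, a, b⟩ | ⟨Γ, x, v, c, a⟩)
    · rw [SetLike.mem_coe, LinearMap.mem_ker, map_sub, map_zsmul]
      simp [hF.iso f x y h]
    · simp [hF.add Γ x v a b]
    · simp [hF.smul Γ x v c a]

theorem graphLift_graphClass {M : Type*} [AddCommGroup M] [Module k M] (F : LabelledGraph O → M)
    (hF : Respects F) (X : LabelledGraph O) : graphLift F hF (graphClass X) = F X := by
  unfold graphLift graphClass
  rw [Submodule.liftQ_apply]
  simp

theorem respects_graphClass : Respects (graphClass (O := O)) where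
  iso f x y h := by
    have := (Submodule.Quotient.mk_eq_zero _).2
      (Submodule.subset_span (R := k) (GraphRelation.iso f x y h))
    rw [Submodule.Quotient.mk_sub, Submodule.Quotient.mk_smul, sub_eq_zero] at this
    exact this
  add Γ x v a b := by
    have := (Submodule.Quotient.mk_eq_zero _).2
      (Submodule.subset_span (R := k) (GraphRelation.add (O := O) Γ x v a b))
    rw [Submodule.Quotient.mk_sub, Submodule.Quotient.mk_sub, sub_sub, sub_eq_zero] at this
    exact this
  smul Γ x v c a := by
    have := (Submodule.Quotient.mk_eq_zero _).2
      (Submodule.subset_span (R := k) (GraphRelation.smul (O := O) Γ x v c a))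
    rw [Submodule.Quotient.mk_sub, Submodule.Quotient.mk_smul, sub_eq_zero] at this
    exact this

theorem respects_zero {M : Type*} [AddCommGroup M] [Module k M] :
    Respects (O := O) (fun _ => (0 : M)) :=
  ⟨fun _ _ _ _ => by simp, fun _ _ _ _ _ => by simp, fun _ _ _ _ _ => by simp⟩

theorem graphSpace_hom_ext {M : Type*} [AddCommGroup M] [Module k M]
    {F G : GraphSpace O →ₗ[k] M} (h : ∀ X, F (graphClass X) = G (graphClass X)) : F = G := by
  refine Submodule.linearMap_qext _ (Finsupp.lhom_ext' fun X => LinearMap.ext_ring ?_)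
  exact h X

theorem eq_map_of_eq {Γ Γ' : OGraph} (f : Γ.Iso Γ') (x : ∀ v, O.obj (Γ.Star v))
    (y : ∀ v, O.obj (Γ'.Star v)) (h : ∀ v, y (f.onV v) = O.map (f.star v) (x v))
    (v : Γ.V) (w : Γ'.V) (e : w = f.onV v) :
    y w = O.map (f.starTo v w e) (x v) := by
  subst e
  exact h v

/-! #### Contraction -/

/-- The labels after a contraction: at the new vertex, the labels of the two endpoints are
composed along the edge. -/
def contractLabel (Γ : OGraph) (x : ∀ v, O.obj (Γ.Star v)) (e : Γ.H)
    (he : Γ.att e ≠ Γ.att (Γ.opp e)) :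
    ∀ v : (Γ.contract e he).V, O.obj ((Γ.contract e he).Star v)
  | none => O.map (Γ.starNone e he)
      (O.comp (⟨e, rfl⟩ : Γ.Star (Γ.att e)) (⟨Γ.opp e, rfl⟩ : Γ.Star (Γ.att (Γ.opp e)))
        (x (Γ.att e)) (x (Γ.att (Γ.opp e))))
  | some v => O.map (Γ.starSome e v) (x v.1)

/-- The contraction `(G, or)_e` of a labelled oriented graph along the edge `e`,
as an element of `𝒢^𝒪`; it is zero if `e` is a loop. -/
def contractClass (X : LabelledGraph O) (e : X.graph.H) : GraphSpace O :=
  if he : X.graph.att e ≠ X.graph.att (X.graph.opp e) then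
    X.graph.contractSign e • graphClass ⟨X.graph.contract e he, contractLabel X.graph X.label e he⟩
  else 0

theorem contractLabel_iso {Γ Γ' : OGraph} (f : Γ.Iso Γ') (x : ∀ v, O.obj (Γ.Star v))
    (y : ∀ v, O.obj (Γ'.Star v)) (h : ∀ v, y (f.onV v) = O.map (f.star v) (x v)) (e : Γ.H)
    (he : Γ.att e ≠ Γ.att (Γ.opp e)) (v : (Γ.contract e he).V) :
    contractLabel Γ' y (f.onH e) (f.loop_iff.not.2 he) ((f.contract e he).onV v) =
      O.map ((f.contract e he).star v) (contractLabel Γ x e he v) := by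
  rcases v with _ | v
  · change O.map _ (O.comp _ _ _ _) = O.map _ (O.map _ (O.comp _ _ _ _))
    rw [eq_map_of_eq f x y h (Γ.att e) _ (f.att_onH e),
      eq_map_of_eq f x y h (Γ.att (Γ.opp e)) (Γ'.att (Γ'.opp (f.onH e)))
        (by rw [f.opp_onH, f.att_onH])]
    exact O.map_comp_eq (f.starTo (Γ.att e) (Γ'.att (f.onH e)) (f.att_onH e))
      (f.starTo (Γ.att (Γ.opp e)) (Γ'.att (Γ'.opp (f.onH e))) (by rw [f.opp_onH, f.att_onH]))
      ⟨e, rfl⟩ ⟨Γ.opp e, rfl⟩ ⟨f.onH e, rfl⟩ ⟨Γ'.opp (f.onH e), rfl⟩ rfl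
      (Subtype.ext (f.opp_onH e).symm) (Γ.starNone e he)
      (Γ'.starNone (f.onH e) (f.loop_iff.not.2 he)) ((f.contract e he).star none)
      (fun _ _ => rfl) (fun _ _ => rfl) (x (Γ.att e)) (x (Γ.att (Γ.opp e)))
  · change O.map _ (y (f.onV v.1)) = O.map _ (O.map _ (x v.1))
    rw [h]
    have hv : f.onV v.1 ≠ Γ'.att (f.onH e) ∧ f.onV v.1 ≠ Γ'.att (Γ'.opp (f.onH e)) := by
      rw [f.opp_onH, f.att_onH, f.att_onH, f.onV.injective.ne_iff, f.onV.injective.ne_iff]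
      exact v.2
    exact O.map_map_eq (f.star v.1) (Γ'.starSome (f.onH e) ⟨f.onV v.1, hv⟩) (Γ.starSome e v)
      ((f.contract e he).star (some v)) (fun _ => rfl) (x v.1)

theorem contractClass_iso {Γ Γ' : OGraph} (f : Γ.Iso Γ') (x : ∀ v, O.obj (Γ.Star v))
    (y : ∀ v, O.obj (Γ'.Star v)) (h : ∀ v, y (f.onV v) = O.map (f.star v) (x v)) (e : Γ.H) :
    contractClass ⟨Γ, x⟩ e = f.sign • contractClass ⟨Γ', y⟩ (f.onH e) := by
  unfold contractClass
  by_cases he : Γ.att e ≠ Γ.att (Γ.opp e)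
  · rw [dif_pos he, dif_pos (f.loop_iff.not.2 he)]
    rw [respects_graphClass.iso (f.contract e he) _ _ (contractLabel_iso f x y h e he),
      smul_smul, smul_smul, f.sign_contract e he]
  · rw [dif_neg he, dif_neg (fun h' => he (f.loop_iff.not.1 h')), smul_zero]

theorem contractLabel_update (Γ : OGraph) (e : Γ.H) (he : Γ.att e ≠ Γ.att (Γ.opp e))
    (x : ∀ v, O.obj (Γ.Star v)) (v : Γ.V) :
    ∃ (w : (Γ.contract e he).V) (L : O.obj (Γ.Star v) →ₗ[k] O.obj ((Γ.contract e he).Star w)),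
      ∀ a, contractLabel Γ (Function.update x v a) e he =
        Function.update (contractLabel Γ x e he) w (L a) := by
  by_cases hv : v ≠ Γ.att e ∧ v ≠ Γ.att (Γ.opp e)
  · refine ⟨(some ⟨v, hv⟩ : Option (Γ.Rest e)), O.map (Γ.starSome e ⟨v, hv⟩), fun a =>
      Function.eq_update_iff.2 ⟨?_, ?_⟩⟩
    · change O.map _ (Function.update x v a v) = _
      rw [Function.update_self]
      rfl
    · rintro (_ | w) hw
      · change O.map _ (O.comp _ _ _ _) = O.map _ (O.comp _ _ _ _)
        rw [Function.update_of_ne hv.1.symm, Function.update_of_ne hv.2.symm]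
      · change O.map _ (Function.update x v a w.1) = O.map _ (x w.1)
        rw [Function.update_of_ne (fun h => hw (congrArg some (Subtype.ext h)))]
  · have hsome : ∀ a (w : Γ.Rest e), contractLabel Γ (Function.update x v a) e he (some w) =
        contractLabel Γ x e he (some w) := by
      intro a w
      change O.map _ (Function.update x v a w.1) = O.map _ (x w.1)
      have hw : w.1 ≠ v := fun h => by
        subst h
        exact hv w.2
      rw [Function.update_of_ne hw]
    by_cases hp : v = Γ.att e
    · subst hp
      refine ⟨(none : Option (Γ.Rest e)), (O.map (Γ.starNone e he)).comp
        ((O.comp (⟨e, rfl⟩ : Γ.Star (Γ.att e))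
          (⟨Γ.opp e, rfl⟩ : Γ.Star (Γ.att (Γ.opp e)))).flip (x (Γ.att (Γ.opp e)))), fun a =>
            Function.eq_update_iff.2 ⟨?_, ?_⟩⟩
      · change O.map _ (O.comp _ _ _ _) = O.map _ (O.comp _ _ _ _)
        rw [Function.update_self, Function.update_of_ne he.symm]
      · rintro (_ | w) hw
        · exact (hw rfl).elim
        · exact hsome a w
    · have hq : v = Γ.att (Γ.opp e) := by tauto
      subst hq
      refine ⟨(none : Option (Γ.Rest e)), (O.map (Γ.starNone e he)).comp
        (O.comp (⟨e, rfl⟩ : Γ.Star (Γ.att e))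
          (⟨Γ.opp e, rfl⟩ : Γ.Star (Γ.att (Γ.opp e))) (x (Γ.att e))), fun a =>
            Function.eq_update_iff.2 ⟨?_, ?_⟩⟩
      · change O.map _ (O.comp _ _ _ _) = O.map _ (O.comp _ _ _ _)
        rw [Function.update_self, Function.update_of_ne he]
      · rintro (_ | w) hw
        · exact (hw rfl).elim
        · exact hsome a w

theorem contractClass_add (Γ : OGraph) (e : Γ.H) (x : ∀ v, O.obj (Γ.Star v)) (v : Γ.V)
    (a b : O.obj (Γ.Star v)) :
    contractClass ⟨Γ, Function.update x v (a + b)⟩ e =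
      contractClass ⟨Γ, Function.update x v a⟩ e + contractClass ⟨Γ, Function.update x v b⟩ e := by
  unfold contractClass
  dsimp only
  by_cases he : Γ.att e ≠ Γ.att (Γ.opp e)
  · obtain ⟨w, L, hL⟩ := contractLabel_update Γ e he x v
    rw [dif_pos he, dif_pos he, dif_pos he, hL, hL, hL, map_add, respects_graphClass.add, smul_add]
  · rw [dif_neg he, dif_neg he, dif_neg he, add_zero]

theorem contractClass_smul (Γ : OGraph) (e : Γ.H) (x : ∀ v, O.obj (Γ.Star v)) (v : Γ.V)
    (c : k) (a : O.obj (Γ.Star v)) :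
    contractClass ⟨Γ, Function.update x v (c • a)⟩ e =
      c • contractClass ⟨Γ, Function.update x v a⟩ e := by
  unfold contractClass
  dsimp only
  by_cases he : Γ.att e ≠ Γ.att (Γ.opp e)
  · obtain ⟨w, L, hL⟩ := contractLabel_update Γ e he x v
    rw [dif_pos he, dif_pos he, hL, hL, map_smul, respects_graphClass.smul, smul_comm]
  · rw [dif_neg he, dif_neg he, smul_zero]

/-! #### Gluing a square and contracting one of the new edges -/

/-- The graph `(G⟨e₁, e₂⟩)_e`, as an element of `𝒢^𝒪`.  Here `e` is the edge which comes
from the side of the square leading from its side glued to `e₁` to its side glued to `e₂`: if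
`e₁` runs from `a` to `b` and `e₂` from `c` to `d`, this is the new edge
between `b` and `c`, which with its induced direction is the half-edge `e₂` followed by the
half-edge `opp e₁`.  The signs make the directed edges `e₁`, `e₂` consistent with the
orientation of the graph. -/
def fuseClass (X : LabelledGraph O) (e₁ e₂ : X.graph.H) : GraphSpace O :=
  if he : X.graph.Indep e₁ e₂ then
    (X.graph.dirSign e₁ * X.graph.dirSign e₂) •
      contractClass ⟨X.graph.glue e₁ e₂ he, X.label⟩ e₂
  else 0

theorem fuseClass_iso {Γ Γ' : OGraph} (f : Γ.Iso Γ') (x : ∀ v, O.obj (Γ.Star v))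
    (y : ∀ v, O.obj (Γ'.Star v)) (h : ∀ v, y (f.onV v) = O.map (f.star v) (x v))
    (e₁ e₂ : Γ.H) :
    fuseClass ⟨Γ, x⟩ e₁ e₂ = f.sign • fuseClass ⟨Γ', y⟩ (f.onH e₁) (f.onH e₂) := by
  unfold fuseClass
  by_cases he : Γ.Indep e₁ e₂
  · rw [dif_pos he, dif_pos (f.indep.2 he)]
    dsimp only
    rw [contractClass_iso (f.glue e₁ e₂ he) x y h e₂, smul_smul, smul_smul,
      f.sign_glue e₁ e₂ he]
    rfl
  · rw [dif_neg he, dif_neg (fun h' => he (f.indep.1 h')), smul_zero]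

theorem fuseClass_add (Γ : OGraph) (e₁ e₂ : Γ.H) (x : ∀ v, O.obj (Γ.Star v)) (v : Γ.V)
    (a b : O.obj (Γ.Star v)) :
    fuseClass ⟨Γ, Function.update x v (a + b)⟩ e₁ e₂ =
      fuseClass ⟨Γ, Function.update x v a⟩ e₁ e₂ +
        fuseClass ⟨Γ, Function.update x v b⟩ e₁ e₂ := by
  unfold fuseClass
  dsimp only
  by_cases he : Γ.Indep e₁ e₂
  · rw [dif_pos he, dif_pos he, dif_pos he, ← smul_add]
    congr 1
    exact contractClass_add (Γ.glue e₁ e₂ he) e₂ x v a b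
  · rw [dif_neg he, dif_neg he, dif_neg he, add_zero]

theorem fuseClass_smul (Γ : OGraph) (e₁ e₂ : Γ.H) (x : ∀ v, O.obj (Γ.Star v)) (v : Γ.V)
    (c : k) (a : O.obj (Γ.Star v)) :
    fuseClass ⟨Γ, Function.update x v (c • a)⟩ e₁ e₂ =
      c • fuseClass ⟨Γ, Function.update x v a⟩ e₁ e₂ := by
  unfold fuseClass
  dsimp only
  by_cases he : Γ.Indep e₁ e₂
  · rw [dif_pos he, dif_pos he, smul_comm]
    congr 1
    exact contractClass_smul (Γ.glue e₁ e₂ he) e₂ x v c a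
  · rw [dif_neg he, dif_neg he, smul_zero]

/-! #### Disjoint unions of labelled graphs -/

/-- The disjoint union of two labelled graphs. -/
def LabelledGraph.disjUnion (X Y : LabelledGraph O) : LabelledGraph O where
  graph := X.graph.disjUnion Y.graph
  label
    | Sum.inl v => O.map (X.graph.starInl Y.graph v) (X.label v)
    | Sum.inr v => O.map (X.graph.starInr Y.graph v) (Y.label v)

theorem disjUnion_label_iso {Γ Γ' Δ Δ' : OGraph} (f : Γ.Iso Γ') (g : Δ.Iso Δ')
    (x : ∀ v, O.obj (Γ.Star v)) (y : ∀ v, O.obj (Γ'.Star v))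
    (h : ∀ v, y (f.onV v) = O.map (f.star v) (x v))
    (x' : ∀ v, O.obj (Δ.Star v)) (y' : ∀ v, O.obj (Δ'.Star v))
    (h' : ∀ v, y' (g.onV v) = O.map (g.star v) (x' v)) (v : (Γ.disjUnion Δ).V) :
    (LabelledGraph.disjUnion ⟨Γ', y⟩ ⟨Δ', y'⟩).label ((f.disjUnion g).onV v) =
      O.map ((f.disjUnion g).star v) ((LabelledGraph.disjUnion ⟨Γ, x⟩ ⟨Δ, x'⟩).label v) := by
  rcases v with v | v
  · change O.map _ (y (f.onV v)) = O.map _ (O.map _ (x v))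
    rw [h]
    exact O.map_map_eq (f.star v) (Γ'.starInl Δ' (f.onV v)) (Γ.starInl Δ v)
      ((f.disjUnion g).star (Sum.inl v)) (fun _ => rfl) (x v)
  · change O.map _ (y' (g.onV v)) = O.map _ (O.map _ (x' v))
    rw [h']
    exact O.map_map_eq (g.star v) (Γ'.starInr Δ' (g.onV v)) (Γ.starInr Δ v)
      ((f.disjUnion g).star (Sum.inr v)) (fun _ => rfl) (x' v)

theorem disjUnion_update_left (Γ : OGraph) (Y : LabelledGraph O) (x : ∀ v, O.obj (Γ.Star v))
    (v : Γ.V) (a : O.obj (Γ.Star v)) :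
    (LabelledGraph.disjUnion ⟨Γ, Function.update x v a⟩ Y).label =
      Function.update (LabelledGraph.disjUnion ⟨Γ, x⟩ Y).label
        (Sum.inl v : Γ.V ⊕ Y.graph.V) (O.map (Γ.starInl Y.graph v) a) := by
  refine Function.eq_update_iff.2 ⟨?_, ?_⟩
  · change O.map _ (Function.update x v a v) = _
    rw [Function.update_self]
  · rintro (w | w) hw
    · change O.map _ (Function.update x v a w) = O.map _ (x w)
      rw [Function.update_of_ne (fun h => hw (congrArg Sum.inl h))]
    · rfl

theorem disjUnion_update_right (X : LabelledGraph O) (Γ : OGraph) (x : ∀ v, O.obj (Γ.Star v))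
    (v : Γ.V) (a : O.obj (Γ.Star v)) :
    (LabelledGraph.disjUnion X ⟨Γ, Function.update x v a⟩).label =
      Function.update (LabelledGraph.disjUnion X ⟨Γ, x⟩).label
        (Sum.inr v : X.graph.V ⊕ Γ.V) (O.map (X.graph.starInr Γ v) a) := by
  refine Function.eq_update_iff.2 ⟨?_, ?_⟩
  · change O.map _ (Function.update x v a v) = _
    rw [Function.update_self]
  · rintro (w | w) hw
    · rfl
    · change O.map _ (Function.update x v a w) = O.map _ (x w)
      rw [Function.update_of_ne (fun h => hw (congrArg Sum.inr h))]

theorem fuseClass_update_left (Γ : OGraph) (Y : LabelledGraph O) (x : ∀ v, O.obj (Γ.Star v))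
    (v : Γ.V) (a : O.obj (Γ.Star v)) (e₁ e₂ : Γ.H ⊕ Y.graph.H) :
    fuseClass (LabelledGraph.disjUnion ⟨Γ, Function.update x v a⟩ Y) e₁ e₂ =
      fuseClass ⟨Γ.disjUnion Y.graph, Function.update (LabelledGraph.disjUnion ⟨Γ, x⟩ Y).label
        (Sum.inl v : Γ.V ⊕ Y.graph.V) (O.map (Γ.starInl Y.graph v) a)⟩ e₁ e₂ :=
  congrArg (fun L => fuseClass ⟨Γ.disjUnion Y.graph, L⟩ e₁ e₂) (disjUnion_update_left Γ Y x v a)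

theorem fuseClass_update_right (X : LabelledGraph O) (Γ : OGraph) (x : ∀ v, O.obj (Γ.Star v))
    (v : Γ.V) (a : O.obj (Γ.Star v)) (e₁ e₂ : X.graph.H ⊕ Γ.H) :
    fuseClass (LabelledGraph.disjUnion X ⟨Γ, Function.update x v a⟩) e₁ e₂ =
      fuseClass ⟨X.graph.disjUnion Γ, Function.update (LabelledGraph.disjUnion X ⟨Γ, x⟩).label
        (Sum.inr v : X.graph.V ⊕ Γ.V) (O.map (X.graph.starInr Γ v) a)⟩ e₁ e₂ :=
  congrArg (fun L => fuseClass ⟨X.graph.disjUnion Γ, L⟩ e₁ e₂)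
    (disjUnion_update_right X Γ x v a)

/-! ### Fusion and fission -/

/-- The value of `φ₂` on labelled graphs `X` and `Y`: the sum of `(X·Y)⟨e₁, e₂⟩_e` over
all pairs of directed edges `e₁`, `e₂` of `X·Y` which lie in separate graphs. -/
def fusionSum (X Y : LabelledGraph O) : GraphSpace O :=
  ∑ p : (X.graph.H ⊕ Y.graph.H) × (X.graph.H ⊕ Y.graph.H),
    if p.1.isLeft ≠ p.2.isLeft then fuseClass (X.disjUnion Y) p.1 p.2 else 0

theorem fusionSum_iso {Γ Γ' Δ Δ' : OGraph} (f : Γ.Iso Γ') (g : Δ.Iso Δ')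
    (x : ∀ v, O.obj (Γ.Star v)) (y : ∀ v, O.obj (Γ'.Star v))
    (h : ∀ v, y (f.onV v) = O.map (f.star v) (x v))
    (x' : ∀ v, O.obj (Δ.Star v)) (y' : ∀ v, O.obj (Δ'.Star v))
    (h' : ∀ v, y' (g.onV v) = O.map (g.star v) (x' v)) :
    fusionSum ⟨Γ, x⟩ ⟨Δ, x'⟩ = (f.sign * g.sign) • fusionSum ⟨Γ', y⟩ ⟨Δ', y'⟩ := by
  unfold fusionSum
  rw [Finset.smul_sum]
  refine Fintype.sum_equiv (Equiv.prodCongr (Equiv.sumCongr f.onH g.onH)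
    (Equiv.sumCongr f.onH g.onH)) _ _ ?_
  rintro ⟨e₁, e₂⟩
  have key := fuseClass_iso (f.disjUnion g) _ _ (disjUnion_label_iso f g x y h x' y' h') e₁ e₂
  rw [f.sign_disjUnion] at key
  have hl : ∀ e : Γ.H ⊕ Δ.H, (Equiv.sumCongr f.onH g.onH e).isLeft = e.isLeft := by
    rintro (e | e) <;> rfl
  change (if e₁.isLeft ≠ e₂.isLeft then _ else _) =
    _ • (if (Equiv.sumCongr f.onH g.onH e₁).isLeft ≠ (Equiv.sumCongr f.onH g.onH e₂).isLeft
      then _ else _)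
  rw [hl, hl]
  split_ifs with hs
  · exact key
  · rw [smul_zero]

theorem Iso.star_refl (Γ : OGraph) (x : ∀ v, O.obj (Γ.Star v)) (v : Γ.V) :
    x ((OGraph.Iso.refl Γ).onV v) = O.map ((OGraph.Iso.refl Γ).star v) (x v) :=
  (O.map_refl (x v)).symm

theorem respects_fusionSum_right (X : LabelledGraph O) : Respects (fun Y => fusionSum X Y) where
  iso f x y h := by
    have := fusionSum_iso (OGraph.Iso.refl X.graph) f X.label X.label
      (Iso.star_refl X.graph X.label) x y h
    rwa [OGraph.Iso.sign_refl, one_mul] at this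
  add Γ x v a b := by
    unfold fusionSum
    rw [← Finset.sum_add_distrib]
    refine Finset.sum_congr rfl fun p _ => ?_
    split_ifs with hs
    · rw [fuseClass_update_right, fuseClass_update_right, fuseClass_update_right, map_add]
      exact fuseClass_add _ _ _ _ _ _ _
    · rw [add_zero]
  smul Γ x v c a := by
    unfold fusionSum
    rw [Finset.smul_sum]
    refine Finset.sum_congr rfl fun p _ => ?_
    split_ifs with hs
    · rw [fuseClass_update_right, fuseClass_update_right, map_smul]
      exact fuseClass_smul _ _ _ _ _ _ _
    · rw [smul_zero]

theorem respects_fusionSum_left (Y : LabelledGraph O) : Respects (fun X => fusionSum X Y) where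
  iso f x y h := by
    have := fusionSum_iso f (OGraph.Iso.refl Y.graph) x y h Y.label Y.label
      (Iso.star_refl Y.graph Y.label)
    rwa [OGraph.Iso.sign_refl, mul_one] at this
  add Γ x v a b := by
    unfold fusionSum
    rw [← Finset.sum_add_distrib]
    refine Finset.sum_congr rfl fun p _ => ?_
    split_ifs with hs
    · rw [fuseClass_update_left, fuseClass_update_left, fuseClass_update_left, map_add]
      exact fuseClass_add _ _ _ _ _ _ _
    · rw [add_zero]
  smul Γ x v c a := by
    unfold fusionSum
    rw [Finset.smul_sum]
    refine Finset.sum_congr rfl fun p _ => ?_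
    split_ifs with hs
    · rw [fuseClass_update_left, fuseClass_update_left, map_smul]
      exact fuseClass_smul _ _ _ _ _ _ _
    · rw [smul_zero]

/-- The fusion bracket `φ₂(X ⊙ Y)`, as a bilinear map. -/
def phi2 : GraphSpace O →ₗ[k] GraphSpace O →ₗ[k] GraphSpace O :=
  graphLift (fun X => graphLift (fun Y => fusionSum X Y) (respects_fusionSum_right X)) {
    iso := fun f x y h => graphSpace_hom_ext fun Y => by
      rw [LinearMap.smul_apply, graphLift_graphClass, graphLift_graphClass]
      exact (respects_fusionSum_left Y).iso f x y h
    add := fun Γ x v a b => graphSpace_hom_ext fun Y => by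
      rw [LinearMap.add_apply, graphLift_graphClass, graphLift_graphClass, graphLift_graphClass]
      exact (respects_fusionSum_left Y).add Γ x v a b
    smul := fun Γ x v c a => graphSpace_hom_ext fun Y => by
      rw [LinearMap.smul_apply, graphLift_graphClass, graphLift_graphClass]
      exact (respects_fusionSum_left Y).smul Γ x v c a }

/-- The operator `∂₂`: the sum over all ways of gluing a square to two edges of a graph and
contracting the edge between `1` and `2`. -/
def partial2 : GraphSpace O →ₗ[k] GraphSpace O :=
  graphLift (fun X => ∑ p : X.graph.H × X.graph.H, fuseClass X p.1 p.2) {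
    iso := fun {Γ Γ'} f x y h => by
      rw [Finset.smul_sum]
      exact Fintype.sum_equiv (Equiv.prodCongr f.onH f.onH) _ _
        fun p => fuseClass_iso f x y h p.1 p.2
    add := fun Γ x v a b => by
      rw [← Finset.sum_add_distrib]
      exact Finset.sum_congr rfl fun p _ => fuseClass_add Γ p.1 p.2 x v a b
    smul := fun Γ x v c a => by
      rw [Finset.smul_sum]
      exact Finset.sum_congr rfl fun p _ => fuseClass_smul Γ p.1 p.2 x v c a }

/-- The projection of `𝒢^𝒪 = S(P𝒢^𝒪)` onto the subspace `S^i(P𝒢^𝒪)` spanned by the graphs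
with exactly `i` connected components. -/
def componentProjection (i : ℕ) : GraphSpace O →ₗ[k] GraphSpace O :=
  graphLift (fun X => if Nat.card X.graph.Components = i then graphClass X else 0) {
    iso := fun {Γ Γ'} f x y h => by
      dsimp only
      rw [Nat.card_congr f.components]
      split_ifs
      · exact respects_graphClass.iso f x y h
      · rw [smul_zero]
    add := fun Γ x v a b => by
      dsimp only
      split_ifs
      · exact respects_graphClass.add Γ x v a b
      · rw [add_zero]
    smul := fun Γ x v c a => by
      dsimp only
      split_ifs
      · exact respects_graphClass.smul Γ x v c a
      · rw [smul_zero] }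

/-- The fission cobracket `θ₂ = ½ π₂ ∂₂`, with `S²(P𝒢^𝒪)` regarded as the subspace of `𝒢^𝒪`
spanned by the graphs with two components, `A ⊙ B` being the disjoint union of `A` and `B`. -/
def theta2 : GraphSpace O →ₗ[k] GraphSpace O :=
  (1 / 2 : k) • (componentProjection 2 ∘ₗ partial2)

variable (O) in
/-- The part of degree `n` of `P^irred 𝒢^𝒪`: the span of the connected graphs with no
separating edges that have `n` vertices. -/
def irreducibleSpace (n : ℕ) : Submodule k (GraphSpace O) :=
  Submodule.span k {z | ∃ X : LabelledGraph O, X.graph.IsConnected ∧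
    (∀ e, ¬ X.graph.IsSeparating e) ∧ Nat.card X.graph.V = n ∧ z = graphClass X}

end

end

/-! All three terms are sums of summands of one kind. Put Z = X·Y. A quadruple q = (e₁, e₂, f₁, f₂)
of half-edges of Z gives `fuseTwice Z q`: glue a square along e₁, e₂, glue another one along f₁, f₂,
and contract one new edge of each, those of e₂ and f₂. Contracting commutes with gluing a square
elsewhere (`smul_fuseClass_contract`), so both contractions can be postponed to the end. Call a pair
of half-edges mixed if one lies in X and the other in Y. Up to the common factor 1/2, the first term
is a sum over q with (e₁, e₂) mixed; in the second and third terms (e₁, e₂) lies within X,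
respectively within Y, and (f₁, f₂) is mixed. The factor (-1)^x in the third term is the one that
makes the orientations match (`smul_phi2_fuseClass_comm`).

In the first term π₂ tests the number of components after both squares, in the other two after the
first square only. This is where irreducibility enters. If B stays connected when any edge is
deleted, a square along an edge of A and an edge of B replaces the edge of A by a connected piece
joining its two ends, so the number of components is that of A (`componentCount_disjUnion`). Hence
the condition is the same in all three terms, and their total is the sum of `fuseTwice Z q` over all
q whose final graph has two components and for which at least one of the two pairs is mixed.

That sum is killed by a fixed-point-free involution of the gluable quadruples, `exchange`. If the
two squares involve four different edges of Z, it swaps them. The second square may also use the new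
edge of the first square that is not contracted; then only three edges of Z take part, and the same
final graph arises from another pair of squares, with the same two edges contracted in the opposite
order. The involution preserves the final pairing of the half-edges (`oppGlueTwice_exchange`), hence
the number of components, and it preserves the condition that some pair is mixed
(`ne_or_ne_exchange`).

The sign comes from `contractTwice_anticomm`: contracting two edges in the two possible orders gives
opposite results. For edges with a common end the labels agree by associativity of the operad, and
the minus sign sits in the contraction signs. For edges without a common end the contraction signs
agree, but each new vertex is put in front, so the two new vertices appear in opposite orders.
Together with the bookkeeping of edge directions this gives `fuseTwice_add_fuseTwice_exchange`. -/

noncomputable section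

open scoped Classical

/-! ### Signs of vertices -/

namespace OGraph

/-- The sign of the comparison of two vertices. -/
def ltSign (Γ : OGraph) (a b : Γ.V) : ℤ := if Γ.lt a b then -1 else 1

/-- The parity of the number of vertices before `a`, as a sign. -/
def beforeSign (Γ : OGraph) (a : Γ.V) : ℤ := ∏ v, Γ.ltSign v a

theorem ltSign_mul_self (Γ : OGraph) (a b : Γ.V) : Γ.ltSign a b * Γ.ltSign a b = 1 := by
  unfold ltSign
  split_ifs <;> rfl

theorem lt_asymm (Γ : OGraph) {a b : Γ.V} (h : Γ.lt a b) : ¬ Γ.lt b a :=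
  fun h' => Γ.lt_order.irrefl a (Γ.lt_order.trans _ _ _ h h')

theorem lt_or_lt (Γ : OGraph) {a b : Γ.V} (h : a ≠ b) : Γ.lt a b ∨ Γ.lt b a := by
  by_contra hn
  push Not at hn
  exact h (Γ.lt_order.trichotomous a b hn.1 hn.2)

theorem ltSign_swap (Γ : OGraph) {a b : Γ.V} (h : a ≠ b) : Γ.ltSign b a = -Γ.ltSign a b := by
  unfold ltSign
  rcases Γ.lt_or_lt h with h | h <;> simp [h, Γ.lt_asymm h]

/-- `frontCount` leaves the starting point out of the count for the end point; using the full count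
there costs the correction `ltSign`. Apart from `dirSign` and `ltSign` the product is symmetric in
the two ends, so that the later sign comparisons become algebra. -/
theorem contractSign_eq (Γ : OGraph) (e : Γ.H) :
    Γ.contractSign e = Γ.dirSign e * (Γ.beforeSign (Γ.att e) * Γ.beforeSign (Γ.att (Γ.opp e)) *
      Γ.ltSign (Γ.att e) (Γ.att (Γ.opp e))) := by
  unfold contractSign
  rw [Iso.sign_front]
  have h : Γ.beforeSign (Γ.att (Γ.opp e)) = (∏ v, if v ≠ Γ.att e ∧
      Γ.lt v (Γ.att (Γ.opp e)) then (-1 : ℤ) else 1) *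
        Γ.ltSign (Γ.att e) (Γ.att (Γ.opp e)) := by
    unfold beforeSign
    rw [← Finset.mul_prod_erase _ _ (Finset.mem_univ (Γ.att e)),
      ← Finset.mul_prod_erase _ (fun v => if v ≠ Γ.att e ∧
      Γ.lt v (Γ.att (Γ.opp e)) then (-1 : ℤ) else 1) (Finset.mem_univ (Γ.att e)),
      if_neg (fun h => h.1 rfl), one_mul, mul_comm]
    congr 1
    refine Finset.prod_congr rfl fun v hv => ?_
    simp only [Finset.mem_erase, Finset.mem_univ, and_true] at hv
    simp [ltSign, hv]
  rw [h]
  have h' := Γ.ltSign_mul_self (Γ.att e) (Γ.att (Γ.opp e))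
  change _ * (Γ.beforeSign (Γ.att e) * _) = _
  linear_combination (-(Γ.dirSign e * Γ.beforeSign (Γ.att e) * (∏ v, if v ≠ Γ.att e ∧
      Γ.lt v (Γ.att (Γ.opp e)) then (-1 : ℤ) else 1))) * h'

theorem dirSign_opp (Γ : OGraph) (e : Γ.H) : Γ.dirSign (Γ.opp e) = -Γ.dirSign e := by
  unfold dirSign
  rw [Γ.out_opp]
  cases Γ.out e <;> rfl

/-- Reversal changes `dirSign` and, as the ends are distinct, `ltSign`; the two signs cancel. -/
theorem contractSign_opp (Γ : OGraph) (e : Γ.H) (he : Γ.att e ≠ Γ.att (Γ.opp e)) :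
    Γ.contractSign (Γ.opp e) = Γ.contractSign e := by
  rw [contractSign_eq, contractSign_eq, Γ.opp_opp, Γ.dirSign_opp, Γ.ltSign_swap he]
  ring

/-! ### The quotient map to a contraction -/

/-- The image of a vertex after contraction of the edge of `e`. -/
def quotVertex (Γ : OGraph) (e : Γ.H) (he : Γ.att e ≠ Γ.att (Γ.opp e)) (v : Γ.V) :
    (Γ.contract e he).V :=
  if hv : v ≠ Γ.att e ∧ v ≠ Γ.att (Γ.opp e) then some (⟨v, hv⟩ : Γ.Rest e)
  else (none : Option (Γ.Rest e))

section

variable {Γ : OGraph} {e : Γ.H} {he : Γ.att e ≠ Γ.att (Γ.opp e)}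

theorem quotVertex_of_eq {v : Γ.V} (hv : v = Γ.att e ∨ v = Γ.att (Γ.opp e)) :
    Γ.quotVertex e he v = (none : Option (Γ.Rest e)) :=
  dif_neg (by tauto)

theorem quotVertex_of_ne {v : Γ.V} (hv : v ≠ Γ.att e ∧ v ≠ Γ.att (Γ.opp e)) :
    Γ.quotVertex e he v = some (⟨v, hv⟩ : Γ.Rest e) :=
  dif_pos hv

theorem quotVertex_eq_iff {v w : Γ.V} :
    Γ.quotVertex e he v = Γ.quotVertex e he w ↔
      v = w ∨ ((v = Γ.att e ∨ v = Γ.att (Γ.opp e)) ∧ (w = Γ.att e ∨ w = Γ.att (Γ.opp e))) := by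
  change (dite _ _ _ : Option (Γ.Rest e)) = dite _ _ _ ↔ _
  split_ifs with hv hw hw <;> simp <;> grind

end

theorem quotVertex_surjective (Γ : OGraph) (e : Γ.H) (he : Γ.att e ≠ Γ.att (Γ.opp e)) :
    Function.Surjective (Γ.quotVertex e he) := by
  rintro (_ | v)
  · exact ⟨Γ.att e, quotVertex_of_eq (Or.inl rfl)⟩
  · exact ⟨v.1, quotVertex_of_ne v.2⟩

theorem contract_lt_quotVertex (Γ : OGraph) (e : Γ.H) (he : Γ.att e ≠ Γ.att (Γ.opp e))
    (v w : Γ.V) : (Γ.contract e he).lt (Γ.quotVertex e he v) (Γ.quotVertex e he w) ↔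
      (w ≠ Γ.att e ∧ w ≠ Γ.att (Γ.opp e)) ∧ ((v = Γ.att e ∨ v = Γ.att (Γ.opp e)) ∨ Γ.lt v w) := by
  change firstLt _ (dite _ _ _ : Option (Γ.Rest e)) (dite _ _ _) ↔ _
  split_ifs with hv hw hw <;> simp [firstLt] <;> grind

/-- The isomorphism determined by two quotient maps with the same fibres. -/
def Iso.ofQuot {Γ Γ' : OGraph} {A : Type} (p : A → Γ.V) (p' : A → Γ'.V)
    (hp : Function.Surjective p) (hp' : Function.Surjective p')
    (hk : ∀ a b, p a = p b ↔ p' a = p' b) (ψ : Γ.H ≃ Γ'.H)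
    (hopp : ∀ h, Γ'.opp (ψ h) = ψ (Γ.opp h))
    (hatt : ∀ h, ∃ a, Γ.att h = p a ∧ Γ'.att (ψ h) = p' a) : Iso Γ Γ' where
  -- A section of `p` followed by `p'`; since the fibres coincide, the choice of the section does
  -- not matter.
  onV := Equiv.ofBijective (fun v => p' (Function.surjInv hp v)) <| by
    constructor
    · intro v w h
      have := (hk _ _).2 h
      rwa [Function.surjInv_eq hp, Function.surjInv_eq hp] at this
    · intro w
      obtain ⟨a, rfl⟩ := hp' w
      exact ⟨p a, (hk _ _).1 (Function.surjInv_eq hp _)⟩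
  onH := ψ
  att_onH h := by
    obtain ⟨a, h1, h2⟩ := hatt h
    rw [h1, h2]
    exact ((hk _ _).1 (Function.surjInv_eq hp _)).symm
  opp_onH := hopp

theorem Iso.ofQuot_onV {Γ Γ' : OGraph} {A : Type} (p : A → Γ.V) (p' : A → Γ'.V)
    (hp : Function.Surjective p) (hp' : Function.Surjective p')
    (hk : ∀ a b, p a = p b ↔ p' a = p' b) (ψ : Γ.H ≃ Γ'.H)
    (hopp : ∀ h, Γ'.opp (ψ h) = ψ (Γ.opp h))
    (hatt : ∀ h, ∃ a, Γ.att h = p a ∧ Γ'.att (ψ h) = p' a) (a : A) :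
    (Iso.ofQuot p p' hp hp' hk ψ hopp hatt).onV (p a) = p' a :=
  (hk _ _).1 (Function.surjInv_eq hp _)

theorem Iso.sign_eq_one {Γ Γ' : OGraph} (f : Iso Γ Γ')
    (hlt : ∀ v w, Γ.lt v w → Γ'.lt (f.onV v) (f.onV w))
    (hout : ∀ h, Γ'.out (f.onH h) = Γ.out h) : f.sign = 1 := by
  have h1 : inversions Γ.lt Γ'.lt f.onV = ∅ := by
    refine Finset.filter_eq_empty_iff.2 fun p _ hp => ?_
    exact Γ'.lt_asymm (hlt _ _ hp.1) hp.2
  have h2 : f.flips = ∅ := by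
    refine Finset.filter_eq_empty_iff.2 fun h _ hh => ?_
    rw [hout, hh.1] at hh
    exact absurd hh.2 (by simp)
  unfold Iso.sign
  rw [h1, h2]
  rfl

end OGraph

section

open OGraph

variable {k : Type u} [Field k] {O : CyclicOperad.{u, w} k}

/-! ### Labels up to relabelling -/

/-- The label at `v` is the element `s` of `𝒪((S))`, the elements of `S` being identified with
half-edges by `ι`. -/
def LabelledGraph.IsLabel (X : LabelledGraph O) (v : X.graph.V) {S : Type} [Finite S]
    (ι : S → X.graph.H) (s : O.obj S) : Prop :=
  ∃ E : S ≃ X.graph.Star v, (∀ i, (E i).1 = ι i) ∧ X.label v = O.map E s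

namespace LabelledGraph.IsLabel

variable {X Y : LabelledGraph O}

theorem self (X : LabelledGraph O) (v : X.graph.V) :
    X.IsLabel v (fun h : X.graph.Star v => h.1) (X.label v) :=
  ⟨Equiv.refl _, fun _ => rfl, (O.map_refl _).symm⟩

theorem mapEquiv {v : X.graph.V} {S T : Type} [Finite S] [Finite T] {ι : S → X.graph.H}
    {s : O.obj S} (h : X.IsLabel v ι s) (g : S ≃ T) (κ : T → X.graph.H)
    (hκ : ∀ i, κ (g i) = ι i) : X.IsLabel v κ (O.map g s) := by
  obtain ⟨E, hE, h⟩ := h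
  refine ⟨g.symm.trans E, fun i => ?_, ?_⟩
  · obtain ⟨i, rfl⟩ := g.surjective i
    simp [hE, hκ]
  · rw [h, ← O.map_trans]
    congr 2
    ext
    simp

theorem of_map {v : X.graph.V} {S T : Type} [Finite S] [Finite T] (g : S ≃ T)
    {κ : T → X.graph.H} {s : O.obj S} (h : X.IsLabel v κ (O.map g s)) :
    X.IsLabel v (fun i => κ (g i)) s := by
  obtain ⟨E, hE, h⟩ := h
  exact ⟨g.trans E, fun i => hE _, by rw [h, ← O.map_trans]⟩

theorem congr {v : X.graph.V} {S : Type} [Finite S] {ι κ : S → X.graph.H}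
    {s : O.obj S} (h : X.IsLabel v ι s) (hκ : ∀ i, κ i = ι i) : X.IsLabel v κ s := by
  obtain ⟨E, hE, h⟩ := h
  exact ⟨E, fun i => (hE i).trans (hκ i).symm, h⟩

/-- The way label conditions of isomorphisms are checked: both labels are traced back to one
operation `s` indexed by a neutral set, which avoids transport along equalities of vertices. -/
theorem transfer {v : X.graph.V} {w : Y.graph.V} {S : Type} [Finite S] {ι : S → X.graph.H}
    {s : O.obj S} (ψ : X.graph.H → Y.graph.H) (h : X.IsLabel v ι s)
    (h' : Y.IsLabel w (fun i => ψ (ι i)) s) :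
    Y.IsLabel w (fun i : X.graph.Star v => ψ i.1) (X.label v) := by
  obtain ⟨E, hE, h⟩ := h
  rw [h]
  refine h'.mapEquiv _ _ fun i => ?_
  rw [hE]

theorem att_eq {v : X.graph.V} {S : Type} [Finite S] {ι : S → X.graph.H} {s : O.obj S}
    (h : X.IsLabel v ι s) (i : S) : X.graph.att (ι i) = v := by
  obtain ⟨E, hE, -⟩ := h
  rw [← hE]
  exact (E i).2

theorem injective {v : X.graph.V} {S : Type} [Finite S] {ι : S → X.graph.H} {s : O.obj S}
    (h : X.IsLabel v ι s) : Function.Injective ι := by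
  obtain ⟨E, hE, -⟩ := h
  intro i j hij
  rw [← hE, ← hE] at hij
  exact E.injective (Subtype.ext hij)

/-- A bijection onto a star is determined by the half-edges that are its values, so the bijection
hidden in `IsLabel` can only be `f.star v`. -/
theorem iso_label (f : X.graph.Iso Y.graph)
    (h : ∀ v, Y.IsLabel (f.onV v) (fun i : X.graph.Star v => f.onH i.1) (X.label v)) (v) :
    Y.label (f.onV v) = O.map (f.star v) (X.label v) := by
  obtain ⟨E, hE, h⟩ := h v
  rw [h]
  congr 2
  ext i
  exact hE i

theorem contract_some {Γ : OGraph} {x : ∀ v, O.obj (Γ.Star v)} {e : Γ.H}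
    (he : Γ.att e ≠ Γ.att (Γ.opp e)) {v : Γ.V} (hv : v ≠ Γ.att e ∧ v ≠ Γ.att (Γ.opp e))
    {S : Type} [Finite S] {ι : S → Γ.H} {s : O.obj S}
    (h : IsLabel (X := ⟨Γ, x⟩) v ι s) (ι' : S → Γ.HalfRest e) (hι : ∀ i, (ι' i).1 = ι i) :
    IsLabel (X := ⟨Γ.contract e he, contractLabel Γ x e he⟩) (Γ.quotVertex e he v) ι' s := by
  rw [quotVertex_of_ne hv]
  obtain ⟨E, hE, h⟩ := h
  refine ⟨E.trans (Γ.starSome e ⟨v, hv⟩), fun i => Subtype.ext ?_, ?_⟩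
  · exact (hE i).trans (hι i).symm
  · exact (congrArg (O.map (Γ.starSome e ⟨v, hv⟩)) h).trans (O.map_trans _ _ _).symm

/-- Equivariance of the composition: it may be formed with the index sets `S` and `T` in place of
the two stars, and relabelled afterwards. -/
theorem contract_none {Γ : OGraph} {x : ∀ v, O.obj (Γ.Star v)} {e : Γ.H}
    (he : Γ.att e ≠ Γ.att (Γ.opp e)) {v : Γ.V} (hv : v = Γ.att e ∨ v = Γ.att (Γ.opp e))
    {S T : Type} [Finite S] [Finite T] {ι : S → Γ.H} {s : O.obj S} {κ : T → Γ.H} {t : O.obj T}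
    (hs : IsLabel (X := ⟨Γ, x⟩) (Γ.att e) ι s) (ht : IsLabel (X := ⟨Γ, x⟩) (Γ.att (Γ.opp e)) κ t)
    {a : S} {b : T} (ha : ι a = e) (hb : κ b = Γ.opp e)
    (ι' : {s : S // s ≠ a} ⊕ {t : T // t ≠ b} → Γ.HalfRest e)
    (hι : ∀ i, (ι' (Sum.inl i)).1 = ι i.1) (hκ : ∀ i, (ι' (Sum.inr i)).1 = κ i.1) :
    IsLabel (X := ⟨Γ.contract e he, contractLabel Γ x e he⟩) (Γ.quotVertex e he v) ι'
      (O.comp a b s t) := by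
  rw [quotVertex_of_eq hv]
  obtain ⟨E, hE, hs⟩ := hs
  obtain ⟨F, hF, ht⟩ := ht
  have hEa : E a = ⟨e, rfl⟩ := Subtype.ext ((hE a).trans ha)
  have hFb : F b = ⟨Γ.opp e, rfl⟩ := Subtype.ext ((hF b).trans hb)
  refine ⟨(Equiv.sumCongr
        (E.subtypeEquiv (p := fun s => s ≠ a) (q := fun s => s ≠ ⟨e, rfl⟩)
          fun _ => by rw [← hEa]; exact E.injective.ne_iff.symm)
        (F.subtypeEquiv (p := fun t => t ≠ b) (q := fun t => t ≠ ⟨Γ.opp e, rfl⟩)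
          fun _ => by rw [← hFb]; exact F.injective.ne_iff.symm)).trans (Γ.starNone e he), ?_, ?_⟩
  · rintro (i | i)
    · exact Subtype.ext ((hE i.1).trans (hι i).symm)
    · exact Subtype.ext ((hF i.1).trans (hκ i).symm)
  · change O.map _ (O.comp _ _ (x _) (x _)) = _
    change x _ = _ at hs
    change x _ = _ at ht
    rw [hs, ht]
    have := O.map_comp_eq E F a b _ _ hEa hFb (Equiv.refl _) (Γ.starNone e he)
      ((Equiv.sumCongr
        (E.subtypeEquiv (p := fun s => s ≠ a) (q := fun s => s ≠ ⟨e, rfl⟩)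
          fun _ => by rw [← hEa]; exact E.injective.ne_iff.symm)
        (F.subtypeEquiv (p := fun t => t ≠ b) (q := fun t => t ≠ ⟨Γ.opp e, rfl⟩)
          fun _ => by rw [← hFb]; exact F.injective.ne_iff.symm)).trans (Γ.starNone e he))
      (fun _ _ => rfl) (fun _ _ => rfl) s t
    rw [O.map_refl] at this
    exact this

end LabelledGraph.IsLabel

/-- A labelled isomorphism determined by two quotient maps with the same fibres. -/
theorem exists_iso_of_quot {X Y : LabelledGraph O} {A : Type} (p : A → X.graph.V)
    (p' : A → Y.graph.V) (hp : Function.Surjective p) (hp' : Function.Surjective p')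
    (hk : ∀ a b, p a = p b ↔ p' a = p' b) (ψ : X.graph.H ≃ Y.graph.H)
    (hopp : ∀ h, Y.graph.opp (ψ h) = ψ (X.graph.opp h))
    (hatt : ∀ h, ∃ a, X.graph.att h = p a ∧ Y.graph.att (ψ h) = p' a)
    (hl : ∀ a, Y.IsLabel (p' a) (fun i : X.graph.Star (p a) => ψ i.1) (X.label (p a))) :
    ∃ f : X.graph.Iso Y.graph, f.onH = ψ ∧ (∀ a, f.onV (p a) = p' a) ∧
      ∀ v, Y.label (f.onV v) = O.map (f.star v) (X.label v) := by
  refine ⟨Iso.ofQuot p p' hp hp' hk ψ hopp hatt, rfl,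
    fun a => Iso.ofQuot_onV p p' hp hp' hk ψ hopp hatt a,
    LabelledGraph.IsLabel.iso_label _ fun v => ?_⟩
  obtain ⟨a, rfl⟩ := hp v
  rw [Iso.ofQuot_onV]
  exact hl a

/-- A labelled isomorphism compatible with orientations determined by two quotient maps with the
same fibres. -/
theorem exists_oriented_iso_of_quot {X Y : LabelledGraph O} {A : Type} (p : A → X.graph.V)
    (p' : A → Y.graph.V) (hp : Function.Surjective p) (hp' : Function.Surjective p')
    (hk : ∀ a b, p a = p b ↔ p' a = p' b) (ψ : X.graph.H ≃ Y.graph.H)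
    (hopp : ∀ h, Y.graph.opp (ψ h) = ψ (X.graph.opp h))
    (hatt : ∀ h, ∃ a, X.graph.att h = p a ∧ Y.graph.att (ψ h) = p' a)
    (hl : ∀ a, Y.IsLabel (p' a) (fun i : X.graph.Star (p a) => ψ i.1) (X.label (p a)))
    (hlt : ∀ a b, X.graph.lt (p a) (p b) → Y.graph.lt (p' a) (p' b))
    (hout : ∀ h, Y.graph.out (ψ h) = X.graph.out h) :
    ∃ f : X.graph.Iso Y.graph, f.onH = ψ ∧ f.sign = 1 ∧
      ∀ v, Y.label (f.onV v) = O.map (f.star v) (X.label v) := by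
  obtain ⟨f, hf, hv, h⟩ := exists_iso_of_quot p p' hp hp' hk ψ hopp hatt hl
  refine ⟨f, hf, f.sign_eq_one (fun v w => ?_) (fun h => ?_), h⟩
  · obtain ⟨v, rfl⟩ := hp v
    obtain ⟨w, rfl⟩ := hp w
    rw [hv, hv]
    exact hlt v w
  · rw [hf, hout]

theorem graphClass_eq_of_iso {X Y : LabelledGraph O} (f : X.graph.Iso Y.graph) (hf : f.sign = 1)
    (h : ∀ v, Y.label (f.onV v) = O.map (f.star v) (X.label v)) :
    graphClass X = graphClass Y :=
  (respects_graphClass.iso f X.label Y.label h).trans (by rw [hf, one_smul])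

/-- Contractions along an edge traversed in opposite directions are isomorphic. -/
theorem exists_iso_contract_opp (Γ : OGraph) (x : ∀ v, O.obj (Γ.Star v)) (e : Γ.H)
    (he : Γ.att e ≠ Γ.att (Γ.opp e)) (he' : Γ.att (Γ.opp e) ≠ Γ.att (Γ.opp (Γ.opp e))) :
    ∃ f : (Γ.contract (Γ.opp e) he').Iso (Γ.contract e he),
      (∀ h : Γ.HalfRest (Γ.opp e), (f.onH h : Γ.HalfRest e).1 = h.1) ∧ f.sign = 1 ∧
      ∀ v, contractLabel Γ x e he (f.onV v) =
        O.map (f.star v) (contractLabel Γ x (Γ.opp e) he' v) := by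
  let ψ : Γ.HalfRest (Γ.opp e) ≃ Γ.HalfRest e :=
    Equiv.subtypeEquivRight fun h => by rw [Γ.opp_opp, and_comm]
  have hlab : ∀ v, LabelledGraph.IsLabel ⟨Γ.contract e he, contractLabel Γ x e he⟩
      (Γ.quotVertex e he v)
      (fun i : (Γ.contract (Γ.opp e) he').Star (Γ.quotVertex (Γ.opp e) he' v) => ψ i.1)
      (contractLabel Γ x (Γ.opp e) he' (Γ.quotVertex (Γ.opp e) he' v)) := by
    intro v
    by_cases hv : v ≠ Γ.att e ∧ v ≠ Γ.att (Γ.opp e)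
    · have hv' : v ≠ Γ.att (Γ.opp e) ∧ v ≠ Γ.att (Γ.opp (Γ.opp e)) := by
        rw [Γ.opp_opp]
        exact hv.symm
      have h1 := LabelledGraph.IsLabel.self ⟨Γ, x⟩ v
      let ι : Γ.Star v → Γ.HalfRest (Γ.opp e) := fun h => ⟨h.1, fun h' => hv'.1 (by rw [← h', h.2]),
        fun h' => hv'.2 (by rw [← h', h.2])⟩
      exact (h1.contract_some he' hv' ι (fun _ => rfl)).transfer ψ
        (h1.contract_some he hv _ (fun _ => rfl))
    · have hv' : v = Γ.att e ∨ v = Γ.att (Γ.opp e) := by tauto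
      have hu := LabelledGraph.IsLabel.self ⟨Γ, x⟩ (Γ.att e)
      have hw := LabelledGraph.IsLabel.self ⟨Γ, x⟩ (Γ.att (Γ.opp e))
      -- The far end of `opp e` is `att (opp (opp e))`, which equals `att e` only propositionally.
      have hu' : LabelledGraph.IsLabel (X := ⟨Γ, x⟩) (Γ.att (Γ.opp (Γ.opp e)))
        (fun h : Γ.Star (Γ.att e) => h.1) (x (Γ.att e)) := by
        rw [Γ.opp_opp]
        exact hu
      let ι : {h : Γ.Star (Γ.att e) // h ≠ ⟨e, rfl⟩} ⊕
          {h : Γ.Star (Γ.att (Γ.opp e)) // h ≠ ⟨Γ.opp e, rfl⟩} → Γ.HalfRest e :=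
        fun h => (Γ.starNone e he h).1
      have key := hu.contract_none he hv' hw (a := ⟨e, rfl⟩) (b := ⟨Γ.opp e, rfl⟩) rfl rfl ι
        (fun _ => rfl) (fun _ => rfl)
      have key' := hw.contract_none he' (v := v) (by rw [Γ.opp_opp]; tauto) hu'
        (a := ⟨Γ.opp e, rfl⟩) (b := ⟨e, rfl⟩) rfl (Γ.opp_opp e).symm (fun h => ψ.symm (ι h.swap))
        (fun _ => rfl) (fun _ => rfl)
      refine key'.transfer (Y := ⟨Γ.contract e he, contractLabel Γ x e he⟩) ψ ?_
      -- Traversing the edge backwards interchanges the arguments of the composition.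
      rw [O.comp_comm]
      refine key.mapEquiv _ _ ?_
      rintro (i | i) <;> rfl
  obtain ⟨f, hψ, hf, hl⟩ := exists_oriented_iso_of_quot
    (X := ⟨Γ.contract (Γ.opp e) he', contractLabel Γ x (Γ.opp e) he'⟩)
    (Y := ⟨Γ.contract e he, contractLabel Γ x e he⟩)
    (Γ.quotVertex (Γ.opp e) he') (Γ.quotVertex e he) (Γ.quotVertex_surjective _ _)
    (Γ.quotVertex_surjective _ _)
    (fun a b => by rw [quotVertex_eq_iff, quotVertex_eq_iff, Γ.opp_opp]; tauto) ψ
    (fun h => rfl) (fun h => ⟨Γ.att h.1, rfl, rfl⟩) hlab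
    (fun v w => by
      rw [contract_lt_quotVertex, contract_lt_quotVertex, Γ.opp_opp]
      tauto)
    (fun h => rfl)
  exact ⟨f, fun h => by rw [hψ]; rfl, hf, hl⟩

/-- The class of a contraction does not depend on the direction in which the edge is
traversed. -/
theorem contractClass_opp (X : LabelledGraph O) (e : X.graph.H) :
    contractClass X (X.graph.opp e) = contractClass X e := by
  unfold contractClass
  by_cases he : X.graph.att e ≠ X.graph.att (X.graph.opp e)
  · have he' : X.graph.att (X.graph.opp e) ≠ X.graph.att (X.graph.opp (X.graph.opp e)) := by
      rw [X.graph.opp_opp]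
      exact he.symm
    obtain ⟨f, -, hf, h⟩ := exists_iso_contract_opp X.graph X.label e he he'
    rw [dif_pos he, dif_pos he', X.graph.contractSign_opp e he]
    exact congrArg _ (graphClass_eq_of_iso (X := ⟨_, _⟩) (Y := ⟨_, _⟩) f hf h)
  · rw [dif_neg he, dif_neg (by rw [X.graph.opp_opp]; exact fun h => he h.symm)]

end

/-! ### Signs of two successive contractions -/

namespace OGraph

variable {Γ : OGraph} {e : Γ.H} {he : Γ.att e ≠ Γ.att (Γ.opp e)}

theorem ltSign_quotVertex_of_eq {v w : Γ.V} (hw : w = Γ.att e ∨ w = Γ.att (Γ.opp e)) :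
    (Γ.contract e he).ltSign (Γ.quotVertex e he v) (Γ.quotVertex e he w) = 1 := by
  unfold ltSign
  rw [contract_lt_quotVertex, if_neg (by tauto)]

theorem ltSign_quotVertex_of_eq_of_ne {v w : Γ.V} (hv : v = Γ.att e ∨ v = Γ.att (Γ.opp e))
    (hw : w ≠ Γ.att e ∧ w ≠ Γ.att (Γ.opp e)) :
    (Γ.contract e he).ltSign (Γ.quotVertex e he v) (Γ.quotVertex e he w) = -1 := by
  unfold ltSign
  rw [contract_lt_quotVertex, if_pos (by tauto)]

theorem ltSign_quotVertex_of_ne {v w : Γ.V} (hv : v ≠ Γ.att e ∧ v ≠ Γ.att (Γ.opp e))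
    (hw : w ≠ Γ.att e ∧ w ≠ Γ.att (Γ.opp e)) :
    (Γ.contract e he).ltSign (Γ.quotVertex e he v) (Γ.quotVertex e he w) = Γ.ltSign v w := by
  unfold ltSign
  rw [contract_lt_quotVertex]
  congr 1
  simp only [eq_iff_iff]
  tauto

theorem beforeSign_quotVertex_of_eq {w : Γ.V} (hw : w = Γ.att e ∨ w = Γ.att (Γ.opp e)) :
    (Γ.contract e he).beforeSign (Γ.quotVertex e he w) = 1 := by
  refine Finset.prod_eq_one fun v _ => ?_
  obtain ⟨v, rfl⟩ := Γ.quotVertex_surjective e he v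
  exact ltSign_quotVertex_of_eq hw

/-- In the contraction the merged vertex always precedes `w`, which gives the minus sign. The other
vertices keep their order, and the factors of the two lost ends are removed by multiplying with them
once more. -/
theorem beforeSign_quotVertex_of_ne {w : Γ.V} (hw : w ≠ Γ.att e ∧ w ≠ Γ.att (Γ.opp e)) :
    (Γ.contract e he).beforeSign (Γ.quotVertex e he w) =
      -(Γ.ltSign (Γ.att e) w * Γ.ltSign (Γ.att (Γ.opp e)) w * Γ.beforeSign w) := by
  let S : Finset Γ.V := Finset.univ.filter fun v => v ≠ Γ.att e ∧ v ≠ Γ.att (Γ.opp e)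
  have hS : ∀ v, v ∈ S ↔ v ≠ Γ.att e ∧ v ≠ Γ.att (Γ.opp e) := fun v => by simp [S]
  have hq : Γ.att (Γ.opp e) ∉ S := fun h => ((hS _).1 h).2 rfl
  have hp : Γ.att e ∉ insert (Γ.att (Γ.opp e)) S := fun h =>
    (Finset.mem_insert.1 h).elim he fun h => ((hS _).1 h).1 rfl
  have huniv : (Finset.univ : Finset Γ.V) =
      insert (Γ.att e) (insert (Γ.att (Γ.opp e)) S) := by
    ext v
    simp only [Finset.mem_univ, Finset.mem_insert, hS, true_iff]
    tauto
  have h1 : (Γ.contract e he).beforeSign (Γ.quotVertex e he w) =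
      -∏ v ∈ S, Γ.ltSign v w := by
    refine (Fintype.prod_option _).trans ?_
    rw [← quotVertex_of_eq (he := he) (Or.inl rfl),
      ltSign_quotVertex_of_eq_of_ne (Or.inl rfl) hw, neg_one_mul, neg_inj]
    refine Eq.trans ?_
      (Finset.prod_subtype (F := (inferInstance : Fintype (Γ.Rest e))) S hS _).symm
    refine Finset.prod_congr rfl fun v _ => ?_
    rw [← ltSign_quotVertex_of_ne (he := he) v.2 hw, quotVertex_of_ne v.2]
  have h2 : Γ.beforeSign w = Γ.ltSign (Γ.att e) w * (Γ.ltSign (Γ.att (Γ.opp e)) w *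
      ∏ v ∈ S, Γ.ltSign v w) := by
    unfold beforeSign
    rw [huniv, Finset.prod_insert hp, Finset.prod_insert hq]
  have h3 := Γ.ltSign_mul_self (Γ.att e) w
  have h4 := Γ.ltSign_mul_self (Γ.att (Γ.opp e)) w
  rw [h1, h2]
  linear_combination (∏ v ∈ S, Γ.ltSign v w) *
    (Γ.ltSign (Γ.att (Γ.opp e)) w * Γ.ltSign (Γ.att (Γ.opp e)) w * h3 + h4)

/-- The sign of the contraction of a second edge. -/
theorem contractSign_contract (h : Γ.HalfRest e) : (Γ.contract e he).contractSign h =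
    Γ.dirSign h.1 * ((Γ.contract e he).beforeSign (Γ.quotVertex e he (Γ.att h.1)) *
      (Γ.contract e he).beforeSign (Γ.quotVertex e he (Γ.att (Γ.opp h.1))) *
      (Γ.contract e he).ltSign (Γ.quotVertex e he (Γ.att h.1))
        (Γ.quotVertex e he (Γ.att (Γ.opp h.1)))) :=
  contractSign_eq _ _

/-- Contracting two adjacent edges in either order gives opposite signs. -/
theorem contractSign_anticomm_adjacent {f : Γ.H} (hf : Γ.att f ≠ Γ.att (Γ.opp f))
    (hef : f ≠ e ∧ f ≠ Γ.opp e) (hfe : e ≠ f ∧ e ≠ Γ.opp f) (h1 : Γ.att f = Γ.att (Γ.opp e))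
    (h2 : Γ.att e ≠ Γ.att (Γ.opp f)) :
    Γ.contractSign e * (Γ.contract e he).contractSign ⟨f, hef⟩ =
      -(Γ.contractSign f * (Γ.contract f hf).contractSign ⟨e, hfe⟩) := by
  rw [contractSign_contract, contractSign_contract, contractSign_eq, contractSign_eq]
  dsimp only
  have h3 : Γ.att (Γ.opp f) ≠ Γ.att e ∧ Γ.att (Γ.opp f) ≠ Γ.att (Γ.opp e) :=
    ⟨h2.symm, fun h => hf (h1.trans h.symm)⟩
  have h4 : Γ.att e ≠ Γ.att f ∧ Γ.att e ≠ Γ.att (Γ.opp f) := ⟨h1 ▸ he, h2⟩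
  -- The merged vertex comes first in either contraction. In one of them the remaining edge `f`
  -- leaves it, in the other the remaining edge `e` enters it, so the comparisons of the ends are -1
  -- and 1: this is the source of the minus sign. The two reversed comparisons with `att e` cancel.
  rw [beforeSign_quotVertex_of_eq (Or.inr h1), beforeSign_quotVertex_of_ne h3,
    ltSign_quotVertex_of_eq_of_ne (Or.inr h1) h3, beforeSign_quotVertex_of_ne h4,
    beforeSign_quotVertex_of_eq (Or.inl h1.symm), ltSign_quotVertex_of_eq (Or.inl h1.symm), h1,
    Γ.ltSign_swap he, Γ.ltSign_swap h2]
  generalize Γ.att (Γ.opp e) = v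
  ring

/-- The two sides differ in the four comparisons of an end of `e` with an end of `f`. All four are
reversed, and an even number of sign changes cancels. -/
theorem contractSign_anticomm_disjoint {f : Γ.H} (hf : Γ.att f ≠ Γ.att (Γ.opp f))
    (hef : f ≠ e ∧ f ≠ Γ.opp e) (hfe : e ≠ f ∧ e ≠ Γ.opp f)
    (h1 : Γ.att f ≠ Γ.att e ∧ Γ.att f ≠ Γ.att (Γ.opp e))
    (h2 : Γ.att (Γ.opp f) ≠ Γ.att e ∧ Γ.att (Γ.opp f) ≠ Γ.att (Γ.opp e)) :
    Γ.contractSign e * (Γ.contract e he).contractSign ⟨f, hef⟩ =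
      Γ.contractSign f * (Γ.contract f hf).contractSign ⟨e, hfe⟩ := by
  rw [contractSign_contract, contractSign_contract, contractSign_eq, contractSign_eq]
  dsimp only
  have h3 : Γ.att e ≠ Γ.att f ∧ Γ.att e ≠ Γ.att (Γ.opp f) := ⟨h1.1.symm, h2.1.symm⟩
  have h4 : Γ.att (Γ.opp e) ≠ Γ.att f ∧ Γ.att (Γ.opp e) ≠ Γ.att (Γ.opp f) :=
    ⟨h1.2.symm, h2.2.symm⟩
  rw [beforeSign_quotVertex_of_ne h1, beforeSign_quotVertex_of_ne h2,
    beforeSign_quotVertex_of_ne h3, beforeSign_quotVertex_of_ne h4,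
    ltSign_quotVertex_of_ne h1 h2, ltSign_quotVertex_of_ne h3 h4,
    Γ.ltSign_swap h1.1, Γ.ltSign_swap h1.2, Γ.ltSign_swap h2.1, Γ.ltSign_swap h2.2]
  ring

end OGraph

/-! ### Following labels through a contraction -/

section

open OGraph

variable {k : Type u} [Field k] {O : CyclicOperad.{u, w} k}

/-- The contraction of an edge that is not a loop in a labelled graph. -/
abbrev LabelledGraph.contract (X : LabelledGraph O) (e : X.graph.H)
    (he : X.graph.att e ≠ X.graph.att (X.graph.opp e)) : LabelledGraph O :=
  ⟨X.graph.contract e he, contractLabel X.graph X.label e he⟩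

namespace LabelledGraph.IsLabel

variable {X : LabelledGraph O} {e : X.graph.H}

theorem exists_contract_of_ne (he : X.graph.att e ≠ X.graph.att (X.graph.opp e)) {v : X.graph.V}
    (hv : v ≠ X.graph.att e ∧ v ≠ X.graph.att (X.graph.opp e))
    {S : Type} [Finite S] {ι : S → X.graph.H} {s : O.obj S} (h : X.IsLabel v ι s) :
    ∃ ι' : S → X.graph.HalfRest e, (∀ i, (ι' i).1 = ι i) ∧
      (X.contract e he).IsLabel (X.graph.quotVertex e he v) ι' s := by
  have hι : ∀ i, ι i ≠ e ∧ ι i ≠ X.graph.opp e := fun i =>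
    ⟨fun h' => hv.1 (by rw [← h', h.att_eq]), fun h' => hv.2 (by rw [← h', h.att_eq])⟩
  exact ⟨fun i => ⟨ι i, hι i⟩, fun _ => rfl, h.contract_some he hv _ fun _ => rfl⟩

theorem exists_contract_of_eq (he : X.graph.att e ≠ X.graph.att (X.graph.opp e)) {v : X.graph.V}
    (hv : v = X.graph.att e ∨ v = X.graph.att (X.graph.opp e))
    {S T : Type} [Finite S] [Finite T] {ι : S → X.graph.H} {s : O.obj S} {κ : T → X.graph.H}
    {t : O.obj T} (hs : X.IsLabel (X.graph.att e) ι s)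
    (ht : X.IsLabel (X.graph.att (X.graph.opp e)) κ t) {a : S} {b : T} (ha : ι a = e)
    (hb : κ b = X.graph.opp e) :
    ∃ ι' : {s : S // s ≠ a} ⊕ {t : T // t ≠ b} → X.graph.HalfRest e,
      (∀ i, (ι' (Sum.inl i)).1 = ι i.1) ∧ (∀ i, (ι' (Sum.inr i)).1 = κ i.1) ∧
      (X.contract e he).IsLabel (X.graph.quotVertex e he v) ι' (O.comp a b s t) := by
  have hι : ∀ i : {s : S // s ≠ a}, ι i.1 ≠ e ∧ ι i.1 ≠ X.graph.opp e := fun i =>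
    ⟨fun h' => i.2 (hs.injective (h'.trans ha.symm)),
      fun h' => he (by rw [← hs.att_eq i.1, h'])⟩
  have hκ : ∀ i : {t : T // t ≠ b}, κ i.1 ≠ e ∧ κ i.1 ≠ X.graph.opp e := fun i =>
    ⟨fun h' => he (by rw [← ht.att_eq i.1, h']),
      fun h' => i.2 (ht.injective (h'.trans hb.symm))⟩
  exact ⟨Sum.elim (fun i => ⟨ι i.1, hι i⟩) (fun i => ⟨κ i.1, hκ i⟩), fun _ => rfl, fun _ => rfl,
    hs.contract_none he hv ht ha hb _ (fun _ => rfl) (fun _ => rfl)⟩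

end LabelledGraph.IsLabel

end

/-! ### Contracting two edges in either order -/

section

open OGraph

variable {k : Type u} [Field k] {O : CyclicOperad.{u, w} k}

/-- The contraction of the edge of `e` followed by that of the edge of `f`, as an element
of `𝒢^𝒪`; it is zero if the two edges coincide. -/
def contractTwice (X : LabelledGraph O) (e f : X.graph.H) : GraphSpace O :=
  if he : X.graph.att e ≠ X.graph.att (X.graph.opp e) then
    X.graph.contractSign e •
      if hf : f ≠ e ∧ f ≠ X.graph.opp e then contractClass (X.contract e he) ⟨f, hf⟩ else 0
  else 0

theorem contractTwice_iso {Γ Γ' : OGraph} (f : Γ.Iso Γ') (x : ∀ v, O.obj (Γ.Star v))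
    (y : ∀ v, O.obj (Γ'.Star v)) (h : ∀ v, y (f.onV v) = O.map (f.star v) (x v)) (e e' : Γ.H) :
    contractTwice ⟨Γ, x⟩ e e' = f.sign • contractTwice ⟨Γ', y⟩ (f.onH e) (f.onH e') := by
  unfold contractTwice
  by_cases he : Γ.att e ≠ Γ.att (Γ.opp e)
  · rw [dif_pos he, dif_pos (f.loop_iff.not.2 he)]
    by_cases he' : e' ≠ e ∧ e' ≠ Γ.opp e
    · have he'' : f.onH e' ≠ f.onH e ∧ f.onH e' ≠ Γ'.opp (f.onH e) := by
        rwa [f.opp_onH, f.onH.injective.ne_iff, f.onH.injective.ne_iff]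
      rw [dif_pos he', dif_pos he'', smul_smul,
        contractClass_iso (f.contract e he) _ _ (contractLabel_iso f x y h e he)
          (⟨e', he'⟩ : Γ.HalfRest e),
        smul_smul, f.sign_contract e he]
      rfl
    · have he'' : ¬ (f.onH e' ≠ f.onH e ∧ f.onH e' ≠ Γ'.opp (f.onH e)) := by
        rwa [f.opp_onH, f.onH.injective.ne_iff, f.onH.injective.ne_iff]
      rw [dif_neg he', dif_neg he'', smul_zero, smul_zero, smul_zero]
  · rw [dif_neg he, dif_neg (fun h' => he (f.loop_iff.not.1 h')), smul_zero]

theorem contractTwice_opp_right (X : LabelledGraph O) (e f : X.graph.H) :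
    contractTwice X e (X.graph.opp f) = contractTwice X e f := by
  have := X.graph.opp_opp
  unfold contractTwice
  by_cases he : X.graph.att e ≠ X.graph.att (X.graph.opp e)
  · rw [dif_pos he, dif_pos he]
    by_cases hf : f ≠ e ∧ f ≠ X.graph.opp e
    · have hf' : X.graph.opp f ≠ e ∧ X.graph.opp f ≠ X.graph.opp e := by grind
      rw [dif_pos hf, dif_pos hf', ← contractClass_opp (X.contract e he)
        (⟨f, hf⟩ : X.graph.HalfRest e)]
      rfl
    · have hf' : ¬ (X.graph.opp f ≠ e ∧ X.graph.opp f ≠ X.graph.opp e) := by grind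
      rw [dif_neg hf, dif_neg hf']
  · rw [dif_neg he, dif_neg he]

/-- The contractions along `e` and `opp e` are isomorphic with sign 1, by an isomorphism that is the
identity on the remaining half-edges and hence keeps `f`. -/
theorem contractTwice_opp_left (X : LabelledGraph O) (e f : X.graph.H) :
    contractTwice X (X.graph.opp e) f = contractTwice X e f := by
  unfold contractTwice
  by_cases he : X.graph.att e ≠ X.graph.att (X.graph.opp e)
  · have he' : X.graph.att (X.graph.opp e) ≠ X.graph.att (X.graph.opp (X.graph.opp e)) := by
      rw [X.graph.opp_opp]
      exact he.symm
    rw [dif_pos he, dif_pos he', X.graph.contractSign_opp e he]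
    by_cases hf : f ≠ e ∧ f ≠ X.graph.opp e
    · have hf' : f ≠ X.graph.opp e ∧ f ≠ X.graph.opp (X.graph.opp e) := by
        rw [X.graph.opp_opp]
        exact hf.symm
      obtain ⟨φ, hφ, hs, h⟩ := exists_iso_contract_opp X.graph X.label e he he'
      rw [dif_pos hf, dif_pos hf',
        contractClass_iso φ _ _ h (⟨f, hf'⟩ : X.graph.HalfRest (X.graph.opp e)), hs, one_smul]
      congr 2
      exact Subtype.ext (hφ _)
    · rw [dif_neg hf, dif_neg (by rw [X.graph.opp_opp, and_comm]; exact hf)]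
  · rw [dif_neg he, dif_neg (by rw [X.graph.opp_opp]; exact fun h => he h.symm)]

/-- The two labelled graphs have the same label at `v` and `w`, half-edges being identified with
the help of `ι` and `κ`. -/
def SameLabel (X Y : LabelledGraph O) {H : Type} (ι : X.graph.H → H) (κ : Y.graph.H → H)
    (v : X.graph.V) (w : Y.graph.V) : Prop :=
  ∃ (S : Type) (_ : Finite S) (s : O.obj S) (f : S → X.graph.H) (g : S → Y.graph.H),
    X.IsLabel v f s ∧ Y.IsLabel w g s ∧ ∀ i, ι (f i) = κ (g i)

theorem SameLabel.symm {X Y : LabelledGraph O} {H : Type} {ι : X.graph.H → H}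
    {κ : Y.graph.H → H} {v : X.graph.V} {w : Y.graph.V} (h : SameLabel X Y ι κ v w) :
    SameLabel Y X κ ι w v := by
  obtain ⟨S, hS, s, f, g, h1, h2, h3⟩ := h
  exact ⟨S, hS, s, g, f, h2, h1, fun i => (h3 i).symm⟩

theorem SameLabel.isLabel {X Y : LabelledGraph O} {H : Type} {ι : X.graph.H → H}
    {κ : Y.graph.H → H} {v : X.graph.V} {w : Y.graph.V} (h : SameLabel X Y ι κ v w)
    (ψ : X.graph.H → Y.graph.H) (hκ : Function.Injective κ) (hψ : ∀ i, κ (ψ i) = ι i) :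
    Y.IsLabel w (fun i : X.graph.Star v => ψ i.1) (X.label v) := by
  obtain ⟨S, hS, s, f, g, h1, h2, h3⟩ := h
  exact h1.transfer ψ (h2.congr fun i => hκ ((hψ _).trans (h3 i)))

section TwoEdges

variable {X : LabelledGraph O} {e f : X.graph.H}
  (he : X.graph.att e ≠ X.graph.att (X.graph.opp e))
  (hf : X.graph.att f ≠ X.graph.att (X.graph.opp f))
  (hef : f ≠ e ∧ f ≠ X.graph.opp e) (hfe : e ≠ f ∧ e ≠ X.graph.opp f)
  (h1 : X.graph.quotVertex e he (X.graph.att f) ≠ X.graph.quotVertex e he (X.graph.att (X.graph.opp f)))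
  (h2 : X.graph.quotVertex f hf (X.graph.att e) ≠ X.graph.quotVertex f hf (X.graph.att (X.graph.opp e)))

/-- The quotient map to the contraction of two edges. -/
def quotVertexTwice (v : X.graph.V) : ((X.contract e he).contract ⟨f, hef⟩ h1).graph.V :=
  (X.graph.contract e he).quotVertex ⟨f, hef⟩ h1 (X.graph.quotVertex e he v)

theorem quotVertexTwice_surjective : Function.Surjective (quotVertexTwice he hef h1) :=
  (quotVertex_surjective _ _ _).comp (quotVertex_surjective _ _ _)

theorem quotVertexTwice_eq_iff {v w : X.graph.V} :
    quotVertexTwice he hef h1 v = quotVertexTwice he hef h1 w ↔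
      X.graph.quotVertex e he v = X.graph.quotVertex e he w ∨
      ((X.graph.quotVertex e he v = X.graph.quotVertex e he (X.graph.att f) ∨
        X.graph.quotVertex e he v = X.graph.quotVertex e he (X.graph.att (X.graph.opp f))) ∧
      (X.graph.quotVertex e he w = X.graph.quotVertex e he (X.graph.att f) ∨
        X.graph.quotVertex e he w = X.graph.quotVertex e he (X.graph.att (X.graph.opp f)))) :=
  quotVertex_eq_iff

/-- Both maps divide by the equivalence relation generated by identifying the ends of `e` and the
ends of `f`, in which the order plays no role. -/
theorem quotVertexTwice_comm {v w : X.graph.V} :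
    quotVertexTwice he hef h1 v = quotVertexTwice he hef h1 w ↔
      quotVertexTwice hf hfe h2 v = quotVertexTwice hf hfe h2 w := by
  rw [quotVertexTwice_eq_iff, quotVertexTwice_eq_iff]
  simp only [quotVertex_eq_iff]
  generalize X.graph.att e = a, X.graph.att (X.graph.opp e) = b, X.graph.att f = c,
    X.graph.att (X.graph.opp f) = d
  constructor <;> grind (splits := 20)

theorem contract_contract_lt (v w : X.graph.V) :
    ((X.contract e he).contract ⟨f, hef⟩ h1).graph.lt (quotVertexTwice he hef h1 v)
      (quotVertexTwice he hef h1 w) ↔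
    (X.graph.quotVertex e he w ≠ X.graph.quotVertex e he (X.graph.att f) ∧
      X.graph.quotVertex e he w ≠ X.graph.quotVertex e he (X.graph.att (X.graph.opp f))) ∧
    ((X.graph.quotVertex e he v = X.graph.quotVertex e he (X.graph.att f) ∨
      X.graph.quotVertex e he v = X.graph.quotVertex e he (X.graph.att (X.graph.opp f))) ∨
      (w ≠ X.graph.att e ∧ w ≠ X.graph.att (X.graph.opp e)) ∧
        ((v = X.graph.att e ∨ v = X.graph.att (X.graph.opp e)) ∨ X.graph.lt v w)) := by
  refine (contract_lt_quotVertex _ _ _ _ _).trans ?_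
  rw [contract_lt_quotVertex]
  rfl

/-- The half-edges remaining after the contraction of two edges. -/
def halfRestComm : ((X.contract e he).contract ⟨f, hef⟩ h1).graph.H ≃
    ((X.contract f hf).contract ⟨e, hfe⟩ h2).graph.H where
  toFun h := ⟨⟨h.1.1, fun h' => h.2.1 (Subtype.ext h'), fun h' => h.2.2 (Subtype.ext h')⟩,
    fun h' => h.1.2.1 (congrArg Subtype.val h'), fun h' => h.1.2.2 (congrArg Subtype.val h')⟩
  invFun h := ⟨⟨h.1.1, fun h' => h.2.1 (Subtype.ext h'), fun h' => h.2.2 (Subtype.ext h')⟩,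
    fun h' => h.1.2.1 (congrArg Subtype.val h'), fun h' => h.1.2.2 (congrArg Subtype.val h')⟩
  left_inv _ := rfl
  right_inv _ := rfl

/-- The contraction of `f` only carries the two labels at the ends of `e` along, so it makes no
difference whether they are composed before or after it. -/
theorem sameLabel_of_disjoint
    (hd : (X.graph.att f ≠ X.graph.att e ∧ X.graph.att f ≠ X.graph.att (X.graph.opp e)) ∧
      X.graph.att (X.graph.opp f) ≠ X.graph.att e ∧
        X.graph.att (X.graph.opp f) ≠ X.graph.att (X.graph.opp e)) {v : X.graph.V}
    (hv : v = X.graph.att e ∨ v = X.graph.att (X.graph.opp e)) :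
    SameLabel ((X.contract e he).contract ⟨f, hef⟩ h1) ((X.contract f hf).contract ⟨e, hfe⟩ h2)
      (fun h => h.1.1) (fun h => h.1.1)
      (quotVertexTwice he hef h1 v) (quotVertexTwice hf hfe h2 v) := by
  have hu := LabelledGraph.IsLabel.self X (X.graph.att e)
  have hw := LabelledGraph.IsLabel.self X (X.graph.att (X.graph.opp e))
  obtain ⟨ι, i1, i2, hι⟩ := hu.exists_contract_of_eq he hv hw (a := ⟨e, rfl⟩)
    (b := ⟨X.graph.opp e, rfl⟩) rfl rfl
  obtain ⟨ι', i3, hι'⟩ := hι.exists_contract_of_ne (X := X.contract e he)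
    (e := (⟨f, hef⟩ : X.graph.HalfRest e)) h1 (by
    change X.graph.quotVertex e he v ≠ X.graph.quotVertex e he (X.graph.att f) ∧
      X.graph.quotVertex e he v ≠ X.graph.quotVertex e he (X.graph.att (X.graph.opp f))
    rw [Ne, Ne, quotVertex_eq_iff, quotVertex_eq_iff]
    grind)
  obtain ⟨κ, k1, hκ⟩ := hu.exists_contract_of_ne hf (by grind)
  obtain ⟨μ, m1, hμ⟩ := hw.exists_contract_of_ne hf (by grind)
  obtain ⟨κ', k2, k3, hκ'⟩ := hκ.exists_contract_of_eq (X := X.contract f hf)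
    (e := (⟨e, hfe⟩ : X.graph.HalfRest f)) h2
    (v := X.graph.quotVertex f hf v) (by
      rcases hv with rfl | rfl
      · exact Or.inl rfl
      · exact Or.inr rfl) hμ (a := ⟨e, rfl⟩) (b := ⟨X.graph.opp e, rfl⟩)
    (Subtype.ext (k1 _)) (Subtype.ext (m1 _))
  refine ⟨_, inferInstance, _, ι', κ', hι', hκ', ?_⟩
  rintro (i | i)
  · exact (congrArg Subtype.val (i3 _)).trans ((i1 _).trans
      ((congrArg Subtype.val (k2 _)).trans (k1 _)).symm)
  · exact (congrArg Subtype.val (i3 _)).trans ((i2 _).trans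
      ((congrArg Subtype.val (k3 _)).trans (m1 _)).symm)

theorem sameLabel_of_ne {v : X.graph.V}
    (hv : v ≠ X.graph.att e ∧ v ≠ X.graph.att (X.graph.opp e))
    (hv' : v ≠ X.graph.att f ∧ v ≠ X.graph.att (X.graph.opp f)) :
    SameLabel ((X.contract e he).contract ⟨f, hef⟩ h1) ((X.contract f hf).contract ⟨e, hfe⟩ h2)
      (fun h => h.1.1) (fun h => h.1.1)
      (quotVertexTwice he hef h1 v) (quotVertexTwice hf hfe h2 v) := by
  have hu := LabelledGraph.IsLabel.self X v
  obtain ⟨ι, i1, hι⟩ := hu.exists_contract_of_ne he hv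
  obtain ⟨ι', i2, hι'⟩ := hι.exists_contract_of_ne (X := X.contract e he)
    (e := (⟨f, hef⟩ : X.graph.HalfRest e)) h1 (by
    change X.graph.quotVertex e he v ≠ X.graph.quotVertex e he (X.graph.att f) ∧
      X.graph.quotVertex e he v ≠ X.graph.quotVertex e he (X.graph.att (X.graph.opp f))
    rw [Ne, Ne, quotVertex_eq_iff, quotVertex_eq_iff]
    grind)
  obtain ⟨κ, k1, hκ⟩ := hu.exists_contract_of_ne hf hv'
  obtain ⟨κ', k2, hκ'⟩ := hκ.exists_contract_of_ne (X := X.contract f hf)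
    (e := (⟨e, hfe⟩ : X.graph.HalfRest f)) h2 (by
    change X.graph.quotVertex f hf v ≠ X.graph.quotVertex f hf (X.graph.att e) ∧
      X.graph.quotVertex f hf v ≠ X.graph.quotVertex f hf (X.graph.att (X.graph.opp e))
    rw [Ne, Ne, quotVertex_eq_iff, quotVertex_eq_iff]
    grind)
  exact ⟨_, inferInstance, _, ι', κ', hι', hκ', fun i =>
    (congrArg Subtype.val (i2 _)).trans ((i1 _).trans
      ((congrArg Subtype.val (k2 _)).trans (k1 _)).symm)⟩

/-- Operadic associativity: with labels a, b, c at the start of `e`, the common vertex and the end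
of `f`, one order of contraction produces (a b) c and the other a (b c). -/
theorem sameLabel_of_adjacent (ha : X.graph.att f = X.graph.att (X.graph.opp e))
    (ha' : X.graph.att e ≠ X.graph.att (X.graph.opp f)) {v : X.graph.V}
    (hv : v = X.graph.att e ∨ v = X.graph.att f ∨ v = X.graph.att (X.graph.opp f)) :
    SameLabel ((X.contract e he).contract ⟨f, hef⟩ h1) ((X.contract f hf).contract ⟨e, hfe⟩ h2)
      (fun h => h.1.1) (fun h => h.1.1)
      (quotVertexTwice he hef h1 v) (quotVertexTwice hf hfe h2 v) := by
  have hu := LabelledGraph.IsLabel.self X (X.graph.att e)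
  have hw := LabelledGraph.IsLabel.self X (X.graph.att (X.graph.opp e))
  have hz := LabelledGraph.IsLabel.self X (X.graph.att (X.graph.opp f))
  have hw' := hw
  nth_rw 1 [← ha] at hw'
  obtain ⟨ι, i1, i2, hι⟩ := hu.exists_contract_of_eq he (v := X.graph.att f) (Or.inr ha) hw
    (a := ⟨e, rfl⟩) (b := ⟨X.graph.opp e, rfl⟩) rfl rfl
  obtain ⟨μ, m1, hμ⟩ := hz.exists_contract_of_ne he (by grind)
  obtain ⟨ι', i3, i4, hι'⟩ := hι.exists_contract_of_eq (X := X.contract e he)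
    (e := (⟨f, hef⟩ : X.graph.HalfRest e)) h1
    (v := X.graph.quotVertex e he v) (by
      change X.graph.quotVertex e he v = X.graph.quotVertex e he (X.graph.att f) ∨
        X.graph.quotVertex e he v = X.graph.quotVertex e he (X.graph.att (X.graph.opp f))
      rw [quotVertex_eq_iff, quotVertex_eq_iff]
      grind) hμ
    (a := Sum.inr ⟨⟨f, ha⟩, fun h => hef.2 (congrArg Subtype.val h)⟩)
    (b := ⟨X.graph.opp f, rfl⟩) (Subtype.ext (i2 _)) (Subtype.ext (m1 _))
  obtain ⟨κ, k1, k2, hκ⟩ := hw'.exists_contract_of_eq hf (v := X.graph.att (X.graph.opp e))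
    (Or.inl ha.symm) hz (a := ⟨f, ha⟩) (b := ⟨X.graph.opp f, rfl⟩) rfl rfl
  obtain ⟨ν, n1, hν⟩ := hu.exists_contract_of_ne hf (by grind)
  obtain ⟨κ', k3, k4, hκ'⟩ := hν.exists_contract_of_eq (X := X.contract f hf)
    (e := (⟨e, hfe⟩ : X.graph.HalfRest f)) h2
    (v := X.graph.quotVertex f hf v) (by
      change X.graph.quotVertex f hf v = X.graph.quotVertex f hf (X.graph.att e) ∨
        X.graph.quotVertex f hf v = X.graph.quotVertex f hf (X.graph.att (X.graph.opp e))
      rw [quotVertex_eq_iff, quotVertex_eq_iff]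
      grind) hκ
    (a := ⟨e, rfl⟩)
    (b := Sum.inl ⟨⟨X.graph.opp e, rfl⟩, fun h => hef.2 (congrArg Subtype.val h).symm⟩)
    (Subtype.ext (n1 _)) (Subtype.ext (k1 _))
  -- Turns the composite formed in the order `f`, `e` into the one formed in the order `e`, `f`, up
  -- to the relabelling `gluingAssoc`, which `of_map` then absorbs.
  rw [← O.comp_assoc] at hκ'
  refine ⟨_, inferInstance, _, ι', _, hι', hκ'.of_map, ?_⟩
  rintro (⟨i | i, hi⟩ | i)
  · exact (congrArg Subtype.val (i3 _)).trans ((i1 _).trans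
      ((congrArg Subtype.val (k3 _)).trans (n1 _)).symm)
  · exact (congrArg Subtype.val (i3 _)).trans ((i2 _).trans
      ((congrArg Subtype.val (k4 _)).trans (k1 _)).symm)
  · exact (congrArg Subtype.val (i4 _)).trans ((m1 _).trans
      ((congrArg Subtype.val (k4 _)).trans (k2 _)).symm)

end TwoEdges

end

/-! ### Anticommutation of contractions -/

section

open OGraph

variable {k : Type u} [Field k] {O : CyclicOperad.{u, w} k}

section TwoEdges

variable {X : LabelledGraph O} {e f : X.graph.H}
  (he : X.graph.att e ≠ X.graph.att (X.graph.opp e))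
  (hf : X.graph.att f ≠ X.graph.att (X.graph.opp f))
  (hef : f ≠ e ∧ f ≠ X.graph.opp e) (hfe : e ≠ f ∧ e ≠ X.graph.opp f)
  (h1 : X.graph.quotVertex e he (X.graph.att f) ≠
    X.graph.quotVertex e he (X.graph.att (X.graph.opp f)))
  (h2 : X.graph.quotVertex f hf (X.graph.att e) ≠
    X.graph.quotVertex f hf (X.graph.att (X.graph.opp e)))

theorem contractTwice_eq_smul : contractTwice X e f = (X.graph.contractSign e *
    (X.graph.contract e he).contractSign (⟨f, hef⟩ : X.graph.HalfRest e)) •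
      graphClass ((X.contract e he).contract (⟨f, hef⟩ : X.graph.HalfRest e) h1) := by
  unfold contractTwice
  rw [dif_pos he, dif_pos hef]
  have : contractClass (X.contract e he) (⟨f, hef⟩ : X.graph.HalfRest e) =
    (X.graph.contract e he).contractSign (⟨f, hef⟩ : X.graph.HalfRest e) •
      graphClass ((X.contract e he).contract (⟨f, hef⟩ : X.graph.HalfRest e) h1) := dif_pos h1
  rw [this, smul_smul]

/-- Either `f` has become a loop, or it belongs to the edge of `e`; both count as zero. -/
theorem contractTwice_eq_zero {X : LabelledGraph O} {e f : X.graph.H}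
    (he : X.graph.att e ≠ X.graph.att (X.graph.opp e)) (h : X.graph.quotVertex e he (X.graph.att f) =
    X.graph.quotVertex e he (X.graph.att (X.graph.opp f))) : contractTwice X e f = 0 := by
  unfold contractTwice
  rw [dif_pos he]
  by_cases hf : f ≠ e ∧ f ≠ X.graph.opp e
  · rw [dif_pos hf]
    have : contractClass (X.contract e he) (⟨f, hf⟩ : X.graph.HalfRest e) = 0 :=
      dif_neg (fun h' => h' h)
    rw [this, smul_zero]
  · rw [dif_neg hf, smul_zero]

/-- The sign of the isomorphism is left open, because it depends on whether the two edges have a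
common end. -/
theorem exists_iso_contract_contract
    (hl : ∀ v, SameLabel ((X.contract e he).contract ⟨f, hef⟩ h1)
      ((X.contract f hf).contract ⟨e, hfe⟩ h2) (fun h => h.1.1) (fun h => h.1.1)
      (quotVertexTwice he hef h1 v) (quotVertexTwice hf hfe h2 v)) :
    ∃ φ : ((X.contract e he).contract ⟨f, hef⟩ h1).graph.Iso
        ((X.contract f hf).contract ⟨e, hfe⟩ h2).graph,
      φ.onH = halfRestComm he hf hef hfe h1 h2 ∧
      (∀ v, φ.onV (quotVertexTwice he hef h1 v) = quotVertexTwice hf hfe h2 v) ∧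
      graphClass ((X.contract e he).contract ⟨f, hef⟩ h1) =
        φ.sign • graphClass ((X.contract f hf).contract ⟨e, hfe⟩ h2) := by
  obtain ⟨φ, hφ, hφ', h⟩ := exists_iso_of_quot (X := (X.contract e he).contract ⟨f, hef⟩ h1)
    (Y := (X.contract f hf).contract ⟨e, hfe⟩ h2) (quotVertexTwice he hef h1)
    (quotVertexTwice hf hfe h2) (quotVertexTwice_surjective he hef h1)
    (quotVertexTwice_surjective hf hfe h2)
    (fun v w => quotVertexTwice_comm he hf hef hfe h1 h2)
    (halfRestComm he hf hef hfe h1 h2) (fun _ => rfl)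
    (fun h => ⟨X.graph.att h.1.1, rfl, rfl⟩)
    (fun v => (hl v).isLabel _ (fun i j hij => Subtype.ext (Subtype.ext hij)) fun _ => rfl)
  exact ⟨φ, hφ, hφ', respects_graphClass.iso φ _ _ h⟩

end TwoEdges

/-- Three vertices merge into one, which is the first vertex in both cases, and the others keep
their order. The isomorphism therefore has sign 1, and the minus sign comes from the contraction
signs. -/
theorem contractTwice_anticomm_adjacent {X : LabelledGraph O} {e f : X.graph.H}
    (he : X.graph.att e ≠ X.graph.att (X.graph.opp e))
    (hf : X.graph.att f ≠ X.graph.att (X.graph.opp f))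
    (hef : f ≠ e ∧ f ≠ X.graph.opp e) (hfe : e ≠ f ∧ e ≠ X.graph.opp f)
    (ha : X.graph.att f = X.graph.att (X.graph.opp e))
    (ha' : X.graph.att e ≠ X.graph.att (X.graph.opp f)) :
    contractTwice X e f = -contractTwice X f e := by
  have h1 : X.graph.quotVertex e he (X.graph.att f) ≠
      X.graph.quotVertex e he (X.graph.att (X.graph.opp f)) := by
    rw [Ne, quotVertex_eq_iff]
    grind
  have h2 : X.graph.quotVertex f hf (X.graph.att e) ≠
      X.graph.quotVertex f hf (X.graph.att (X.graph.opp e)) := by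
    rw [Ne, quotVertex_eq_iff]
    grind
  rw [contractTwice_eq_smul he hef h1, contractTwice_eq_smul hf hfe h2,
    contractSign_anticomm_adjacent hf hef hfe ha ha', neg_smul]
  congr 2
  obtain ⟨φ, hφ, hφ', h⟩ := exists_iso_contract_contract he hf hef hfe h1 h2 fun v => by
    by_cases hv : v = X.graph.att e ∨ v = X.graph.att f ∨ v = X.graph.att (X.graph.opp f)
    · exact sameLabel_of_adjacent he hf hef hfe h1 h2 ha ha' hv
    · exact sameLabel_of_ne he hf hef hfe h1 h2 (by grind) (by grind)
  rw [h, φ.sign_eq_one, one_smul]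
  · intro v w
    obtain ⟨v, rfl⟩ := quotVertexTwice_surjective he hef h1 v
    obtain ⟨w, rfl⟩ := quotVertexTwice_surjective he hef h1 w
    rw [hφ', hφ', contract_contract_lt, contract_contract_lt]
    simp only [Ne, quotVertex_eq_iff]
    clear hφ' hφ h φ h1 h2
    generalize X.graph.att e = a, X.graph.att (X.graph.opp e) = b, X.graph.att f = c,
      X.graph.att (X.graph.opp f) = d at *
    grind (splits := 20)
  · intro h
    rw [hφ]
    rfl

/-- Here the contraction signs agree, and it is the isomorphism that has sign -1. -/
theorem contractTwice_anticomm_disjoint {X : LabelledGraph O} {e f : X.graph.H}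
    (he : X.graph.att e ≠ X.graph.att (X.graph.opp e))
    (hf : X.graph.att f ≠ X.graph.att (X.graph.opp f))
    (hef : f ≠ e ∧ f ≠ X.graph.opp e) (hfe : e ≠ f ∧ e ≠ X.graph.opp f)
    (h3 : X.graph.att f ≠ X.graph.att e ∧ X.graph.att f ≠ X.graph.att (X.graph.opp e))
    (h4 : X.graph.att (X.graph.opp f) ≠ X.graph.att e ∧
      X.graph.att (X.graph.opp f) ≠ X.graph.att (X.graph.opp e)) :
    contractTwice X e f = -contractTwice X f e := by
  have h1 : X.graph.quotVertex e he (X.graph.att f) ≠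
      X.graph.quotVertex e he (X.graph.att (X.graph.opp f)) := by
    rw [Ne, quotVertex_eq_iff]
    grind
  have h2 : X.graph.quotVertex f hf (X.graph.att e) ≠
      X.graph.quotVertex f hf (X.graph.att (X.graph.opp e)) := by
    rw [Ne, quotVertex_eq_iff]
    grind
  rw [contractTwice_eq_smul he hef h1, contractTwice_eq_smul hf hfe h2,
    contractSign_anticomm_disjoint hf hef hfe h3 h4, ← smul_neg]
  congr 1
  obtain ⟨φ, hφ, hφ', h⟩ := exists_iso_contract_contract he hf hef hfe h1 h2 fun v => by
    by_cases hv : v = X.graph.att e ∨ v = X.graph.att (X.graph.opp e)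
    · exact sameLabel_of_disjoint he hf hef hfe h1 h2 ⟨h3, h4⟩ hv
    by_cases hv' : v = X.graph.att f ∨ v = X.graph.att (X.graph.opp f)
    · exact (sameLabel_of_disjoint hf he hfe hef h2 h1
        ⟨⟨h3.1.symm, h4.1.symm⟩, h3.2.symm, h4.2.symm⟩ hv').symm
    · exact sameLabel_of_ne he hf hef hfe h1 h2 (by grind) (by grind)
  have hflips : φ.flips = ∅ := by
    refine Finset.filter_eq_empty_iff.2 fun i _ hi => ?_
    rw [hφ] at hi
    exact absurd (hi.1.symm.trans hi.2) (by simp)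
  -- The edge contracted last provides the first vertex and the one contracted before it the second,
  -- so the two merged vertices form the only inverted pair.
  have hinv : inversions ((X.contract e he).contract ⟨f, hef⟩ h1).graph.lt
      ((X.contract f hf).contract ⟨e, hfe⟩ h2).graph.lt φ.onV =
      {(quotVertexTwice he hef h1 (X.graph.att f), quotVertexTwice he hef h1 (X.graph.att e))} := by
    ext ⟨v, w⟩
    obtain ⟨v, rfl⟩ := quotVertexTwice_surjective he hef h1 v
    obtain ⟨w, rfl⟩ := quotVertexTwice_surjective he hef h1 w
    refine Finset.mem_filter.trans ?_
    rw [Finset.mem_singleton, Prod.mk.injEq]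
    dsimp only
    rw [hφ', hφ', contract_contract_lt, contract_contract_lt, quotVertexTwice_eq_iff,
      quotVertexTwice_eq_iff]
    simp only [Finset.mem_univ, true_and, Ne, quotVertex_eq_iff]
    have := X.graph.lt_asymm (a := v) (b := w)
    clear hφ' hφ h hflips φ h1 h2
    generalize X.graph.att e = a, X.graph.att (X.graph.opp e) = b, X.graph.att f = c,
      X.graph.att (X.graph.opp f) = d at *
    constructor <;> grind (splits := 20)
  have hsign : φ.sign = -1 := by
    unfold Iso.sign
    rw [hflips, hinv]
    simp
  rw [h, hsign, neg_one_smul]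

/-- Contracting two edges in either order gives opposite results. -/
theorem contractTwice_anticomm (X : LabelledGraph O) (e f : X.graph.H) :
    contractTwice X e f = -contractTwice X f e := by
  have hopp := X.graph.opp_opp
  by_cases he : X.graph.att e ≠ X.graph.att (X.graph.opp e)
  swap
  -- A loop stays a loop when another edge is contracted, so both orders give zero.
  · have h1 : contractTwice X e f = 0 := dif_neg he
    rw [h1, zero_eq_neg]
    by_cases hf : X.graph.att f ≠ X.graph.att (X.graph.opp f)
    · exact contractTwice_eq_zero hf (congrArg _ (not_not.1 he))
    · exact dif_neg hf
  by_cases hf : X.graph.att f ≠ X.graph.att (X.graph.opp f)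
  swap
  · have h1 : contractTwice X f e = 0 := dif_neg hf
    rw [h1, neg_zero]
    exact contractTwice_eq_zero he (congrArg _ (not_not.1 hf))
  by_cases h1 : X.graph.quotVertex e he (X.graph.att f) =
    X.graph.quotVertex e he (X.graph.att (X.graph.opp f))
  -- In this case `f` joins the two ends of `e`, which is a symmetric condition; both orders give
  -- zero.
  · rw [contractTwice_eq_zero he h1, contractTwice_eq_zero hf, neg_zero]
    rw [quotVertex_eq_iff] at h1 ⊢
    grind
  have hef : f ≠ e ∧ f ≠ X.graph.opp e := by
    rw [quotVertex_eq_iff] at h1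
    constructor <;> rintro rfl <;> grind
  have hfe : e ≠ f ∧ e ≠ X.graph.opp f := by grind
  rw [quotVertex_eq_iff] at h1
  -- Whichever ends coincide, reversing `e` or `f` makes `f` start where `e` ends, and reversal does
  -- not affect `contractTwice`.
  have key : ∀ e' f' : X.graph.H, (e' = e ∨ e' = X.graph.opp e) → (f' = f ∨ f' = X.graph.opp f) →
      X.graph.att f' = X.graph.att (X.graph.opp e') →
      contractTwice X e' f' = -contractTwice X f' e' := by
    intro e' f' he' hf' ha
    refine contractTwice_anticomm_adjacent ?_ ?_ ?_ ?_ ha ?_ <;> grind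
  by_cases h3 : X.graph.att f = X.graph.att (X.graph.opp e)
  · exact key e f (Or.inl rfl) (Or.inl rfl) h3
  by_cases h4 : X.graph.att (X.graph.opp f) = X.graph.att (X.graph.opp e)
  · have := key e (X.graph.opp f) (Or.inl rfl) (Or.inr rfl) h4
    rwa [contractTwice_opp_left, contractTwice_opp_right] at this
  by_cases h5 : X.graph.att f = X.graph.att e
  · have := key (X.graph.opp e) f (Or.inr rfl) (Or.inl rfl) (by rw [hopp, h5])
    rwa [contractTwice_opp_left, contractTwice_opp_right] at this
  by_cases h6 : X.graph.att (X.graph.opp f) = X.graph.att e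
  · have := key (X.graph.opp e) (X.graph.opp f) (Or.inr rfl) (Or.inr rfl) (by rw [hopp, h6])
    rwa [contractTwice_opp_left, contractTwice_opp_right, contractTwice_opp_right,
      contractTwice_opp_left] at this
  exact contractTwice_anticomm_disjoint he hf hef hfe ⟨h5, h3⟩ ⟨h6, h4⟩

end

/-! ### Gluing a square commutes with contracting another edge -/

section

open OGraph

variable {k : Type u} [Field k] {O : CyclicOperad.{u, w} k}

/-- The labelled graph obtained by gluing a square along two directed edges. -/
abbrev LabelledGraph.glue (X : LabelledGraph O) (e₁ e₂ : X.graph.H)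
    (h : X.graph.Indep e₁ e₂) : LabelledGraph O :=
  ⟨X.graph.glue e₁ e₂ h, X.label⟩

theorem glueOpp_eq_opp {Γ : OGraph} {e f₁ f₂ : Γ.H} (h₁ : f₁ ≠ e ∧ f₁ ≠ Γ.opp e)
    (h₂ : f₂ ≠ e ∧ f₂ ≠ Γ.opp e) : Γ.glueOpp f₁ f₂ e = Γ.opp e := by
  have := Γ.opp_opp
  unfold glueOpp
  grind

theorem sameLabel_contract_glue (X : LabelledGraph O) {e f₁ f₂ : X.graph.H}
    (he : X.graph.att e ≠ X.graph.att (X.graph.opp e))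
    (h₁ : f₁ ≠ e ∧ f₁ ≠ X.graph.opp e) (h₂ : f₂ ≠ e ∧ f₂ ≠ X.graph.opp e)
    (h : X.graph.Indep f₁ f₂) (he' : X.graph.att e ≠ X.graph.att (X.graph.glueOpp f₁ f₂ e))
    (v : X.graph.V) :
    SameLabel (X.contract e he) ((X.glue f₁ f₂ h).contract e he') (fun i => i.1) (fun i => i.1)
      (X.graph.quotVertex e he v) ((X.glue f₁ f₂ h).graph.quotVertex e he' v) := by
  have hopp := glueOpp_eq_opp h₁ h₂
  by_cases hv : v ≠ X.graph.att e ∧ v ≠ X.graph.att (X.graph.opp e)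
  · have hu := LabelledGraph.IsLabel.self X v
    obtain ⟨ι, i1, hι⟩ := hu.exists_contract_of_ne he hv
    obtain ⟨κ, k1, hκ⟩ := LabelledGraph.IsLabel.exists_contract_of_ne
      (X := X.glue f₁ f₂ h) (e := e) he' (v := v)
      (by change v ≠ X.graph.att e ∧ v ≠ X.graph.att (X.graph.glueOpp f₁ f₂ e); rwa [hopp]) hu
    exact ⟨_, inferInstance, _, ι, κ, hι, hκ, fun i => (i1 i).trans (k1 i).symm⟩
  · have hv : v = X.graph.att e ∨ v = X.graph.att (X.graph.opp e) := by tauto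
    have hu := LabelledGraph.IsLabel.self X (X.graph.att e)
    have hw := LabelledGraph.IsLabel.self X (X.graph.att (X.graph.opp e))
    have hw' := hw
    nth_rw 1 [← hopp] at hw'
    obtain ⟨ι, i1, i2, hι⟩ := hu.exists_contract_of_eq he hv hw (a := ⟨e, rfl⟩)
      (b := ⟨X.graph.opp e, rfl⟩) rfl rfl
    obtain ⟨κ, k1, k2, hκ⟩ := LabelledGraph.IsLabel.exists_contract_of_eq
      (X := X.glue f₁ f₂ h) (e := e) he' (v := v)
      (by change v = X.graph.att e ∨ v = X.graph.att (X.graph.glueOpp f₁ f₂ e); rwa [hopp]) hu hw'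
      (a := ⟨e, rfl⟩) (b := ⟨X.graph.opp e, rfl⟩) rfl hopp.symm
    refine ⟨_, inferInstance, _, ι, κ, hι, hκ, ?_⟩
    rintro (i | i)
    · exact (i1 i).trans (k1 i).symm
    · exact (i2 i).trans (k2 i).symm

/-- The image of a glued pairing under an injection of half-edges. -/
theorem glueOpp_of_injective {Γ Γ' : OGraph} {ι : Γ.H → Γ'.H} (hι : Function.Injective ι)
    (hopp : ∀ i, Γ'.opp (ι i) = ι (Γ.opp i)) (e₁ e₂ i : Γ.H) :
    Γ'.glueOpp (ι e₁) (ι e₂) (ι i) = ι (Γ.glueOpp e₁ e₂ i) := by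
  unfold glueOpp
  simp only [apply_ite ι, hopp, hι.eq_iff]

theorem glueOut_of_injective {Γ Γ' : OGraph} {ι : Γ.H → Γ'.H} (hι : Function.Injective ι)
    (hopp : ∀ i, Γ'.opp (ι i) = ι (Γ.opp i)) (hout : ∀ i, Γ'.out (ι i) = Γ.out i)
    (e₁ e₂ i : Γ.H) : Γ'.glueOut (ι e₁) (ι e₂) (ι i) = Γ.glueOut e₁ e₂ i := by
  unfold glueOut
  simp only [hopp, hout, hι.eq_iff]

/-- Gluing a square commutes with contracting an edge that is not involved. -/
theorem exists_iso_contract_glue (X : LabelledGraph O) {e f₁ f₂ : X.graph.H}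
    (he : X.graph.att e ≠ X.graph.att (X.graph.opp e))
    (h₁ : f₁ ≠ e ∧ f₁ ≠ X.graph.opp e) (h₂ : f₂ ≠ e ∧ f₂ ≠ X.graph.opp e)
    (h : X.graph.Indep f₁ f₂) (he' : X.graph.att e ≠ X.graph.att (X.graph.glueOpp f₁ f₂ e))
    (h' : (X.graph.contract e he).Indep ⟨f₁, h₁⟩ ⟨f₂, h₂⟩) :
    ∃ φ : ((X.contract e he).glue ⟨f₁, h₁⟩ ⟨f₂, h₂⟩ h').graph.Iso
        ((X.glue f₁ f₂ h).contract e he').graph,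
      (∀ i : X.graph.HalfRest e, (φ.onH i).1 = i.1) ∧ φ.sign = 1 ∧
      ∀ v, ((X.glue f₁ f₂ h).contract e he').label (φ.onV v) =
        O.map (φ.star v) (((X.contract e he).glue ⟨f₁, h₁⟩ ⟨f₂, h₂⟩ h').label v) := by
  have hopp := glueOpp_eq_opp h₁ h₂
  let ψ : X.graph.HalfRest e ≃ (X.graph.glue f₁ f₂ h).HalfRest e :=
    Equiv.subtypeEquivRight fun i => by
      change _ ↔ i ≠ e ∧ i ≠ X.graph.glueOpp f₁ f₂ e
      rw [hopp]
  have hk : ∀ v w : X.graph.V, X.graph.quotVertex e he v = X.graph.quotVertex e he w ↔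
      (X.graph.glue f₁ f₂ h).quotVertex e he' v = (X.graph.glue f₁ f₂ h).quotVertex e he' w := by
    intro v w
    rw [quotVertex_eq_iff]
    refine Iff.trans ?_ quotVertex_eq_iff.symm
    change _ ↔ v = w ∨ ((v = X.graph.att e ∨ v = X.graph.att (X.graph.glueOpp f₁ f₂ e)) ∧
      (w = X.graph.att e ∨ w = X.graph.att (X.graph.glueOpp f₁ f₂ e)))
    rw [hopp]
  obtain ⟨φ, hφ, hs, hl⟩ := exists_oriented_iso_of_quot
    (X := (X.contract e he).glue ⟨f₁, h₁⟩ ⟨f₂, h₂⟩ h')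
    (Y := (X.glue f₁ f₂ h).contract e he')
    (X.graph.quotVertex e he) ((X.graph.glue f₁ f₂ h).quotVertex e he')
    (quotVertex_surjective _ _ _) (quotVertex_surjective _ _ _)
    hk
    ψ
    (fun i => Subtype.ext (glueOpp_of_injective (Γ := X.graph.contract e he) (Γ' := X.graph)
      Subtype.val_injective (fun _ => rfl)
      (⟨f₁, h₁⟩ : X.graph.HalfRest e) (⟨f₂, h₂⟩ : X.graph.HalfRest e) i))
    (fun i => ⟨X.graph.att i.1, rfl, rfl⟩)
    (fun v => (sameLabel_contract_glue X he h₁ h₂ h he' v).isLabel ψ Subtype.val_injective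
      fun _ => rfl)
    (fun v w => by
      refine fun hvw => (contract_lt_quotVertex _ _ _ _ _).2 ?_
      have := (contract_lt_quotVertex _ _ he _ _).1 hvw
      change (w ≠ X.graph.att e ∧ w ≠ X.graph.att (X.graph.glueOpp f₁ f₂ e)) ∧
        ((v = X.graph.att e ∨ v = X.graph.att (X.graph.glueOpp f₁ f₂ e)) ∨ X.graph.lt v w)
      rwa [hopp])
    (fun i => glueOut_of_injective (Γ := X.graph.contract e he) (Γ' := X.graph)
      Subtype.val_injective (fun _ => rfl) (fun _ => rfl)
      (⟨f₁, h₁⟩ : X.graph.HalfRest e) (⟨f₂, h₂⟩ : X.graph.HalfRest e) i)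
  exact ⟨φ, fun i => by rw [hφ]; rfl, hs, hl⟩

theorem indep_contract {Γ : OGraph} {e f₁ f₂ : Γ.H} (he : Γ.att e ≠ Γ.att (Γ.opp e))
    (h₁ : f₁ ≠ e ∧ f₁ ≠ Γ.opp e) (h₂ : f₂ ≠ e ∧ f₂ ≠ Γ.opp e) :
    (Γ.contract e he).Indep ⟨f₁, h₁⟩ ⟨f₂, h₂⟩ ↔ Γ.Indep f₁ f₂ := by
  change ((⟨f₂, h₂⟩ : Γ.HalfRest e) ≠ ⟨f₁, h₁⟩ ∧ (⟨f₂, h₂⟩ : Γ.HalfRest e) ≠ ⟨Γ.opp f₁, _⟩) ↔ _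
  rw [Ne, Ne, Subtype.mk.injEq, Subtype.mk.injEq]
  rfl

/-- Fusing two edges after a contraction amounts to gluing a square before the contraction. -/
theorem smul_fuseClass_contract (X : LabelledGraph O) {e f₁ f₂ : X.graph.H}
    (he : X.graph.att e ≠ X.graph.att (X.graph.opp e))
    (h₁ : f₁ ≠ e ∧ f₁ ≠ X.graph.opp e) (h₂ : f₂ ≠ e ∧ f₂ ≠ X.graph.opp e)
    (h : X.graph.Indep f₁ f₂) :
    X.graph.contractSign e • fuseClass (X.contract e he) (⟨f₁, h₁⟩ : X.graph.HalfRest e)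
        (⟨f₂, h₂⟩ : X.graph.HalfRest e) =
      (X.graph.dirSign f₁ * X.graph.dirSign f₂) • contractTwice (X.glue f₁ f₂ h) e f₂ := by
  have hopp := glueOpp_eq_opp h₁ h₂
  have he' : X.graph.att e ≠ X.graph.att (X.graph.glueOpp f₁ f₂ e) := by rwa [hopp]
  have h' : (X.graph.contract e he).Indep ⟨f₁, h₁⟩ ⟨f₂, h₂⟩ := (indep_contract he h₁ h₂).2 h
  obtain ⟨φ, hφ, hs, hl⟩ := exists_iso_contract_glue X he h₁ h₂ h he' h'
  -- The square changes neither the direction of `e` nor its two ends.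
  have hsign : (X.graph.glue f₁ f₂ h).contractSign e = X.graph.contractSign e := by
    have hd : (X.graph.glue f₁ f₂ h).dirSign e = X.graph.dirSign e := by
      have := X.graph.opp_opp
      change (if X.graph.glueOut f₁ f₂ e = true then (1 : ℤ) else -1) = _
      unfold glueOut dirSign
      grind
    unfold contractSign
    rw [hd]
    congr 2
    change _ + (Finset.univ.filter fun v => v ≠ X.graph.att e ∧
      X.graph.lt v (X.graph.att (X.graph.glueOpp f₁ f₂ e))).card = _
    rw [hopp]
    rfl
  have h2' : f₂ ≠ e ∧ f₂ ≠ X.graph.glueOpp f₁ f₂ e := by rwa [hopp]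
  have e1 : fuseClass (X.contract e he) (⟨f₁, h₁⟩ : X.graph.HalfRest e)
        (⟨f₂, h₂⟩ : X.graph.HalfRest e) = (X.graph.dirSign f₁ * X.graph.dirSign f₂) •
      contractClass ((X.contract e he).glue ⟨f₁, h₁⟩ ⟨f₂, h₂⟩ h')
        (⟨f₂, h₂⟩ : X.graph.HalfRest e) := dif_pos h'
  have e2 : contractTwice (X.glue f₁ f₂ h) e f₂ = (X.graph.glue f₁ f₂ h).contractSign e •
      contractClass ((X.glue f₁ f₂ h).contract e he')
        (⟨f₂, h2'⟩ : (X.graph.glue f₁ f₂ h).HalfRest e) :=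
    (dif_pos he').trans (congrArg _ (dif_pos h2'))
  have e3 := contractClass_iso φ _ _ hl (⟨f₂, h₂⟩ : X.graph.HalfRest e)
  rw [hs, one_smul] at e3
  rw [e1, e2, hsign, smul_comm]
  refine congrArg _ (congrArg _ (e3.trans (congrArg _ ?_)))
  exact Subtype.ext (hφ _)

end

/-! ### Two successive squares -/

section

variable {H : Type} (o : H → H) (t : H → Bool)

/-- The pairing of half-edges after gluing a square. -/
def oppGlue (e₁ e₂ h : H) : H :=
  if h = e₁ then o e₂
  else if h = o e₂ then e₁
  else if h = e₂ then o e₁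
  else if h = o e₁ then e₂
  else o h

/-- The directions of the edges after gluing a square. -/
def outGlue (e₁ e₂ h : H) : Bool :=
  if h = e₁ ∨ h = e₂ then true
  else if h = o e₁ ∨ h = o e₂ then false
  else t h

/-- The pairing of half-edges after gluing two squares, the second one along `q.2.2.1`
and `q.2.2.2`. -/
def oppGlueTwice (q : H × H × H × H) : H → H :=
  oppGlue (oppGlue o q.1 q.2.1) q.2.2.1 q.2.2.2

/-- The directions of the edges after gluing two squares. -/
def outGlueTwice (q : H × H × H × H) : H → Bool :=
  outGlue (oppGlue o q.1 q.2.1) (outGlue o t q.1 q.2.1) q.2.2.1 q.2.2.2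

/-- A square can be glued along `q.1` and `q.2.1`, and after contraction of the edge of `q.2.1`
another one can be glued along `q.2.2.1` and `q.2.2.2`. -/
def Gluable (q : H × H × H × H) : Prop :=
  (q.2.1 ≠ q.1 ∧ q.2.1 ≠ o q.1) ∧ (q.2.2.1 ≠ q.2.1 ∧ q.2.2.1 ≠ o q.1) ∧
    (q.2.2.2 ≠ q.2.1 ∧ q.2.2.2 ≠ o q.1) ∧
    (q.2.2.2 ≠ q.2.2.1 ∧ q.2.2.2 ≠ oppGlue o q.1 q.2.1 q.2.2.1)

/-- The involution which exchanges the two squares. -/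
def exchange (q : H × H × H × H) : H × H × H × H :=
  if q.2.2.1 = q.1 then (q.2.1, q.2.2.2, q.1, q.2.1)
  else if q.2.2.2 = q.1 then (q.2.2.1, q.1, q.2.2.1, q.2.1)
  else if q.2.2.1 = o q.2.1 then (o q.2.2.2, q.1, o q.2.1, o q.1)
  else if q.2.2.2 = o q.2.1 then (q.2.1, o q.2.2.1, q.2.2.1, o q.1)
  else (q.2.2.1, q.2.2.2, q.1, q.2.1)

variable {o}

/-- The contracted edge, with halves `e₂` and `o e₁`, is not available to the second square. The
other new edge has the halves `e₁` and `o e₂`, and at most one of `f₁`, `f₂` lies on it. This leaves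
four cases in which three edges of the original graph take part, and one with four edges. -/
theorem gluable_cases (ho : ∀ h, o (o h) = h) {e₁ e₂ f₁ f₂ : H} (hq : Gluable o (e₁, e₂, f₁, f₂)) :
    (e₂ ≠ e₁ ∧ e₂ ≠ o e₁) ∧
    ((f₁ = e₁ ∧ (f₂ ≠ e₁ ∧ f₂ ≠ o e₁ ∧ f₂ ≠ e₂ ∧ f₂ ≠ o e₂) ∧
        exchange o (e₁, e₂, f₁, f₂) = (e₂, f₂, e₁, e₂)) ∨
      (f₂ = e₁ ∧ (f₁ ≠ e₁ ∧ f₁ ≠ o e₁ ∧ f₁ ≠ e₂ ∧ f₁ ≠ o e₂) ∧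
        exchange o (e₁, e₂, f₁, f₂) = (f₁, e₁, f₁, e₂)) ∨
      (f₁ = o e₂ ∧ (f₂ ≠ e₁ ∧ f₂ ≠ o e₁ ∧ f₂ ≠ e₂ ∧ f₂ ≠ o e₂) ∧
        exchange o (e₁, e₂, f₁, f₂) = (o f₂, e₁, o e₂, o e₁)) ∨
      (f₂ = o e₂ ∧ (f₁ ≠ e₁ ∧ f₁ ≠ o e₁ ∧ f₁ ≠ e₂ ∧ f₁ ≠ o e₂) ∧
        exchange o (e₁, e₂, f₁, f₂) = (e₂, o f₁, f₁, o e₁)) ∨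
      (((f₁ ≠ e₁ ∧ f₁ ≠ o e₁ ∧ f₁ ≠ e₂ ∧ f₁ ≠ o e₂) ∧
        (f₂ ≠ e₁ ∧ f₂ ≠ o e₁ ∧ f₂ ≠ e₂ ∧ f₂ ≠ o e₂)) ∧ (f₂ ≠ f₁ ∧ f₂ ≠ o f₁) ∧
        exchange o (e₁, e₂, f₁, f₂) = (f₁, f₂, e₁, e₂))) := by
  obtain ⟨h1, h2, h3, h4⟩ := hq
  dsimp only at h1 h2 h3 h4
  refine ⟨h1, ?_⟩
  unfold oppGlue at h4
  unfold exchange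
  dsimp only
  by_cases a1 : f₁ = e₁
  · left
    grind
  by_cases a2 : f₂ = e₁
  · right; left
    grind
  by_cases a3 : f₁ = o e₂
  · right; right; left
    grind
  by_cases a4 : f₂ = o e₂
  · right; right; right; left
    grind
  right; right; right; right
  grind

/-- In the notation of `gluable_cases`, the cases `f₁ = e₁` and `f₂ = e₁` are interchanged, as are
the cases `f₁ = o e₂` and `f₂ = o e₂`, while the case of four edges is mapped to itself. -/
theorem exchange_exchange (ho : ∀ h, o (o h) = h) (hn : ∀ h, o h ≠ h) {q : H × H × H × H}
    (hq : Gluable o q) : exchange o (exchange o q) = q := by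
  obtain ⟨e₁, e₂, f₁, f₂⟩ := q
  obtain ⟨h0, ⟨rfl, h, hx⟩ | ⟨rfl, h, hx⟩ | ⟨rfl, h, hx⟩ | ⟨rfl, h, hx⟩ | ⟨h, h', hx⟩⟩ :=
    gluable_cases ho hq <;> rw [hx] <;> unfold exchange <;> grind

theorem gluable_exchange (ho : ∀ h, o (o h) = h) (hn : ∀ h, o h ≠ h) {q : H × H × H × H}
    (hq : Gluable o q) : Gluable o (exchange o q) := by
  obtain ⟨e₁, e₂, f₁, f₂⟩ := q
  obtain ⟨h0, ⟨rfl, h, hx⟩ | ⟨rfl, h, hx⟩ | ⟨rfl, h, hx⟩ | ⟨rfl, h, hx⟩ | ⟨h, h', hx⟩⟩ :=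
    gluable_cases ho hq <;> rw [hx] <;> unfold Gluable oppGlue <;> dsimp only <;> grind

/-- The first entry of the quadruple changes in every case. -/
theorem exchange_ne (ho : ∀ h, o (o h) = h) {q : H × H × H × H}
    (hq : Gluable o q) : exchange o q ≠ q := by
  obtain ⟨e₁, e₂, f₁, f₂⟩ := q
  obtain ⟨h0, ⟨rfl, h, hx⟩ | ⟨rfl, h, hx⟩ | ⟨rfl, h, hx⟩ | ⟨rfl, h, hx⟩ | ⟨h, h', hx⟩⟩ :=
    gluable_cases ho hq <;> rw [hx] <;> grind

/-- Squares along four different edges commute. When three edges take part, two successive squares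
re-pair their six halves, and the same pairing results from another choice of two squares;
`exchange` passes from one choice to the other. -/
theorem oppGlueTwice_exchange (ho : ∀ h, o (o h) = h) (hn : ∀ h, o h ≠ h) {q : H × H × H × H}
    (hq : Gluable o q) (i : H) : oppGlueTwice o (exchange o q) i = oppGlueTwice o q i := by
  obtain ⟨e₁, e₂, f₁, f₂⟩ := q
  obtain ⟨h0, ⟨rfl, h, hx⟩ | ⟨rfl, h, hx⟩ | ⟨rfl, h, hx⟩ | ⟨rfl, h, hx⟩ | ⟨h, h', hx⟩⟩ :=
    gluable_cases ho hq <;> rw [hx] <;> unfold oppGlueTwice oppGlue <;> dsimp only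
  all_goals grind (splits := 25)

theorem oppGlue_of_ne {e₁ e₂ f : H} (h : f ≠ e₁ ∧ f ≠ o e₁ ∧ f ≠ e₂ ∧ f ≠ o e₂) :
    oppGlue o e₁ e₂ f = o f := by
  unfold oppGlue
  grind

theorem oppGlue_left (e₁ e₂ : H) : oppGlue o e₁ e₂ e₁ = o e₂ := if_pos rfl

theorem oppGlue_right {e₁ e₂ : H} (hn : ∀ h, o h ≠ h) (h : e₂ ≠ e₁) :
    oppGlue o e₁ e₂ e₂ = o e₁ := by
  have := hn e₂
  unfold oppGlue
  grind

theorem oppGlue_opp_right {e₁ e₂ : H} (ho : ∀ h, o (o h) = h) (h : e₂ ≠ o e₁) :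
    oppGlue o e₁ e₂ (o e₂) = e₁ := by
  have := ho e₂
  unfold oppGlue
  grind

theorem oppGlue_opp_left {e₁ e₂ : H} (ho : ∀ h, o (o h) = h) (hn : ∀ h, o h ≠ h)
    (h : e₂ ≠ e₁ ∧ e₂ ≠ o e₁) : oppGlue o e₁ e₂ (o e₁) = e₂ := by
  have := hn e₁
  have := ho e₁
  have := ho e₂
  unfold oppGlue
  grind

/-- In the case `f₁ = o e₂`, this shows that the exchanged quadruple contracts the same two edges as
the original one, but names them by their other halves `e₁` and `o e₁`. -/
theorem oppGlueTwice_opp (ho : ∀ h, o (o h) = h) (hn : ∀ h, o h ≠ h) {e₁ e₂ f : H}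
    (h0 : e₂ ≠ e₁ ∧ e₂ ≠ o e₁) (h : f ≠ e₁ ∧ f ≠ o e₁ ∧ f ≠ e₂ ∧ f ≠ o e₂) :
    oppGlueTwice o (o f, e₁, o e₂, o e₁) e₁ = f ∧
      oppGlueTwice o (o f, e₁, o e₂, o e₁) (o e₁) = e₂ := by
  have h1 : oppGlue o (o f) e₁ (o e₂) = e₂ := by
    rw [oppGlue_of_ne (by grind), ho]
  have h2 : oppGlue o (o f) e₁ (o e₁) = o f := oppGlue_opp_right ho (by grind)
  have h3 : oppGlue o (o f) e₁ e₁ = f := by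
    rw [oppGlue_right hn (by grind), ho]
  have a1 := hn e₁
  have b2 := ho e₂
  have b3 := ho f
  constructor
  · change oppGlue (oppGlue o (o f) e₁) (o e₂) (o e₁) e₁ = f
    rw [oppGlue_of_ne (by rw [h1, h2]; grind), h3]
  · change oppGlue (oppGlue o (o f) e₁) (o e₂) (o e₁) (o e₁) = e₂
    rw [oppGlue, h1, h2]
    grind

variable {t}

theorem outGlueTwice_first (hn : ∀ h, o h ≠ h) {e₁ e₂ f : H}
    (h0 : e₂ ≠ e₁ ∧ e₂ ≠ o e₁) (h : f ≠ e₁ ∧ f ≠ o e₁ ∧ f ≠ e₂ ∧ f ≠ o e₂) (ho : ∀ h, o (o h) = h)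
    (i : H) : outGlueTwice o t (e₁, e₂, e₁, f) i = outGlueTwice o t (e₂, f, e₁, e₂) i := by
  unfold outGlueTwice
  dsimp only
  have h1 : oppGlue o e₂ f e₁ = o e₁ := oppGlue_of_ne (by grind)
  unfold outGlue
  rw [oppGlue_left, oppGlue_left, oppGlue_of_ne h, h1]
  grind

theorem outGlueTwice_apart {e₁ e₂ f₁ f₂ : H}
    (h₁ : f₁ ≠ e₁ ∧ f₁ ≠ o e₁ ∧ f₁ ≠ e₂ ∧ f₁ ≠ o e₂)
    (h₂ : f₂ ≠ e₁ ∧ f₂ ≠ o e₁ ∧ f₂ ≠ e₂ ∧ f₂ ≠ o e₂) (ho : ∀ h, o (o h) = h)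
    (i : H) : outGlueTwice o t (e₁, e₂, f₁, f₂) i = outGlueTwice o t (f₁, f₂, e₁, e₂) i := by
  unfold outGlueTwice
  dsimp only
  have h1 : oppGlue o f₁ f₂ e₁ = o e₁ := oppGlue_of_ne (by grind)
  have h2 : oppGlue o f₁ f₂ e₂ = o e₂ := oppGlue_of_ne (by grind)
  unfold outGlue
  rw [oppGlue_of_ne h₁, oppGlue_of_ne h₂, h1, h2]
  grind

/-- Exactly the two edges to be contracted are directed oppositely by the two constructions. Their
number is even, so no sign results. -/
theorem outGlueTwice_opp (ho : ∀ h, o (o h) = h) (hn : ∀ h, o h ≠ h) {e₁ e₂ f : H}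
    (h0 : e₂ ≠ e₁ ∧ e₂ ≠ o e₁) (h : f ≠ e₁ ∧ f ≠ o e₁ ∧ f ≠ e₂ ∧ f ≠ o e₂) (i : H) :
    (outGlueTwice o t (e₁, e₂, o e₂, f) i = true ∧
      outGlueTwice o t (o f, e₁, o e₂, o e₁) i = false) ↔ i = e₂ ∨ i = f := by
  unfold outGlueTwice
  dsimp only
  have h1 : oppGlue o (o f) e₁ (o e₂) = e₂ := by
    rw [oppGlue_of_ne (by grind), ho]
  have h2 : oppGlue o (o f) e₁ (o e₁) = o f := oppGlue_opp_right ho (by grind)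
  have a1 := hn e₁
  have a2 := hn e₂
  have a3 := hn f
  have b1 := ho e₁
  have b2 := ho e₂
  have b3 := ho f
  have h3 : oppGlue o e₁ e₂ (o e₂) = e₁ := oppGlue_opp_right ho h0.2
  have h4 : oppGlue o e₁ e₂ f = o f := oppGlue_of_ne h
  clear ho hn
  simp only [outGlue, h1, h2, h3, h4]
  grind

variable (o) in
/-- The direction sign of a half-edge after gluing a square. -/
def signGlue (d : H → ℤ) (e₁ e₂ f : H) : ℤ :=
  if f = e₁ ∨ f = e₂ then 1 else if f = o e₁ ∨ f = o e₂ then -1 else d f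

theorem signGlue_left (d : H → ℤ) (e₁ e₂ : H) : signGlue o d e₁ e₂ e₁ = 1 := if_pos (Or.inl rfl)

theorem signGlue_of_ne (d : H → ℤ) {e₁ e₂ f : H} (h : f ≠ e₁ ∧ f ≠ o e₁ ∧ f ≠ e₂ ∧ f ≠ o e₂) :
    signGlue o d e₁ e₂ f = d f := by
  unfold signGlue
  grind

theorem signGlue_opp_right (ho : ∀ h, o (o h) = h) (hn : ∀ h, o h ≠ h) (d : H → ℤ) {e₁ e₂ : H}
    (h : e₂ ≠ o e₁) : signGlue o d e₁ e₂ (o e₂) = -1 := by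
  have := hn e₂
  have := ho e₂
  unfold signGlue
  grind

end

section

variable {H : Type} {o : H → H}

theorem ne_opp_of_ne (ho : ∀ h, o (o h) = h) {e₁ e₂ f : H}
    (h : f ≠ e₁ ∧ f ≠ o e₁ ∧ f ≠ e₂ ∧ f ≠ o e₂) :
    (e₁ ≠ f ∧ e₁ ≠ o f) ∧ (e₂ ≠ f ∧ e₂ ≠ o f) := by
  obtain ⟨h1, h2, h3, h4⟩ := h
  have a : e₁ ≠ o f := fun h => h2 (by rw [h, ho])
  have b : e₂ ≠ o f := fun h => h4 (by rw [h, ho])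
  exact ⟨⟨h1.symm, a⟩, h3.symm, b⟩

/-- Both sides are equal to -d(e₁) d(e₂) d(f). On each side one new edge is traversed backwards; on
the right there are in addition two reversed old edges. The exponent 2 is the number of edges found
in `outGlueTwice_opp`. -/
theorem signGlue_signs_opp (ho : ∀ h, o (o h) = h) (hn : ∀ h, o h ≠ h) (d : H → ℤ)
    (hd : ∀ h, d (o h) = -d h) {e₁ e₂ f : H} (h0 : e₂ ≠ e₁ ∧ e₂ ≠ o e₁)
    (h : f ≠ e₁ ∧ f ≠ o e₁ ∧ f ≠ e₂ ∧ f ≠ o e₂) :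
    d e₁ * d e₂ * (signGlue o d e₁ e₂ (o e₂) * signGlue o d e₁ e₂ f) * (-1) ^ 2 =
      d (o f) * d e₁ * (signGlue o d (o f) e₁ (o e₂) * signGlue o d (o f) e₁ (o e₁)) := by
  obtain ⟨⟨a1, a2⟩, a3, a4⟩ := ne_opp_of_ne ho h
  have b1 : o e₂ ≠ o f := fun h => a3 (by rw [← ho e₂, h, ho])
  have b2 : o e₂ ≠ e₁ := fun h => h0.2 (by rw [← h, ho])
  have b3 : o e₂ ≠ o e₁ := fun h => h0.1 (by rw [← ho e₂, h, ho])
  have b4 : o e₂ ≠ o (o f) := by rw [ho]; exact h.2.2.2.symm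
  have b5 : e₁ ≠ o (o f) := by rw [ho]; exact a1
  rw [signGlue_opp_right ho hn d h0.2, signGlue_of_ne d h, signGlue_of_ne d ⟨b1, b4, b2, b3⟩,
    signGlue_opp_right ho hn d b5, hd, hd]
  ring

end

/-! ### Antisymmetry under the exchange of two squares -/

section

open OGraph

variable {k : Type u} [Field k] {O : CyclicOperad.{u, w} k}

/-- The labelled graph obtained by gluing two squares. -/
abbrev LabelledGraph.glueTwice (X : LabelledGraph O) (q : X.graph.H × X.graph.H × X.graph.H × X.graph.H)
    (hq : Gluable X.graph.opp q) : LabelledGraph O :=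
  (X.glue q.1 q.2.1 hq.1).glue q.2.2.1 q.2.2.2 hq.2.2.2

/-- The direction sign of the edges along which two squares are glued. -/
def dirSignTwice (Γ : OGraph) (q : Γ.H × Γ.H × Γ.H × Γ.H) : ℤ :=
  Γ.dirSign q.1 * Γ.dirSign q.2.1 *
    (signGlue Γ.opp Γ.dirSign q.1 q.2.1 q.2.2.1 * signGlue Γ.opp Γ.dirSign q.1 q.2.1 q.2.2.2)

theorem dirSign_glue {Γ : OGraph} {e₁ e₂ : Γ.H} (h : Γ.Indep e₁ e₂) (f : Γ.H) :
    (Γ.glue e₁ e₂ h).dirSign f = signGlue Γ.opp Γ.dirSign e₁ e₂ f := by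
  change (if Γ.glueOut e₁ e₂ f = true then (1 : ℤ) else -1) = _
  unfold glueOut dirSign signGlue
  split_ifs <;> simp_all

/-- The result of gluing two squares, one after the other, and contracting an edge of each. -/
def fuseTwice (X : LabelledGraph O) (q : X.graph.H × X.graph.H × X.graph.H × X.graph.H) :
    GraphSpace O :=
  if hq : Gluable X.graph.opp q then
    dirSignTwice X.graph q • contractTwice (X.glueTwice q hq) q.2.1 q.2.2.2
  else 0

/-- Changing the directions of edges. -/
theorem contractTwice_glueTwice_congr (X : LabelledGraph O)
    {q q' : X.graph.H × X.graph.H × X.graph.H × X.graph.H} (hq : Gluable X.graph.opp q)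
    (hq' : Gluable X.graph.opp q')
    (hopp : ∀ i, oppGlueTwice X.graph.opp q' i = oppGlueTwice X.graph.opp q i) (a b : X.graph.H) :
    contractTwice (X.glueTwice q hq) a b =
      (-1 : ℤ) ^ (Finset.univ.filter fun i => outGlueTwice X.graph.opp X.graph.out q i = true ∧
        outGlueTwice X.graph.opp X.graph.out q' i = false).card •
        contractTwice (X.glueTwice q' hq') a b := by
  let φ : (X.glueTwice q hq).graph.Iso (X.glueTwice q' hq').graph :=
    { onV := Equiv.refl X.graph.V
      onH := Equiv.refl X.graph.H
      att_onH := fun _ => rfl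
      opp_onH := hopp }
  have hφ : φ.sign = (-1 : ℤ) ^ (Finset.univ.filter fun i =>
        outGlueTwice X.graph.opp X.graph.out q i = true ∧
        outGlueTwice X.graph.opp X.graph.out q' i = false).card := by
    have : inversions (X.glueTwice q hq).graph.lt (X.glueTwice q' hq').graph.lt φ.onV = ∅ :=
      Finset.filter_eq_empty_iff.2 fun p _ hp => X.graph.lt_asymm hp.1 hp.2
    unfold Iso.sign
    rw [this, Finset.card_empty, pow_zero, one_mul]
    rfl
  rw [← hφ]
  exact contractTwice_iso φ X.label X.label (fun v => (O.map_refl (X.label v)).symm) a b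

/-- By `hopp` the two glued graphs differ only in the directions of their edges. That difference is
accounted for by `hs`, so the minus sign is the one in `hc`, due to the order of the contractions.
-/
theorem fuseTwice_add_eq_zero (X : LabelledGraph O)
    {q q' : X.graph.H × X.graph.H × X.graph.H × X.graph.H} (hq : Gluable X.graph.opp q)
    (hq' : Gluable X.graph.opp q')
    (hopp : ∀ i, oppGlueTwice X.graph.opp q' i = oppGlueTwice X.graph.opp q i)
    (hs : dirSignTwice X.graph q *
      (-1 : ℤ) ^ (Finset.univ.filter fun i => outGlueTwice X.graph.opp X.graph.out q i = true ∧
        outGlueTwice X.graph.opp X.graph.out q' i = false).card = dirSignTwice X.graph q')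
    (hc : contractTwice (X.glueTwice q' hq') q.2.1 q.2.2.2 =
      -contractTwice (X.glueTwice q' hq') q'.2.1 q'.2.2.2) :
    fuseTwice X q + fuseTwice X q' = 0 := by
  unfold fuseTwice
  rw [dif_pos hq, dif_pos hq', contractTwice_glueTwice_congr X hq hq' hopp, smul_smul, hs, hc,
    smul_neg, neg_add_cancel]

/-- Exchanging two squares changes the sign. -/
theorem fuseTwice_add_fuseTwice_exchange (X : LabelledGraph O)
    {q : X.graph.H × X.graph.H × X.graph.H × X.graph.H} (hq : Gluable X.graph.opp q) :
    fuseTwice X q + fuseTwice X (exchange X.graph.opp q) = 0 := by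
  have ho := X.graph.opp_opp
  have hn := X.graph.opp_ne
  -- As `exchange` is an involution, the claim may be proved for the partner of `q`. This halves the
  -- number of cases with three edges.
  have reduce : ∀ q, Gluable X.graph.opp q → (∀ q', q' = exchange X.graph.opp q →
      fuseTwice X q' + fuseTwice X (exchange X.graph.opp q') = 0) →
      fuseTwice X q + fuseTwice X (exchange X.graph.opp q) = 0 := by
    intro q hq h
    have := h _ rfl
    rwa [exchange_exchange ho hn hq, add_comm] at this
  -- The edges of `e₂` and `f` are contracted in one order or the other, and all directions agree.
  have key1 : ∀ e₁ e₂ f : X.graph.H, (hq : Gluable X.graph.opp (e₁, e₂, e₁, f)) →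
      fuseTwice X (e₁, e₂, e₁, f) + fuseTwice X (exchange X.graph.opp (e₁, e₂, e₁, f)) = 0 := by
    intro e₁ e₂ f hq
    have hq' := gluable_exchange ho hn hq
    have hopp := oppGlueTwice_exchange ho hn hq
    have hx : exchange X.graph.opp (e₁, e₂, e₁, f) = (e₂, f, e₁, e₂) := if_pos rfl
    rw [hx] at hq' hopp ⊢
    have h : (e₂ ≠ e₁ ∧ e₂ ≠ X.graph.opp e₁) ∧
        (f ≠ e₁ ∧ f ≠ X.graph.opp e₁ ∧ f ≠ e₂ ∧ f ≠ X.graph.opp e₂) := by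
      have := gluable_cases ho hq
      grind
    refine fuseTwice_add_eq_zero X hq hq' hopp ?_ (contractTwice_anticomm _ _ _)
    rw [Finset.filter_eq_empty_iff.2 fun i _ hi => by
      rw [outGlueTwice_first hn h.1 h.2 ho] at hi
      exact absurd (hi.1.symm.trans hi.2) (by simp)]
    unfold dirSignTwice
    dsimp only
    obtain ⟨⟨a1, a2⟩, -⟩ := ne_opp_of_ne ho h.2
    have a3 : e₁ ≠ X.graph.opp e₂ := fun h' => h.1.2 (by rw [h', ho])
    rw [signGlue_left, signGlue_of_ne _ h.2, signGlue_left,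
      signGlue_of_ne _ ⟨h.1.1.symm, a3, a1, a2⟩, Finset.card_empty]
    ring
  -- Here the second square traverses the new edge backwards, so the directions and the names of the
  -- contracted edges have to be tracked.
  have key3 : ∀ e₁ e₂ f : X.graph.H, (hq : Gluable X.graph.opp (e₁, e₂, X.graph.opp e₂, f)) →
      fuseTwice X (e₁, e₂, X.graph.opp e₂, f) +
        fuseTwice X (exchange X.graph.opp (e₁, e₂, X.graph.opp e₂, f)) = 0 := by
    intro e₁ e₂ f hq
    have hq' := gluable_exchange ho hn hq
    have hopp := oppGlueTwice_exchange ho hn hq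
    have h : (e₂ ≠ e₁ ∧ e₂ ≠ X.graph.opp e₁) ∧
        (f ≠ e₁ ∧ f ≠ X.graph.opp e₁ ∧ f ≠ e₂ ∧ f ≠ X.graph.opp e₂) := by
      have := gluable_cases ho hq
      grind
    have hx : exchange X.graph.opp (e₁, e₂, X.graph.opp e₂, f) =
        (X.graph.opp f, e₁, X.graph.opp e₂, X.graph.opp e₁) := by
      unfold exchange
      grind
    rw [hx] at hq' hopp ⊢
    obtain ⟨g1', g2'⟩ := oppGlueTwice_opp ho hn h.1 h.2
    have g1 : (X.glueTwice _ hq').graph.opp e₁ = f := by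
      change oppGlueTwice X.graph.opp _ e₁ = f
      exact g1'
    have g2 : (X.glueTwice _ hq').graph.opp (X.graph.opp e₁) = e₂ := by
      change oppGlueTwice X.graph.opp _ (X.graph.opp e₁) = e₂
      exact g2'
    refine fuseTwice_add_eq_zero X hq hq' hopp ?_ ?_
    · have hflip : (Finset.univ.filter fun i => outGlueTwice X.graph.opp X.graph.out
          (e₁, e₂, X.graph.opp e₂, f) i = true ∧ outGlueTwice X.graph.opp X.graph.out
          (X.graph.opp f, e₁, X.graph.opp e₂, X.graph.opp e₁) i = false) = {e₂, f} := by
        ext i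
        rw [Finset.mem_filter, Finset.mem_insert, Finset.mem_singleton,
          outGlueTwice_opp ho hn h.1 h.2]
        simp
      rw [hflip, Finset.card_pair h.2.2.2.1.symm]
      exact signGlue_signs_opp ho hn X.graph.dirSign X.graph.dirSign_opp h.1 h.2
    -- By `g1` and `g2` the halves `f` and `e₂` lie on the same edges as `e₁` and `opp e₁`, and
    -- contraction does not depend on the half chosen.
    · have := contractTwice_anticomm (X.glueTwice _ hq') e₂ f
      have l := contractTwice_opp_left (X.glueTwice _ hq') e₁ e₂
      have r := contractTwice_opp_right (X.glueTwice _ hq') e₁ (X.graph.opp e₁)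
      rw [g1] at l
      rw [g2] at r
      exact this.trans (congrArg Neg.neg (l.trans r))
  obtain ⟨e₁, e₂, f₁, f₂⟩ := q
  obtain ⟨h0, ⟨rfl, h, hx⟩ | ⟨rfl, h, hx⟩ | ⟨rfl, h, hx⟩ | ⟨rfl, h, hx⟩ | ⟨h, h', hx⟩⟩ :=
    gluable_cases ho hq
  · exact key1 _ _ _ hq
  · refine reduce _ hq fun q' hq' => ?_
    rw [hx] at hq'
    subst hq'
    refine key1 _ _ _ ?_
    rw [← hx]
    exact gluable_exchange ho hn hq
  · exact key3 _ _ _ hq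
  · refine reduce _ hq fun q' hq' => ?_
    rw [hx] at hq'
    subst hq'
    have := gluable_exchange ho hn hq
    rw [hx] at this
    -- The exchanged quadruple has the shape required by `key3` once its third entry `f₁` is written
    -- as `opp (opp f₁)`.
    have h1 := key3 e₂ (X.graph.opp f₁) (X.graph.opp e₁)
    rw [ho] at h1
    exact h1 this
  -- Four different edges: the squares do not interact, and neither signs nor directions change.
  · have hq' := gluable_exchange ho hn hq
    have hopp := oppGlueTwice_exchange ho hn hq
    rw [hx] at hq' hopp ⊢
    refine fuseTwice_add_eq_zero X hq hq' hopp ?_ (contractTwice_anticomm _ _ _)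
    rw [Finset.filter_eq_empty_iff.2 fun i _ hi => by
      rw [outGlueTwice_apart h.1 h.2 ho] at hi
      exact absurd (hi.1.symm.trans hi.2) (by simp)]
    unfold dirSignTwice
    dsimp only
    obtain ⟨⟨a1, a2⟩, a3, a4⟩ := ne_opp_of_ne ho h.1
    obtain ⟨⟨b1, b2⟩, b3, b4⟩ := ne_opp_of_ne ho h.2
    rw [signGlue_of_ne _ h.1, signGlue_of_ne _ h.2, signGlue_of_ne _ ⟨a1, a2, b1, b2⟩,
      signGlue_of_ne _ ⟨a3, a4, b3, b4⟩, Finset.card_empty]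
    ring

end

/-! ### Connected components -/

/-- The number of connected components of a graph given by its incidence map and the pairing of
its half-edges. -/
def componentCount {V H : Type} (att : H → V) (o : H → H) : ℕ :=
  Nat.card (Quot fun v w => ∃ h, att h = v ∧ att (o h) = w)

namespace OGraph

/-- Contracting an edge that is not a loop does not change the connected components. -/
def contractComponents (Γ : OGraph) (e : Γ.H) (he : Γ.att e ≠ Γ.att (Γ.opp e)) :
    (Γ.contract e he).Components ≃ Γ.Components where
  toFun := Quot.lift
    (fun v => Quot.mk _ (Function.surjInv (Γ.quotVertex_surjective e he) v)) <| by
      -- The chosen preimage of the merged vertex may be the other end of `e`, but that lies in the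
      -- same component.
      have key : ∀ v : Γ.V, (Quot.mk _ (Function.surjInv (Γ.quotVertex_surjective e he)
          (Γ.quotVertex e he v)) : Γ.Components) = Quot.mk _ v := by
        intro v
        have hend : (Quot.mk _ (Γ.att e) : Γ.Components) = Quot.mk _ (Γ.att (Γ.opp e)) :=
          Quot.sound ⟨e, rfl, rfl⟩
        rcases quotVertex_eq_iff.1 (Function.surjInv_eq (Γ.quotVertex_surjective e he)
          (Γ.quotVertex e he v)) with h | ⟨h | h, h' | h'⟩ <;> rw [h]
        · rw [h']
        · rw [h', hend]
        · rw [h', hend]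
        · rw [h']
      rintro v w ⟨h, rfl, rfl⟩
      refine (key (Γ.att h.1)).trans (Eq.trans ?_ (key (Γ.att (Γ.opp h.1))).symm)
      exact Quot.sound ⟨h.1, rfl, rfl⟩
  invFun := Quot.lift (fun v => Quot.mk _ (Γ.quotVertex e he v)) <| by
    rintro v w ⟨h, rfl, rfl⟩
    by_cases h1 : h ≠ e ∧ h ≠ Γ.opp e
    · exact Quot.sound ⟨(⟨h, h1⟩ : Γ.HalfRest e), rfl, rfl⟩
    · refine congrArg (Quot.mk _) (quotVertex_eq_iff.2 (Or.inr ?_))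
      have : h = e ∨ h = Γ.opp e := by tauto
      rcases this with rfl | rfl
      · exact ⟨Or.inl rfl, Or.inr rfl⟩
      · exact ⟨Or.inr rfl, Or.inl (by rw [Γ.opp_opp])⟩
  left_inv := by
    rintro ⟨v⟩
    exact congrArg (Quot.mk _) (Function.surjInv_eq (Γ.quotVertex_surjective e he) v)
  right_inv := by
    rintro ⟨v⟩
    have hend : (Quot.mk _ (Γ.att e) : Γ.Components) = Quot.mk _ (Γ.att (Γ.opp e)) :=
      Quot.sound ⟨e, rfl, rfl⟩
    change (Quot.mk _ (Function.surjInv (Γ.quotVertex_surjective e he)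
      (Γ.quotVertex e he v)) : Γ.Components) = Quot.mk _ v
    rcases quotVertex_eq_iff.1 (Function.surjInv_eq (Γ.quotVertex_surjective e he)
      (Γ.quotVertex e he v)) with h | ⟨h | h, h' | h'⟩ <;> rw [h]
    · rw [h']
    · rw [h', hend]
    · rw [h', hend]
    · rw [h']

/-- In either order the start of each edge is joined to the end of the other. -/
theorem oppGlue_comm {H : Type} {o : H → H} (ho : ∀ h, o (o h) = h)
    (hn : ∀ h, o h ≠ h) {e₁ e₂ : H} (h : e₂ ≠ e₁ ∧ e₂ ≠ o e₁) :
    oppGlue o e₁ e₂ = oppGlue o e₂ e₁ := by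
  funext i
  have h1 := hn e₁
  have h2 := hn e₂
  have h3 := ho e₁
  have h4 := ho e₂
  unfold oppGlue
  grind

/-- Without the edge of `b`, the graph `B` is still connected, so all of it lies in one component of
the glued graph. The two new edges attach it to both ends of `a`, and it takes over the role of the
removed edge of `A`. -/
theorem componentCount_disjUnion_aux (A B : OGraph) (a : A.H) (b : B.H)
    (hB : Subsingleton (B.ComponentsWithout b)) :
    componentCount (A.disjUnion B).att
      (oppGlue (A.disjUnion B).opp (Sum.inl a : A.H ⊕ B.H) (Sum.inr b : A.H ⊕ B.H)) =
      componentCount A.att A.opp := by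
  have g1 : oppGlue (A.disjUnion B).opp (Sum.inl a : A.H ⊕ B.H) (Sum.inr b : A.H ⊕ B.H)
    (Sum.inl a) = Sum.inr (B.opp b) := if_pos rfl
  have g2 : oppGlue (A.disjUnion B).opp (Sum.inl a : A.H ⊕ B.H) (Sum.inr b : A.H ⊕ B.H)
    (Sum.inr (B.opp b)) = Sum.inl a := oppGlue_opp_right (A.disjUnion B).opp_opp (by rintro ⟨⟩)
  have g3 : oppGlue (A.disjUnion B).opp (Sum.inl a : A.H ⊕ B.H) (Sum.inr b : A.H ⊕ B.H)
    (Sum.inr b) = Sum.inl (A.opp a) := oppGlue_right (A.disjUnion B).opp_ne (by rintro ⟨⟩)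
  have g4 : oppGlue (A.disjUnion B).opp (Sum.inl a : A.H ⊕ B.H) (Sum.inr b : A.H ⊕ B.H)
    (Sum.inl (A.opp a)) = Sum.inr b :=
      oppGlue_opp_left (A.disjUnion B).opp_opp (A.disjUnion B).opp_ne ⟨by rintro ⟨⟩, by rintro ⟨⟩⟩
  have g5 : ∀ h, h ≠ a → h ≠ A.opp a → oppGlue (A.disjUnion B).opp (Sum.inl a : A.H ⊕ B.H)
      (Sum.inr b : A.H ⊕ B.H) (Sum.inl h) = Sum.inl (A.opp h) := fun h h1 h2 =>
    oppGlue_of_ne (o := (A.disjUnion B).opp) ⟨fun e => h1 (Sum.inl.inj e),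
      fun e => h2 (Sum.inl.inj e), by rintro ⟨⟩, by rintro ⟨⟩⟩
  have g6 : ∀ h, h ≠ b → h ≠ B.opp b → oppGlue (A.disjUnion B).opp (Sum.inl a : A.H ⊕ B.H)
      (Sum.inr b : A.H ⊕ B.H) (Sum.inr h) = Sum.inr (B.opp h) := fun h h1 h2 =>
    oppGlue_of_ne (o := (A.disjUnion B).opp) ⟨by rintro ⟨⟩, by rintro ⟨⟩,
      fun e => h1 (Sum.inr.inj e), fun e => h2 (Sum.inr.inj e)⟩
  generalize oppGlue (A.disjUnion B).opp (Sum.inl a : A.H ⊕ B.H) (Sum.inr b : A.H ⊕ B.H) = g at *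
  let r : A.V ⊕ B.V → A.V ⊕ B.V → Prop := fun v w => ∃ h : A.H ⊕ B.H,
    Sum.map A.att B.att h = v ∧ Sum.map A.att B.att (g h) = w
  let s : A.V → A.V → Prop := fun v w => ∃ h : A.H, A.att h = v ∧ A.att (A.opp h) = w
  have hr : ∀ w w' : B.V, Quot.mk r (Sum.inr w) = Quot.mk r (Sum.inr w') := by
    intro w w'
    -- All edges of `B` other than that of `b` survive the gluing.
    let F : B.ComponentsWithout b → Quot r := Quot.lift (fun w => Quot.mk r (Sum.inr w)) <| by
      rintro v w ⟨h, h1, h2, rfl, rfl⟩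
      exact Quot.sound ⟨Sum.inr h, rfl, by rw [g6 h h1 h2]; rfl⟩
    exact congrArg F (hB.elim (Quot.mk _ w) (Quot.mk _ w'))
  have ha : ∀ w, Quot.mk r (Sum.inl (A.att a)) = Quot.mk r (Sum.inr w) := fun w =>
    (Quot.sound ⟨Sum.inl a, rfl, by rw [g1]; rfl⟩).trans (hr (B.att (B.opp b)) w)
  have ha' : ∀ w, Quot.mk r (Sum.inl (A.att (A.opp a))) = Quot.mk r (Sum.inr w) := fun w =>
    (Quot.sound ⟨Sum.inl (A.opp a), rfl, by rw [g4]; rfl⟩).trans (hr (B.att b) w)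
  have hs : Quot.mk s (A.att (A.opp a)) = Quot.mk s (A.att a) :=
    (Quot.sound ⟨a, rfl, rfl⟩).symm
  refine Nat.card_congr (α := Quot r) (β := Quot s)
    -- The whole of `B` is sent to the component of `A` that contains the edge of `a`.
    { toFun := Quot.lift (Sum.elim (fun v => Quot.mk s v) fun _ => Quot.mk s (A.att a)) ?_
      invFun := Quot.lift (fun v => Quot.mk r (Sum.inl v)) ?_
      left_inv := ?_
      right_inv := ?_ }
  · rintro v w ⟨h | h, rfl, rfl⟩
    · by_cases h1 : h = a
      · subst h1
        rw [g1]
        rfl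
      by_cases h2 : h = A.opp a
      · subst h2
        rw [g4]
        exact hs
      rw [g5 h h1 h2]
      exact Quot.sound ⟨h, rfl, rfl⟩
    · by_cases h1 : h = b
      · subst h1
        rw [g3]
        exact hs.symm
      by_cases h2 : h = B.opp b
      · subst h2
        rw [g2]
        rfl
      rw [g6 h h1 h2]
      rfl
  · rintro v w ⟨h, rfl, rfl⟩
    by_cases h1 : h = a
    · subst h1
      exact (ha (B.att b)).trans (ha' _).symm
    by_cases h2 : h = A.opp a
    · subst h2
      rw [A.opp_opp]
      exact (ha' (B.att b)).trans (ha _).symm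
    exact Quot.sound ⟨Sum.inl h, rfl, by rw [g5 h h1 h2]; rfl⟩
  · rintro ⟨v | w⟩
    · rfl
    · exact ha w
  · rintro ⟨v⟩
    rfl

/-- Gluing a square along an edge of `A` and an edge of a connected graph without separating edges
does not change the number of components of `A`. -/
theorem componentCount_disjUnion (A B : OGraph)
    (hB : ∀ b, Subsingleton (B.ComponentsWithout b)) {f₁ f₂ : A.H ⊕ B.H}
    (h : f₁.isLeft ≠ f₂.isLeft) :
    componentCount (A.disjUnion B).att (oppGlue (A.disjUnion B).opp f₁ f₂) =
      componentCount A.att A.opp := by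
  rcases f₁ with a | b <;> rcases f₂ with a' | b'
  · exact (h rfl).elim
  · exact componentCount_disjUnion_aux A B a b' (hB b')
  · have : oppGlue (A.disjUnion B).opp (Sum.inr b : A.H ⊕ B.H) (Sum.inl a') =
        oppGlue (A.disjUnion B).opp (Sum.inl a' : A.H ⊕ B.H) (Sum.inr b) :=
      oppGlue_comm (A.disjUnion B).opp_opp (A.disjUnion B).opp_ne
        ⟨by rintro ⟨⟩, by rintro ⟨⟩⟩
    rw [this]
    exact componentCount_disjUnion_aux A B a' b (hB b)
  · exact (h rfl).elim

theorem subsingleton_componentsWithout {Γ : OGraph} (h : Γ.IsConnected)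
    (h' : ∀ e, ¬ Γ.IsSeparating e) (e : Γ.H) : Subsingleton (Γ.ComponentsWithout e) := by
  have h1 : Nat.card (Γ.ComponentsWithout e) = 1 := (not_not.1 (h' e)).trans h
  exact (Nat.card_eq_one_iff_unique.1 h1).1

/-- The exchange of the two parts of a disjoint union. -/
def Iso.swap (Γ Γ' : OGraph) : (Γ.disjUnion Γ').Iso (Γ'.disjUnion Γ) where
  onV := Equiv.sumComm Γ.V Γ'.V
  onH := Equiv.sumComm Γ.H Γ'.H
  att_onH := by rintro (h | h) <;> rfl
  opp_onH := by rintro (h | h) <;> rfl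

/-- The inverted pairs are those consisting of a vertex of `Γ` and a vertex of `Γ'`, and no
direction changes. -/
theorem Iso.sign_swap (Γ Γ' : OGraph) :
    (Iso.swap Γ Γ').sign = (-1) ^ (Nat.card Γ.V * Nat.card Γ'.V) := by
  have h1 : (Iso.swap Γ Γ').flips = ∅ := by
    refine Finset.filter_eq_empty_iff.2 fun h _ hh => ?_
    rcases h with h | h
    · exact absurd (hh.1.symm.trans hh.2) (by simp)
    · exact absurd (hh.1.symm.trans hh.2) (by simp)
  have h2 : (inversions (Γ.disjUnion Γ').lt (Γ'.disjUnion Γ).lt (Iso.swap Γ Γ').onV).card =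
      Fintype.card (Γ.V × Γ'.V) := by
    rw [← Finset.card_univ]
    symm
    refine Finset.card_bij (fun p _ => ((Sum.inl p.1 : Γ.V ⊕ Γ'.V), (Sum.inr p.2 : Γ.V ⊕ Γ'.V)))
      ?_ ?_ ?_
    · rintro ⟨v, w⟩ -
      exact Finset.mem_filter.2 ⟨Finset.mem_univ _, Sum.Lex.sep _ _, Sum.Lex.sep _ _⟩
    · rintro ⟨v, w⟩ - ⟨v', w'⟩ - h
      have h1 := Sum.inl.inj (congrArg Prod.fst h)
      have h2 := Sum.inr.inj (congrArg Prod.snd h)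
      exact Prod.ext h1 h2
    · rintro ⟨v | v, w | w⟩ h
      · have h := (Finset.mem_filter.1 h).2
        exact (Γ.lt_asymm (Sum.lex_inl_inl.1 h.1) (Sum.lex_inr_inr.1 h.2)).elim
      · exact ⟨(v, w), Finset.mem_univ _, rfl⟩
      · have h := (Finset.mem_filter.1 h).2
        exact (Sum.lex_inr_inl h.1).elim
      · have h := (Finset.mem_filter.1 h).2
        exact (Γ'.lt_asymm (Sum.lex_inr_inr.1 h.1) (Sum.lex_inl_inl.1 h.2)).elim
  unfold Iso.sign
  rw [h1, h2, Fintype.card_prod, Nat.card_eq_fintype_card, Nat.card_eq_fintype_card]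
  simp

end OGraph

/-! ### Expanding the operators as sums over pairs of squares -/

section

open OGraph

variable {k : Type u} [Field k] {O : CyclicOperad.{u, w} k}

/-- The comparisons of component counts need edges along which squares can be glued. It suffices to
compare where the summand is nonzero, and there this is automatic. -/
theorem ite_zero_congr {M : Type*} [Zero M] {p q : Prop} {hp : Decidable p} {hq : Decidable q}
    {a : M} (h : a ≠ 0 → (p ↔ q)) : @ite M p hp a 0 = @ite M q hq a 0 := by
  by_cases ha : a = 0
  · rw [ha, ite_self, ite_self]
  · exact if_congr (h ha) rfl rfl

/-- The antisymmetry under the exchange of the two squares makes sums over pairs of squares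
vanish. -/
theorem sum_fuseTwice_eq_zero (Z : LabelledGraph O)
    (P : Z.graph.H × Z.graph.H × Z.graph.H × Z.graph.H → Prop)
    (hP : ∀ q, Gluable Z.graph.opp q → P q → P (exchange Z.graph.opp q)) :
    ∑ q, (if P q then fuseTwice Z q else 0) = 0 := by
  have ho := Z.graph.opp_opp
  have hn := Z.graph.opp_ne
  have h1 : ∑ q, (if P q then fuseTwice Z q else 0) =
      ∑ q ∈ Finset.univ.filter fun q => Gluable Z.graph.opp q ∧ P q, fuseTwice Z q := by
    rw [Finset.sum_filter]
    refine Finset.sum_congr rfl fun q _ => ?_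
    by_cases hq : Gluable Z.graph.opp q
    · simp [hq]
    · have : fuseTwice Z q = 0 := dif_neg hq
      simp [this]
  rw [h1]
  refine Finset.sum_involution (fun q _ => exchange Z.graph.opp q) ?_ ?_ ?_ ?_
  · intro q hq
    exact fuseTwice_add_fuseTwice_exchange Z (Finset.mem_filter.1 hq).2.1
  · intro q hq _
    exact exchange_ne ho (Finset.mem_filter.1 hq).2.1
  · intro q hq
    have h := (Finset.mem_filter.1 hq).2
    exact Finset.mem_filter.2 ⟨Finset.mem_univ _, gluable_exchange ho hn h.1, hP q h.1 h.2⟩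
  · intro q hq
    exact exchange_exchange ho hn (Finset.mem_filter.1 hq).2.1

/-- Isomorphisms act on pairs of squares. -/
theorem fuseTwice_iso {Γ Γ' : OGraph} (φ : Γ.Iso Γ') (x : ∀ v, O.obj (Γ.Star v))
    (y : ∀ v, O.obj (Γ'.Star v)) (h : ∀ v, y (φ.onV v) = O.map (φ.star v) (x v))
    (e₁ e₂ f₁ f₂ : Γ.H) :
    fuseTwice ⟨Γ, x⟩ (e₁, e₂, f₁, f₂) =
      φ.sign • fuseTwice ⟨Γ', y⟩ (φ.onH e₁, φ.onH e₂, φ.onH f₁, φ.onH f₂) := by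
  have hg : ∀ i, oppGlue Γ'.opp (φ.onH e₁) (φ.onH e₂) (φ.onH i) =
      φ.onH (oppGlue Γ.opp e₁ e₂ i) :=
    fun i => glueOpp_of_injective φ.onH.injective φ.opp_onH e₁ e₂ i
  have hG : Gluable Γ'.opp (φ.onH e₁, φ.onH e₂, φ.onH f₁, φ.onH f₂) ↔
      Gluable Γ.opp (e₁, e₂, f₁, f₂) := by
    unfold Gluable
    dsimp only
    simp only [hg, φ.opp_onH, φ.onH.injective.ne_iff]
  unfold fuseTwice
  by_cases hq : Gluable Γ.opp (e₁, e₂, f₁, f₂)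
  · have hq' := hG.2 hq
    rw [dif_pos hq, dif_pos hq']
    have s1 := φ.sign_glue e₁ e₂ hq.1
    have s2 := (φ.glue e₁ e₂ hq.1).sign_glue f₁ f₂ hq.2.2.2
    have key := contractTwice_iso ((φ.glue e₁ e₂ hq.1).glue f₁ f₂ hq.2.2.2) x y h e₂ f₂
    refine (congrArg (fun z => dirSignTwice Γ (e₁, e₂, f₁, f₂) • z) key).trans ?_
    rw [smul_smul, smul_smul]
    refine congrArg₂ (fun (c : ℤ) z => c • z) ?_ rfl
    have s5 := dirSign_glue hq.1 f₁
    have s6 := dirSign_glue hq.1 f₂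
    have s3 := dirSign_glue (Γ := Γ') (φ.indep.2 hq.1) (φ.onH f₁)
    have s4 := dirSign_glue (Γ := Γ') (φ.indep.2 hq.1) (φ.onH f₂)
    unfold dirSignTwice
    dsimp only
    have s2' : signGlue Γ.opp Γ.dirSign e₁ e₂ f₁ * signGlue Γ.opp Γ.dirSign e₁ e₂ f₂ *
        ((φ.glue e₁ e₂ hq.1).glue f₁ f₂ hq.2.2.2).sign = (φ.glue e₁ e₂ hq.1).sign *
        (signGlue Γ'.opp Γ'.dirSign (φ.onH e₁) (φ.onH e₂) (φ.onH f₁) *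
          signGlue Γ'.opp Γ'.dirSign (φ.onH e₁) (φ.onH e₂) (φ.onH f₂)) := by
      rw [← s3, ← s4, ← s5, ← s6]
      exact s2
    rw [mul_assoc, s2', ← mul_assoc, s1]
    ring
  · rw [dif_neg hq, dif_neg fun hq' => hq (hG.1 hq'), smul_zero]

/-- A sum over the half-edges that are not contracted. -/
theorem smul_sum_fuseClass_contract (Z : LabelledGraph O) {e₁ e₂ : Z.graph.H}
    (h : Z.graph.Indep e₁ e₂)
    (he : (Z.glue e₁ e₂ h).graph.att e₂ ≠
      (Z.glue e₁ e₂ h).graph.att ((Z.glue e₁ e₂ h).graph.opp e₂))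
    (P : Z.graph.H → Z.graph.H → Prop)
    [∀ a b, Decidable (P a b)] :
    (Z.graph.dirSign e₁ * Z.graph.dirSign e₂) • (Z.glue e₁ e₂ h).graph.contractSign e₂ •
      (∑ p : (Z.glue e₁ e₂ h).graph.HalfRest e₂ × (Z.glue e₁ e₂ h).graph.HalfRest e₂,
        if P p.1.1 p.2.1 then fuseClass ((Z.glue e₁ e₂ h).contract e₂ he) p.1 p.2 else 0) =
      ∑ f : Z.graph.H × Z.graph.H, if P f.1 f.2 then fuseTwice Z (e₁, e₂, f.1, f.2) else 0 := by
  have hopp : (Z.glue e₁ e₂ h).graph.opp e₂ = Z.graph.opp e₁ :=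
    oppGlue_right (o := Z.graph.opp) Z.graph.opp_ne h.1
  rw [Finset.smul_sum, Finset.smul_sum]
  -- The right-hand side also runs over half-edges of the contracted edge, but such quadruples are
  -- not gluable and contribute zero.
  refine Finset.sum_of_injOn (fun p => (p.1.1, p.2.1)) ?_ (fun _ _ => Finset.mem_univ _) ?_ ?_
  · rintro ⟨⟨a, ha⟩, b, hb⟩ - ⟨⟨a', ha'⟩, b', hb'⟩ - heq
    cases heq
    rfl
  · rintro ⟨f₁, f₂⟩ - hf
    dsimp only
    split_ifs
    · refine dif_neg fun hq => hf ?_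
      have h1 : f₁ ≠ e₂ ∧ f₁ ≠ (Z.glue e₁ e₂ h).graph.opp e₂ := by
        rw [hopp]
        exact hq.2.1
      have h2 : f₂ ≠ e₂ ∧ f₂ ≠ (Z.glue e₁ e₂ h).graph.opp e₂ := by
        rw [hopp]
        exact hq.2.2.1
      exact ⟨(⟨f₁, h1⟩, ⟨f₂, h2⟩), Finset.mem_coe.2 (Finset.mem_univ _), rfl⟩
    · rfl
  · rintro ⟨⟨f₁, h1⟩, f₂, h2⟩ -
    dsimp only
    split_ifs
    · by_cases hf : (Z.glue e₁ e₂ h).graph.Indep f₁ f₂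
      · have hq : Gluable Z.graph.opp (e₁, e₂, f₁, f₂) :=
          ⟨h, by rw [hopp] at h1; exact h1, by rw [hopp] at h2; exact h2, hf⟩
        have d1 := dirSign_glue h f₁
        have d2 := dirSign_glue h f₂
        rw [smul_fuseClass_contract (Z.glue e₁ e₂ h) he h1 h2 hf, smul_smul]
        have hT : fuseTwice Z (e₁, e₂, f₁, f₂) = dirSignTwice Z.graph (e₁, e₂, f₁, f₂) •
            contractTwice (Z.glueTwice (e₁, e₂, f₁, f₂) hq) e₂ f₂ := dif_pos hq
        rw [hT]
        refine congrArg₂ (fun (c : ℤ) z => c • z) ?_ rfl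
        unfold dirSignTwice
        dsimp only
        rw [← d1, ← d2]
      · have hq : ¬ Gluable Z.graph.opp (e₁, e₂, f₁, f₂) := fun hq => hf hq.2.2.2
        have h0 : fuseClass ((Z.glue e₁ e₂ h).contract e₂ he)
            (⟨f₁, h1⟩ : (Z.glue e₁ e₂ h).graph.HalfRest e₂)
            (⟨f₂, h2⟩ : (Z.glue e₁ e₂ h).graph.HalfRest e₂) = 0 :=
          dif_neg fun h' => hf ((indep_contract he h1 h2).1 h')
        unfold fuseTwice
        rw [dif_neg hq, h0, smul_zero, smul_zero]
    · rw [smul_zero, smul_zero]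

/-- The second square avoids both halves of this loop, so it is still a loop when it is to be
contracted. -/
theorem fuseTwice_of_loop (Z : LabelledGraph O) {e₁ e₂ : Z.graph.H} (h : Z.graph.Indep e₁ e₂)
    (he : (Z.glue e₁ e₂ h).graph.att e₂ =
      (Z.glue e₁ e₂ h).graph.att ((Z.glue e₁ e₂ h).graph.opp e₂)) (f₁ f₂ : Z.graph.H) :
    fuseTwice Z (e₁, e₂, f₁, f₂) = 0 := by
  unfold fuseTwice
  split_ifs with hq
  · have hopp : (Z.glue e₁ e₂ h).graph.opp e₂ = Z.graph.opp e₁ :=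
      oppGlue_right (o := Z.graph.opp) Z.graph.opp_ne h.1
    have h1 : f₁ ≠ e₂ ∧ f₁ ≠ (Z.glue e₁ e₂ h).graph.opp e₂ := by
      rw [hopp]
      exact hq.2.1
    have h2 : f₂ ≠ e₂ ∧ f₂ ≠ (Z.glue e₁ e₂ h).graph.opp e₂ := by
      rw [hopp]
      exact hq.2.2.1
    have hopp' : (Z.glueTwice _ hq).graph.opp e₂ = (Z.glue e₁ e₂ h).graph.opp e₂ :=
      glueOpp_eq_opp (Γ := (Z.glue e₁ e₂ h).graph) h1 h2
    have h0 : contractTwice (Z.glueTwice _ hq) e₂ f₂ = 0 :=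
      dif_neg (not_not.2 (he.trans (congrArg Z.graph.att hopp'.symm)))
    exact (congrArg _ h0).trans (smul_zero _)
  · rfl

theorem fuseClass_of_loop (Z : LabelledGraph O) {e₁ e₂ : Z.graph.H} (h : Z.graph.Indep e₁ e₂)
    (he : (Z.glue e₁ e₂ h).graph.att e₂ =
      (Z.glue e₁ e₂ h).graph.att ((Z.glue e₁ e₂ h).graph.opp e₂)) :
    fuseClass Z e₁ e₂ = 0 := by
  have h0 : contractClass (Z.glue e₁ e₂ h) e₂ = 0 := dif_neg (not_not.2 he)
  exact (dif_pos h).trans ((congrArg _ h0).trans (smul_zero _))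

theorem fuseClass_of_ne (Z : LabelledGraph O) {e₁ e₂ : Z.graph.H} (h : Z.graph.Indep e₁ e₂)
    (he : (Z.glue e₁ e₂ h).graph.att e₂ ≠
      (Z.glue e₁ e₂ h).graph.att ((Z.glue e₁ e₂ h).graph.opp e₂)) :
    fuseClass Z e₁ e₂ = (Z.graph.dirSign e₁ * Z.graph.dirSign e₂) •
      (Z.glue e₁ e₂ h).graph.contractSign e₂ • graphClass ((Z.glue e₁ e₂ h).contract e₂ he) := by
  have h0 : contractClass (Z.glue e₁ e₂ h) e₂ = (Z.glue e₁ e₂ h).graph.contractSign e₂ •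
    graphClass ((Z.glue e₁ e₂ h).contract e₂ he) := dif_pos he
  exact (dif_pos h).trans (congrArg _ h0)

theorem componentProjection_graphClass (i : ℕ) (X : LabelledGraph O) :
    componentProjection i (graphClass X) =
      if Nat.card X.graph.Components = i then graphClass X else 0 :=
  graphLift_graphClass _ _ X

/-- Contracting an edge that is not a loop preserves the components, so they can be counted in the
glued graph; a loop gives zero on both sides. -/
theorem componentProjection_fuseClass (i : ℕ) (Z : LabelledGraph O) (e₁ e₂ : Z.graph.H) :
    componentProjection i (fuseClass Z e₁ e₂) =
      if componentCount Z.graph.att (oppGlue Z.graph.opp e₁ e₂) = i then fuseClass Z e₁ e₂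
      else 0 := by
  by_cases h : Z.graph.Indep e₁ e₂
  · by_cases he : (Z.glue e₁ e₂ h).graph.att e₂ ≠
      (Z.glue e₁ e₂ h).graph.att ((Z.glue e₁ e₂ h).graph.opp e₂)
    · have hc : Nat.card ((Z.glue e₁ e₂ h).contract e₂ he).graph.Components =
          componentCount Z.graph.att (oppGlue Z.graph.opp e₁ e₂) :=
        Nat.card_congr (contractComponents (Z.glue e₁ e₂ h).graph e₂ he)
      rw [fuseClass_of_ne Z h he, map_zsmul, map_zsmul, componentProjection_graphClass, hc]
      split_ifs
      · rfl
      · rw [smul_zero, smul_zero]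
    · rw [fuseClass_of_loop Z h (not_not.1 he), map_zero, ite_self]
  · have : fuseClass Z e₁ e₂ = 0 := dif_neg h
    rw [this, map_zero, ite_self]

/-- The operator `π₂ ∂₂` on a labelled graph. -/
theorem componentProjection_partial2 (i : ℕ) (Z : LabelledGraph O) :
    componentProjection i (partial2 (graphClass Z)) = ∑ p : Z.graph.H × Z.graph.H,
      if componentCount Z.graph.att (oppGlue Z.graph.opp p.1 p.2) = i then fuseClass Z p.1 p.2
      else 0 := by
  have : partial2 (graphClass Z) = ∑ p : Z.graph.H × Z.graph.H, fuseClass Z p.1 p.2 :=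
    graphLift_graphClass _ _ Z
  rw [this, map_sum]
  exact Finset.sum_congr rfl fun p _ => componentProjection_fuseClass i Z p.1 p.2

/-- The contraction can be moved past the square, and then it does not affect the components. -/
theorem componentCount_contract (Z : LabelledGraph O) {e f₁ f₂ : Z.graph.H}
    (he : Z.graph.att e ≠ Z.graph.att (Z.graph.opp e))
    (h₁ : f₁ ≠ e ∧ f₁ ≠ Z.graph.opp e) (h₂ : f₂ ≠ e ∧ f₂ ≠ Z.graph.opp e)
    (h : Z.graph.Indep f₁ f₂) :
    componentCount (Z.contract e he).graph.att (oppGlue (Z.contract e he).graph.opp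
      (⟨f₁, h₁⟩ : Z.graph.HalfRest e) (⟨f₂, h₂⟩ : Z.graph.HalfRest e)) =
      componentCount Z.graph.att (oppGlue Z.graph.opp f₁ f₂) := by
  have hopp := glueOpp_eq_opp h₁ h₂
  have he' : Z.graph.att e ≠ Z.graph.att (Z.graph.glueOpp f₁ f₂ e) := by rwa [hopp]
  obtain ⟨φ, -⟩ := exists_iso_contract_glue Z he h₁ h₂ h he' ((indep_contract he h₁ h₂).2 h)
  exact Nat.card_congr (φ.components.trans (contractComponents (Z.glue f₁ f₂ h).graph e he'))

/-- The operator `π₂ ∂₂` on the fusion of two edges. -/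
theorem componentProjection_partial2_fuseClass (i : ℕ) (Z : LabelledGraph O)
    (e₁ e₂ : Z.graph.H) :
    componentProjection i (partial2 (fuseClass Z e₁ e₂)) = ∑ f : Z.graph.H × Z.graph.H,
      if componentCount Z.graph.att (oppGlueTwice Z.graph.opp (e₁, e₂, f.1, f.2)) = i then
        fuseTwice Z (e₁, e₂, f.1, f.2) else 0 := by
  by_cases h : Z.graph.Indep e₁ e₂
  · by_cases he : (Z.glue e₁ e₂ h).graph.att e₂ ≠
      (Z.glue e₁ e₂ h).graph.att ((Z.glue e₁ e₂ h).graph.opp e₂)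
    · rw [fuseClass_of_ne Z h he, map_zsmul, map_zsmul, map_zsmul, map_zsmul,
        componentProjection_partial2]
      refine Eq.trans ?_ (smul_sum_fuseClass_contract Z h he fun f₁ f₂ =>
        componentCount Z.graph.att (oppGlueTwice Z.graph.opp (e₁, e₂, f₁, f₂)) = i)
      refine congrArg _ (congrArg _ (Finset.sum_congr rfl ?_))
      rintro ⟨⟨f₁, h1⟩, f₂, h2⟩ -
      -- A nonzero summand forces `f₁` and `f₂` to lie on different edges, as
      -- `componentCount_contract` requires.
      refine ite_zero_congr fun hne => Eq.congr_left (componentCount_contract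
        (Z.glue e₁ e₂ h) he h1 h2 ?_)
      by_contra hf
      exact hne (dif_neg fun h' => hf ((indep_contract he h1 h2).1 h'))
    · have he := not_not.1 he
      rw [fuseClass_of_loop Z h he, map_zero, map_zero]
      refine (Finset.sum_eq_zero fun f _ => ?_).symm
      rw [fuseTwice_of_loop Z h he, ite_self]
  · have h0 : fuseClass Z e₁ e₂ = 0 := dif_neg h
    rw [h0, map_zero, map_zero]
    refine (Finset.sum_eq_zero fun f _ => ?_).symm
    have : fuseTwice Z (e₁, e₂, f.1, f.2) = 0 := dif_neg fun hq => h hq.1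
    rw [this, ite_self]

end

section

open OGraph

variable {k : Type u} [Field k] {O : CyclicOperad.{u, w} k}

/-! ### Fusion of a fusion with another graph -/

namespace LabelledGraph.IsLabel

variable {X : LabelledGraph O}

theorem inl (Y : LabelledGraph O) {v : X.graph.V} {S : Type} [Finite S] {ι : S → X.graph.H}
    {s : O.obj S} (h : X.IsLabel v ι s) :
    (X.disjUnion Y).IsLabel (Sum.inl v : X.graph.V ⊕ Y.graph.V)
      (fun i => (Sum.inl (ι i) : X.graph.H ⊕ Y.graph.H)) s := by
  obtain ⟨E, hE, h⟩ := h
  refine ⟨E.trans (X.graph.starInl Y.graph v), fun i => congrArg Sum.inl (hE i), ?_⟩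
  exact (congrArg (O.map (X.graph.starInl Y.graph v)) h).trans (O.map_trans _ _ _).symm

theorem inr (Y : LabelledGraph O) {v : X.graph.V} {S : Type} [Finite S] {ι : S → X.graph.H}
    {s : O.obj S} (h : X.IsLabel v ι s) :
    (Y.disjUnion X).IsLabel (Sum.inr v : Y.graph.V ⊕ X.graph.V)
      (fun i => (Sum.inr (ι i) : Y.graph.H ⊕ X.graph.H)) s := by
  obtain ⟨E, hE, h⟩ := h
  refine ⟨E.trans (Y.graph.starInr X.graph v), fun i => congrArg Sum.inr (hE i), ?_⟩
  exact (congrArg (O.map (Y.graph.starInr X.graph v)) h).trans (O.map_trans _ _ _).symm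

end LabelledGraph.IsLabel

/-- The half-edges of a disjoint union after a contraction in the first part. -/
def halfRestInl (Γ Δ : OGraph) (e : Γ.H) :
    Γ.HalfRest e ⊕ Δ.H ≃ (Γ.disjUnion Δ).HalfRest (Sum.inl e : Γ.H ⊕ Δ.H) where
  toFun
    | Sum.inl h => ⟨Sum.inl h.1, fun h' => h.2.1 (Sum.inl.inj h'), fun h' => h.2.2 (Sum.inl.inj h')⟩
    | Sum.inr h => ⟨Sum.inr h, Sum.inr_ne_inl (a := e), Sum.inr_ne_inl (a := Γ.opp e)⟩
  invFun
    | ⟨Sum.inl h, h'⟩ => Sum.inl ⟨h, fun e => h'.1 (congrArg Sum.inl e),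
        fun e => h'.2 (congrArg Sum.inl e)⟩
    | ⟨Sum.inr h, _⟩ => Sum.inr h
  left_inv := by rintro (h | h) <;> rfl
  right_inv := by rintro ⟨h | h, h'⟩ <;> rfl

theorem att_inl_ne {Γ : OGraph} (Δ : OGraph) {e : Γ.H} (he : Γ.att e ≠ Γ.att (Γ.opp e)) :
    (Γ.disjUnion Δ).att (Sum.inl e : Γ.H ⊕ Δ.H) ≠
      (Γ.disjUnion Δ).att ((Γ.disjUnion Δ).opp (Sum.inl e : Γ.H ⊕ Δ.H)) :=
  fun h => he (Sum.inl.inj h)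

theorem quotVertex_inl_eq_iff {Γ Δ : OGraph} {e : Γ.H} (he : Γ.att e ≠ Γ.att (Γ.opp e))
    (v w : Γ.V ⊕ Δ.V) :
    (Γ.disjUnion Δ).quotVertex (Sum.inl e : Γ.H ⊕ Δ.H) (att_inl_ne Δ he) v =
      (Γ.disjUnion Δ).quotVertex (Sum.inl e : Γ.H ⊕ Δ.H) (att_inl_ne Δ he) w ↔
    v = w ∨ ((v = Sum.inl (Γ.att e) ∨ v = Sum.inl (Γ.att (Γ.opp e))) ∧
      (w = Sum.inl (Γ.att e) ∨ w = Sum.inl (Γ.att (Γ.opp e)))) :=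
  quotVertex_eq_iff

/-- Contraction in the first part of a disjoint union. -/
theorem exists_iso_contract_disjUnion (X Y : LabelledGraph O) {e : X.graph.H}
    (he : X.graph.att e ≠ X.graph.att (X.graph.opp e)) :
    ∃ φ : ((X.contract e he).disjUnion Y).graph.Iso
        ((X.disjUnion Y).contract (Sum.inl e : X.graph.H ⊕ Y.graph.H)
          (att_inl_ne Y.graph he)).graph,
      φ.onH = halfRestInl X.graph Y.graph e ∧ φ.sign = 1 ∧
      ∀ v, ((X.disjUnion Y).contract (Sum.inl e : X.graph.H ⊕ Y.graph.H)
          (att_inl_ne Y.graph he)).label (φ.onV v) =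
        O.map (φ.star v) (((X.contract e he).disjUnion Y).label v) := by
  have he' := att_inl_ne Y.graph he
  have hsurj := quotVertex_surjective X.graph e he
  refine exists_oriented_iso_of_quot (A := X.graph.V ⊕ Y.graph.V)
    (X := (X.contract e he).disjUnion Y)
    (Y := (X.disjUnion Y).contract (Sum.inl e : X.graph.H ⊕ Y.graph.H) he')
    (Sum.map (X.graph.quotVertex e he) id)
    ((X.disjUnion Y).graph.quotVertex (Sum.inl e : X.graph.H ⊕ Y.graph.H) he')
    ?_ (quotVertex_surjective _ _ _) ?_ (halfRestInl X.graph Y.graph e) ?_ ?_ ?_ ?_ ?_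
  · rintro (v | v)
    · obtain ⟨v, rfl⟩ := hsurj v
      exact ⟨Sum.inl v, rfl⟩
    · exact ⟨Sum.inr v, rfl⟩
  · intro a b
    refine Iff.trans ?_ (quotVertex_inl_eq_iff he a b).symm
    rcases a with a | a <;> rcases b with b | b
    · rw [Sum.map_inl, Sum.map_inl]
      refine (Sum.inl_injective.eq_iff).trans (quotVertex_eq_iff.trans ?_)
      simp only [Sum.inl.injEq]
    · simp
    · simp
    · simp only [Sum.map_inr, id, reduceCtorEq, or_self, and_self, or_false]
      exact Sum.inr_injective.eq_iff.trans Sum.inr_injective.eq_iff.symm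
  · rintro (h | h) <;> rfl
  · rintro (h | h)
    · exact ⟨Sum.inl (X.graph.att h.1), rfl, rfl⟩
    · exact ⟨Sum.inr (Y.graph.att h), rfl, rfl⟩
  · have key : ∀ a : X.graph.V ⊕ Y.graph.V, SameLabel ((X.contract e he).disjUnion Y)
        ((X.disjUnion Y).contract (Sum.inl e : X.graph.H ⊕ Y.graph.H) he')
        (fun i => (halfRestInl X.graph Y.graph e i).1) (fun i => i.1)
        (Sum.map (X.graph.quotVertex e he) id a)
        ((X.disjUnion Y).graph.quotVertex (Sum.inl e : X.graph.H ⊕ Y.graph.H) he' a) := by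
      rintro (v | v)
      · by_cases hv : v ≠ X.graph.att e ∧ v ≠ X.graph.att (X.graph.opp e)
        · have hu := LabelledGraph.IsLabel.self X v
          obtain ⟨ι, i1, hι⟩ := hu.exists_contract_of_ne he hv
          obtain ⟨κ, k1, hκ⟩ := LabelledGraph.IsLabel.exists_contract_of_ne (X := X.disjUnion Y) he'
            (v := (Sum.inl v : X.graph.V ⊕ Y.graph.V))
            ⟨fun h => hv.1 (Sum.inl.inj h), fun h => hv.2 (Sum.inl.inj h)⟩ (hu.inl Y)
          refine ⟨_, inferInstance, _, _, κ, hι.inl Y, hκ, fun i => ?_⟩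
          exact Eq.trans (congrArg Sum.inl (i1 i)) (k1 i).symm
        · have hv : v = X.graph.att e ∨ v = X.graph.att (X.graph.opp e) := by tauto
          have hu := LabelledGraph.IsLabel.self X (X.graph.att e)
          have hw := LabelledGraph.IsLabel.self X (X.graph.att (X.graph.opp e))
          obtain ⟨ι, i1, i2, hι⟩ := hu.exists_contract_of_eq he hv hw (a := ⟨e, rfl⟩)
            (b := ⟨X.graph.opp e, rfl⟩) rfl rfl
          obtain ⟨κ, k1, k2, hκ⟩ := LabelledGraph.IsLabel.exists_contract_of_eq (X := X.disjUnion Y) he'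
            (v := (Sum.inl v : X.graph.V ⊕ Y.graph.V))
            (hv.imp (congrArg Sum.inl) (congrArg Sum.inl)) (hu.inl Y) (hw.inl Y)
            (a := ⟨e, rfl⟩) (b := ⟨X.graph.opp e, rfl⟩) rfl rfl
          refine ⟨_, inferInstance, _, _, κ, hι.inl Y, hκ, ?_⟩
          rintro (i | i)
          · exact Eq.trans (congrArg Sum.inl (i1 i)) (k1 i).symm
          · exact Eq.trans (congrArg Sum.inl (i2 i)) (k2 i).symm
      · have hu := LabelledGraph.IsLabel.self Y v
        obtain ⟨κ, k1, hκ⟩ := LabelledGraph.IsLabel.exists_contract_of_ne (X := X.disjUnion Y) he'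
          (v := (Sum.inr v : X.graph.V ⊕ Y.graph.V))
          ⟨Sum.inr_ne_inl (a := X.graph.att e), Sum.inr_ne_inl (a := X.graph.att (X.graph.opp e))⟩ (hu.inr X)
        exact ⟨_, inferInstance, _, _, κ, hu.inr (X.contract e he), hκ, fun i => (k1 i).symm⟩
    exact fun a => (key a).isLabel _ Subtype.val_injective fun _ => rfl
  · intro a b hab
    refine (contract_lt_quotVertex _ _ he' _ _).2 ?_
    rcases a with a | a <;> rcases b with b | b
    · have h := (contract_lt_quotVertex _ _ he _ _).1 (Sum.lex_inl_inl.1 hab)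
      refine ⟨⟨fun h' => h.1.1 (Sum.inl.inj h'), fun h' => h.1.2 (Sum.inl.inj h')⟩, ?_⟩
      exact h.2.imp (Or.imp (congrArg Sum.inl) (congrArg Sum.inl)) Sum.lex_inl_inl.2
    · exact ⟨⟨Sum.inr_ne_inl (a := X.graph.att e), Sum.inr_ne_inl (a := X.graph.att (X.graph.opp e))⟩, Or.inr (Sum.Lex.sep _ _)⟩
    · exact (Sum.lex_inr_inl hab).elim
    · exact ⟨⟨Sum.inr_ne_inl (a := X.graph.att e), Sum.inr_ne_inl (a := X.graph.att (X.graph.opp e))⟩,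
        Or.inr (Sum.lex_inr_inr.2 (Sum.lex_inr_inr.1 hab))⟩
  · rintro (h | h) <;> rfl

/-- The vertices of `Δ` come after those of `Γ`, so they are not counted by `frontCount`. -/
theorem contractSign_inl (Γ Δ : OGraph) (e : Γ.H) :
    (Γ.disjUnion Δ).contractSign (Sum.inl e : Γ.H ⊕ Δ.H) = Γ.contractSign e := by
  have key : ∀ (S : Γ.V → Prop) (R : (Γ.disjUnion Δ).V → Prop) [DecidablePred S]
      [DecidablePred R], (∀ v, R (Sum.inl v) ↔ S v) → (∀ w, ¬ R (Sum.inr w)) →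
      (Finset.univ.filter R).card = (Finset.univ.filter S).card := by
    intro S R _ _ h1 h2
    symm
    refine Finset.card_bij (fun w _ => Sum.inl w) ?_ (fun _ _ _ _ h => Sum.inl.inj h) ?_
    · intro w hw
      exact Finset.mem_filter.2 ⟨Finset.mem_univ _, (h1 w).2 (Finset.mem_filter.1 hw).2⟩
    · rintro (w | w) hw
      · exact ⟨w, Finset.mem_filter.2 ⟨Finset.mem_univ _, (h1 w).1 (Finset.mem_filter.1 hw).2⟩, rfl⟩
      · exact (h2 w (Finset.mem_filter.1 hw).2).elim
  have h3 : (Γ.disjUnion Δ).frontCount (Sum.inl e : Γ.H ⊕ Δ.H) = Γ.frontCount e := by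
    unfold frontCount
    refine congrArg₂ (· + ·) (key _ _ (fun v => Sum.lex_inl_inl) fun w => Sum.lex_inr_inl)
      (key _ _ (fun v => and_congr Sum.inl_injective.ne_iff Sum.lex_inl_inl)
        fun w h => Sum.lex_inr_inl h.2)
  unfold contractSign
  rw [h3]
  rfl

/-- Gluing a square in the first part of a disjoint union. -/
theorem exists_iso_glue_disjUnion (X Y : LabelledGraph O) {e₁ e₂ : X.graph.H}
    (h : X.graph.Indep e₁ e₂)
    (h' : (X.disjUnion Y).graph.Indep (Sum.inl e₁ : X.graph.H ⊕ Y.graph.H)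
      (Sum.inl e₂ : X.graph.H ⊕ Y.graph.H)) :
    ∃ φ : ((X.glue e₁ e₂ h).disjUnion Y).graph.Iso
        ((X.disjUnion Y).glue (Sum.inl e₁ : X.graph.H ⊕ Y.graph.H)
          (Sum.inl e₂ : X.graph.H ⊕ Y.graph.H) h').graph,
      (∀ i, φ.onH i = i) ∧ φ.sign = 1 ∧
      ∀ v, ((X.disjUnion Y).glue (Sum.inl e₁ : X.graph.H ⊕ Y.graph.H)
          (Sum.inl e₂ : X.graph.H ⊕ Y.graph.H) h').label (φ.onV v) =
        O.map (φ.star v) (((X.glue e₁ e₂ h).disjUnion Y).label v) := by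
  let φ : ((X.glue e₁ e₂ h).disjUnion Y).graph.Iso
        ((X.disjUnion Y).glue (Sum.inl e₁ : X.graph.H ⊕ Y.graph.H)
          (Sum.inl e₂ : X.graph.H ⊕ Y.graph.H) h').graph :=
    { onV := Equiv.refl (X.graph.V ⊕ Y.graph.V)
      onH := Equiv.refl (X.graph.H ⊕ Y.graph.H)
      att_onH := fun _ => rfl
      opp_onH := by
        rintro (i | i)
        · exact glueOpp_of_injective (Γ := X.graph) (Γ' := X.graph.disjUnion Y.graph)
            Sum.inl_injective (fun _ => rfl) e₁ e₂ i
        · exact oppGlue_of_ne (o := (X.graph.disjUnion Y.graph).opp) (e₁ := Sum.inl e₁)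
            (e₂ := Sum.inl e₂) ⟨by rintro ⟨⟩, by rintro ⟨⟩, by rintro ⟨⟩, by rintro ⟨⟩⟩ }
  refine ⟨φ, fun _ => rfl, φ.sign_eq_one (fun v w h => h) ?_, ?_⟩
  swap
  · refine LabelledGraph.IsLabel.iso_label φ ?_
    rintro (v | v)
    · have hu := LabelledGraph.IsLabel.self X v
      exact LabelledGraph.IsLabel.transfer (Y := (X.disjUnion Y).glue _ _ h') φ.onH
        (LabelledGraph.IsLabel.inl (X := X.glue e₁ e₂ h) Y hu) (hu.inl Y)
    · have hu := LabelledGraph.IsLabel.self Y v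
      exact LabelledGraph.IsLabel.transfer (Y := (X.disjUnion Y).glue _ _ h') φ.onH
        (hu.inr (X.glue e₁ e₂ h)) (hu.inr X)
  rintro (i | i)
  · exact glueOut_of_injective (Γ := X.graph) (Γ' := X.graph.disjUnion Y.graph)
      Sum.inl_injective (fun _ => rfl) (fun _ => rfl) e₁ e₂ i
  · change (X.graph.disjUnion Y.graph).glueOut (Sum.inl e₁) (Sum.inl e₂) (Sum.inr i) =
      Y.graph.out i
    unfold glueOut
    refine (if_neg ?_).trans (if_neg ?_)
    · rintro (⟨⟨⟩⟩ | ⟨⟨⟩⟩)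
    · rintro (⟨⟨⟩⟩ | ⟨⟨⟩⟩)

/-- By `sign_contract`, the contraction signs make up for the difference between the sign of `φ` and
that of the induced isomorphism of the contractions. -/
theorem smul_fuseClass_contract_iso {X Y : LabelledGraph O} (φ : X.graph.Iso Y.graph)
    (h : ∀ v, Y.label (φ.onV v) = O.map (φ.star v) (X.label v)) {e : X.graph.H} {e' : Y.graph.H}
    (he : X.graph.att e ≠ X.graph.att (X.graph.opp e))
    (he' : Y.graph.att e' ≠ Y.graph.att (Y.graph.opp e')) (hφ : φ.onH e = e')
    {p₁ p₂ : X.graph.HalfRest e} {q₁ q₂ : Y.graph.HalfRest e'} (h₁ : φ.onH p₁.1 = q₁.1)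
    (h₂ : φ.onH p₂.1 = q₂.1) :
    X.graph.contractSign e • fuseClass (X.contract e he) p₁ p₂ =
      φ.sign • Y.graph.contractSign e' • fuseClass (Y.contract e' he') q₁ q₂ := by
  subst hφ
  have := fuseClass_iso (φ.contract e he) _ _ (contractLabel_iso φ X.label Y.label h e he) p₁ p₂
  have e1 : (φ.contract e he).onH p₁ = q₁ := Subtype.ext h₁
  have e2 : (φ.contract e he).onH p₂ = q₂ := Subtype.ext h₂
  rw [e1, e2] at this
  rw [smul_smul, ← φ.sign_contract e he, ← smul_smul]
  exact congrArg _ this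

theorem phi2_graphClass (X Y : LabelledGraph O) :
    phi2 (graphClass X) (graphClass Y) = fusionSum X Y := by
  unfold phi2
  rw [graphLift_graphClass, graphLift_graphClass]

/-- The fusion of a graph with a fusion of two edges. -/
theorem phi2_fuseClass (X Y : LabelledGraph O) (e₁ e₂ : X.graph.H) :
    phi2 (fuseClass X e₁ e₂) (graphClass Y) =
      ∑ f : (X.graph.H ⊕ Y.graph.H) × (X.graph.H ⊕ Y.graph.H),
        if f.1.isLeft ≠ f.2.isLeft then
          fuseTwice (X.disjUnion Y) (Sum.inl e₁, Sum.inl e₂, f.1, f.2) else 0 := by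
  have hzero : ∀ {F : (X.graph.H ⊕ Y.graph.H) × (X.graph.H ⊕ Y.graph.H) → GraphSpace O},
      (∀ f, F f = 0) → phi2 0 (graphClass Y) = ∑ f : (X.graph.H ⊕ Y.graph.H) ×
        (X.graph.H ⊕ Y.graph.H), if f.1.isLeft ≠ f.2.isLeft then F f else 0 := by
    intro F hF
    rw [map_zero, LinearMap.zero_apply]
    refine (Finset.sum_eq_zero fun f _ => ?_).symm
    rw [hF, ite_self]
  by_cases h : X.graph.Indep e₁ e₂
  · have h' : (X.disjUnion Y).graph.Indep (Sum.inl e₁ : X.graph.H ⊕ Y.graph.H)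
        (Sum.inl e₂ : X.graph.H ⊕ Y.graph.H) :=
      ⟨fun h1 => h.1 (Sum.inl.inj h1), fun h1 => h.2 (Sum.inl.inj h1)⟩
    obtain ⟨φ, hφ, hs, hl⟩ := exists_iso_glue_disjUnion X Y h h'
    by_cases he : (X.glue e₁ e₂ h).graph.att e₂ ≠
      (X.glue e₁ e₂ h).graph.att ((X.glue e₁ e₂ h).graph.opp e₂)
    · have hopp : ((X.disjUnion Y).glue (Sum.inl e₁ : X.graph.H ⊕ Y.graph.H)
          (Sum.inl e₂ : X.graph.H ⊕ Y.graph.H) h').graph.opp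
            (Sum.inl e₂ : X.graph.H ⊕ Y.graph.H) = Sum.inl ((X.glue e₁ e₂ h).graph.opp e₂) :=
        glueOpp_of_injective (Γ := X.graph) (Γ' := X.graph.disjUnion Y.graph)
            Sum.inl_injective (fun _ => rfl) e₁ e₂ e₂
      have he2 : ((X.disjUnion Y).glue (Sum.inl e₁ : X.graph.H ⊕ Y.graph.H)
          (Sum.inl e₂ : X.graph.H ⊕ Y.graph.H) h').graph.att
            (Sum.inl e₂ : X.graph.H ⊕ Y.graph.H) ≠
          ((X.disjUnion Y).glue (Sum.inl e₁ : X.graph.H ⊕ Y.graph.H)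
          (Sum.inl e₂ : X.graph.H ⊕ Y.graph.H) h').graph.att
          (((X.disjUnion Y).glue (Sum.inl e₁ : X.graph.H ⊕ Y.graph.H)
          (Sum.inl e₂ : X.graph.H ⊕ Y.graph.H) h').graph.opp
            (Sum.inl e₂ : X.graph.H ⊕ Y.graph.H)) :=
        fun h1 => he (Sum.inl.inj (h1.trans (congrArg (X.disjUnion Y).graph.att hopp)))
      -- Adding `Y` commutes with gluing the square, by `φ`, and with contracting its edge, by `χ`;
      -- both isomorphisms have sign 1.
      obtain ⟨χ, hχ, ht, hm⟩ := exists_iso_contract_disjUnion (X.glue e₁ e₂ h) Y he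
      let ψ : (X.glue e₁ e₂ h).graph.HalfRest e₂ ⊕ Y.graph.H ≃
          ((X.disjUnion Y).glue (Sum.inl e₁ : X.graph.H ⊕ Y.graph.H)
          (Sum.inl e₂ : X.graph.H ⊕ Y.graph.H) h').graph.HalfRest
            (Sum.inl e₂ : X.graph.H ⊕ Y.graph.H) :=
        (halfRestInl (X.glue e₁ e₂ h).graph Y.graph e₂).trans <|
          Equiv.subtypeEquivRight fun i => and_congr Iff.rfl
            (Iff.of_eq (congrArg (fun j => i ≠ j) hopp.symm))
      have hψ : ∀ i, (ψ i).1.isLeft = i.isLeft := by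
        rintro (i | i) <;> rfl
      rw [fuseClass_of_ne X h he, map_zsmul, map_zsmul, LinearMap.smul_apply,
        LinearMap.smul_apply, phi2_graphClass]
      refine Eq.trans ?_ ((smul_sum_fuseClass_contract (X.disjUnion Y) h' he2
        fun a b : X.graph.H ⊕ Y.graph.H => a.isLeft ≠ b.isLeft).trans
          (Finset.sum_congr rfl fun f _ => ite_zero_congr fun _ => Iff.rfl))
      refine congrArg₂ (fun (c : ℤ) z => c • z) rfl ?_
      unfold fusionSum
      rw [Finset.smul_sum, Finset.smul_sum]
      refine Fintype.sum_equiv (Equiv.prodCongr ψ ψ) _ _ ?_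
      rintro ⟨p₁, p₂⟩
      have hiff : (ψ p₁).1.isLeft ≠ (ψ p₂).1.isLeft ↔ p₁.isLeft ≠ p₂.isLeft := by
        rw [hψ, hψ]
      by_cases hm' : p₁.isLeft ≠ p₂.isLeft
      · have k1 := fuseClass_iso χ _ _ hm p₁ p₂
        have k2 := smul_fuseClass_contract_iso φ hl (att_inl_ne Y.graph he) he2
          (hφ (Sum.inl e₂ : X.graph.H ⊕ Y.graph.H)) (p₁ := halfRestInl _ _ _ p₁)
          (p₂ := halfRestInl _ _ _ p₂) (q₁ := ψ p₁) (q₂ := ψ p₂) (hφ _) (hφ _)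
        rw [ht, one_smul, hχ] at k1
        rw [hs, one_smul] at k2
        refine (congrArg _ (if_pos hm')).trans
          (Eq.trans (Eq.trans ?_ k2) (congrArg _ (if_pos (hiff.2 hm'))).symm)
        refine congrArg₂ (fun (c : ℤ) z => c • z)
          (contractSign_inl (X.glue e₁ e₂ h).graph Y.graph e₂).symm k1
      · exact ((congrArg _ (if_neg hm')).trans (smul_zero _)).trans
          ((congrArg _ (if_neg fun h1 => hm' (hiff.1 h1))).trans (smul_zero _)).symm
    · rw [fuseClass_of_loop X h (not_not.1 he)]
      refine hzero fun f => fuseTwice_of_loop (X.disjUnion Y) h' ?_ _ _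
      have hopp : ((X.disjUnion Y).glue (Sum.inl e₁ : X.graph.H ⊕ Y.graph.H)
          (Sum.inl e₂ : X.graph.H ⊕ Y.graph.H) h').graph.opp
            (Sum.inl e₂ : X.graph.H ⊕ Y.graph.H) = Sum.inl ((X.glue e₁ e₂ h).graph.opp e₂) :=
        glueOpp_of_injective (Γ := X.graph) (Γ' := X.graph.disjUnion Y.graph)
            Sum.inl_injective (fun _ => rfl) e₁ e₂ e₂
      exact (congrArg Sum.inl (not_not.1 he)).trans
        (congrArg (X.disjUnion Y).graph.att hopp).symm
  · have h0 : fuseClass X e₁ e₂ = 0 := dif_neg h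
    rw [h0]
    exact hzero fun f => dif_neg fun hq =>
      h ⟨fun h1 => hq.1.1 (congrArg Sum.inl h1), fun h1 => hq.1.2 (congrArg Sum.inl h1)⟩

end

/-- When three edges take part, the condition says that they do not all have the same colour, which
is symmetric in them. With four edges the two pairs are merely swapped. -/
theorem ne_or_ne_exchange {H : Type} {o : H → H} (ho : ∀ h, o (o h) = h) (c : H → Bool)
    (hc : ∀ h, c (o h) = c h) {q : H × H × H × H} (hq : Gluable o q)
    (h : c q.1 ≠ c q.2.1 ∨ c q.2.2.1 ≠ c q.2.2.2) :
    c (exchange o q).1 ≠ c (exchange o q).2.1 ∨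
      c (exchange o q).2.2.1 ≠ c (exchange o q).2.2.2 := by
  obtain ⟨e₁, e₂, f₁, f₂⟩ := q
  obtain ⟨h0, ⟨rfl, -, hx⟩ | ⟨rfl, -, hx⟩ | ⟨rfl, -, hx⟩ | ⟨rfl, -, hx⟩ | ⟨-, -, hx⟩⟩ :=
    gluable_cases ho hq <;> rw [hx] <;> simp only [hc] at h ⊢ <;> grind

/-! ### Comparison of the three terms -/

section

open OGraph

variable {k : Type u} [Field k] {O : CyclicOperad.{u, w} k}

theorem swap_label (X Y : LabelledGraph O) (v : (X.disjUnion Y).graph.V) :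
    (Y.disjUnion X).label ((Iso.swap X.graph Y.graph).onV v) =
      O.map ((Iso.swap X.graph Y.graph).star v) ((X.disjUnion Y).label v) := by
  revert v
  refine LabelledGraph.IsLabel.iso_label (X := X.disjUnion Y) (Y := Y.disjUnion X)
    (Iso.swap X.graph Y.graph) ?_
  rintro (v | v)
  · have hu := LabelledGraph.IsLabel.self X v
    exact LabelledGraph.IsLabel.transfer (Y := Y.disjUnion X) (Iso.swap X.graph Y.graph).onH
      (hu.inl Y) (hu.inr Y)
  · have hu := LabelledGraph.IsLabel.self Y v
    exact LabelledGraph.IsLabel.transfer (Y := Y.disjUnion X) (Iso.swap X.graph Y.graph).onH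
      (hu.inr X) (hu.inl X)

theorem isLeft_sumComm {α β : Type} (a : α ⊕ β) : (Equiv.sumComm α β a).isLeft = !a.isLeft := by
  rcases a with a | a <;> rfl

/-- The graded commutativity of the fusion. -/
theorem fusionSum_comm (X Y : LabelledGraph O) :
    fusionSum X Y =
      ((-1 : ℤ) ^ (Nat.card X.graph.V * Nat.card Y.graph.V)) • fusionSum Y X := by
  unfold fusionSum
  rw [Finset.smul_sum]
  refine Fintype.sum_equiv (Equiv.prodCongr (Equiv.sumComm X.graph.H Y.graph.H)
    (Equiv.sumComm X.graph.H Y.graph.H)) _ _ ?_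
  rintro ⟨e₁, e₂⟩
  have h := fuseClass_iso (Iso.swap X.graph Y.graph) _ _ (swap_label X Y) e₁ e₂
  rw [Iso.sign_swap] at h
  have hiff : ((Equiv.sumComm X.graph.H Y.graph.H) e₁).isLeft ≠
      ((Equiv.sumComm X.graph.H Y.graph.H) e₂).isLeft ↔ e₁.isLeft ≠ e₂.isLeft := by
    rw [isLeft_sumComm, isLeft_sumComm]
    cases e₁.isLeft <;> cases e₂.isLeft <;> decide
  by_cases he : e₁.isLeft ≠ e₂.isLeft
  · exact (if_pos he).trans (h.trans (congrArg _ (if_pos (hiff.2 he))).symm)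
  · exact (if_neg he).trans
      ((congrArg _ (if_neg fun h1 => he (hiff.1 h1))).trans (smul_zero _)).symm

theorem card_contract (Γ : OGraph) {e : Γ.H} (he : Γ.att e ≠ Γ.att (Γ.opp e)) :
    Nat.card (Γ.contract e he).V + 1 = Nat.card Γ.V := by
  have h1 : Nat.card (Γ.contract e he).V = Nat.card (Γ.Rest e) + 1 := Finite.card_option
  have h2 : Fintype.card (Γ.Rest e) = Fintype.card Γ.V - 2 := by
    rw [Fintype.card_subtype]
    have : (Finset.univ.filter fun v => v ≠ Γ.att e ∧ v ≠ Γ.att (Γ.opp e)) =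
        ({Γ.att e, Γ.att (Γ.opp e)} : Finset Γ.V)ᶜ := by
      ext v
      simp
    rw [this, Finset.card_compl, Finset.card_pair he]
  have h3 : 2 ≤ Fintype.card Γ.V := by
    rw [← Finset.card_pair he]
    exact Finset.card_le_univ _
  rw [h1, Nat.card_eq_fintype_card, Nat.card_eq_fintype_card]
  omega

/-- Let x and y be the numbers of vertices. Fusing two edges of `Y` lowers y by one, so
interchanging the factors costs (-1)^(x(y-1)). The additional (-1)^x completes this to the sign of
the exchange of `X` and `Y`. -/
theorem smul_phi2_fuseClass_comm (X Y : LabelledGraph O) (e₁ e₂ : Y.graph.H) :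
    ((-1 : ℤ) ^ Nat.card X.graph.V) • phi2 (graphClass X) (fuseClass Y e₁ e₂) =
      ((-1 : ℤ) ^ (Nat.card X.graph.V * Nat.card Y.graph.V)) •
        phi2 (fuseClass Y e₁ e₂) (graphClass X) := by
  by_cases h : Y.graph.Indep e₁ e₂
  · by_cases he : (Y.glue e₁ e₂ h).graph.att e₂ ≠
      (Y.glue e₁ e₂ h).graph.att ((Y.glue e₁ e₂ h).graph.opp e₂)
    · have hc : Nat.card ((Y.glue e₁ e₂ h).contract e₂ he).graph.V + 1 = Nat.card Y.graph.V :=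
        card_contract (Y.glue e₁ e₂ h).graph he
      rw [fuseClass_of_ne Y h he, map_zsmul, map_zsmul, map_zsmul, map_zsmul,
        LinearMap.smul_apply, LinearMap.smul_apply, phi2_graphClass, phi2_graphClass,
        fusionSum_comm, ← hc, mul_add, mul_one, pow_add, smul_smul, smul_smul, smul_smul,
        smul_smul, smul_smul]
      congr 1
      ring
    · rw [fuseClass_of_loop Y h (not_not.1 he)]
      simp
  · have h0 : fuseClass Y e₁ e₂ = 0 := dif_neg h
    rw [h0]
    simp

/-- The place where the absence of separating edges is used: a second square that joins the glued
`X` to `Y` leaves the number of components unchanged, so π₂ may be applied after both squares. -/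
theorem componentCount_oppGlueTwice_inl (X Y : LabelledGraph O)
    (hY : ∀ b, Subsingleton (Y.graph.ComponentsWithout b)) {e₁ e₂ : X.graph.H}
    (h : X.graph.Indep e₁ e₂) {f₁ f₂ : X.graph.H ⊕ Y.graph.H} (hf : f₁.isLeft ≠ f₂.isLeft) :
    componentCount (X.disjUnion Y).graph.att (oppGlueTwice (X.disjUnion Y).graph.opp
      (Sum.inl e₁, Sum.inl e₂, f₁, f₂)) =
      componentCount X.graph.att (oppGlue X.graph.opp e₁ e₂) := by
  have h' : (X.disjUnion Y).graph.Indep (Sum.inl e₁ : X.graph.H ⊕ Y.graph.H)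
      (Sum.inl e₂ : X.graph.H ⊕ Y.graph.H) :=
    ⟨fun h1 => h.1 (Sum.inl.inj h1), fun h1 => h.2 (Sum.inl.inj h1)⟩
  obtain ⟨φ, hφ, -⟩ := exists_iso_glue_disjUnion X Y h h'
  have hopp : oppGlue (X.disjUnion Y).graph.opp (Sum.inl e₁ : X.graph.H ⊕ Y.graph.H)
      (Sum.inl e₂ : X.graph.H ⊕ Y.graph.H) = ((X.glue e₁ e₂ h).disjUnion Y).graph.opp := by
    funext i
    have := φ.opp_onH i
    exact (congrArg _ (hφ i).symm).trans (this.trans (hφ _))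
  exact (congrArg (fun o => componentCount (X.disjUnion Y).graph.att (oppGlue o f₁ f₂)) hopp).trans
    (componentCount_disjUnion (X.glue e₁ e₂ h).graph Y.graph hY hf)

/-- The summand belonging to two pairs of edges. -/
def fissionTerm (Z : LabelledGraph O) (q : Z.graph.H × Z.graph.H × Z.graph.H × Z.graph.H) :
    GraphSpace O :=
  if componentCount Z.graph.att (oppGlueTwice Z.graph.opp q) = 2 then fuseTwice Z q else 0

/-- The fusion of the fission of a graph with another graph. -/
theorem phi2_componentProjection_left (X Y : LabelledGraph O)
    (hY : ∀ b, Subsingleton (Y.graph.ComponentsWithout b)) :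
    phi2 (componentProjection 2 (partial2 (graphClass X))) (graphClass Y) =
      ∑ p : X.graph.H × X.graph.H, ∑ f : (X.graph.H ⊕ Y.graph.H) × (X.graph.H ⊕ Y.graph.H),
        if f.1.isLeft ≠ f.2.isLeft then
          fissionTerm (X.disjUnion Y) (Sum.inl p.1, Sum.inl p.2, f.1, f.2) else 0 := by
  rw [componentProjection_partial2, map_sum, LinearMap.sum_apply]
  refine Finset.sum_congr rfl fun p _ => ?_
  have h1 : phi2 (if componentCount X.graph.att (oppGlue X.graph.opp p.1 p.2) = 2 then
      fuseClass X p.1 p.2 else 0) (graphClass Y) =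
      if componentCount X.graph.att (oppGlue X.graph.opp p.1 p.2) = 2 then
        phi2 (fuseClass X p.1 p.2) (graphClass Y) else 0 := by
    split_ifs
    · rfl
    · rw [map_zero, LinearMap.zero_apply]
  have h2 : ∀ f : (X.graph.H ⊕ Y.graph.H) × (X.graph.H ⊕ Y.graph.H), f.1.isLeft ≠ f.2.isLeft →
      fissionTerm (X.disjUnion Y) (Sum.inl p.1, Sum.inl p.2, f.1, f.2) =
        if componentCount X.graph.att (oppGlue X.graph.opp p.1 p.2) = 2 then
          fuseTwice (X.disjUnion Y) (Sum.inl p.1, Sum.inl p.2, f.1, f.2) else 0 := by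
    intro f hf
    refine ite_zero_congr fun hne => Eq.congr_left ?_
    by_cases h : X.graph.Indep p.1 p.2
    · exact componentCount_oppGlueTwice_inl X Y hY h hf
    · exact (hne (dif_neg fun hq => h ⟨fun h1 => hq.1.1 (congrArg Sum.inl h1),
        fun h1 => hq.1.2 (congrArg Sum.inl h1)⟩)).elim
  rw [h1, phi2_fuseClass]
  by_cases hc : componentCount X.graph.att (oppGlue X.graph.opp p.1 p.2) = 2
  · rw [if_pos hc]
    refine Finset.sum_congr rfl fun f _ => ?_
    by_cases hf : f.1.isLeft ≠ f.2.isLeft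
    · rw [if_pos hf, if_pos hf, h2 f hf, if_pos hc]
    · rw [if_neg hf, if_neg hf]
  · rw [if_neg hc]
    refine (Finset.sum_eq_zero fun f _ => ?_).symm
    by_cases hf : f.1.isLeft ≠ f.2.isLeft
    · rw [if_pos hf, h2 f hf, if_neg hc]
    · rw [if_neg hf]

theorem fissionTerm_iso {X Y : LabelledGraph O} (φ : X.graph.Iso Y.graph)
    (h : ∀ v, Y.label (φ.onV v) = O.map (φ.star v) (X.label v)) (e₁ e₂ f₁ f₂ : X.graph.H) :
    fissionTerm X (e₁, e₂, f₁, f₂) =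
      φ.sign • fissionTerm Y (φ.onH e₁, φ.onH e₂, φ.onH f₁, φ.onH f₂) := by
  have h1 := fuseTwice_iso φ X.label Y.label h e₁ e₂ f₁ f₂
  unfold fissionTerm
  by_cases hq : Gluable X.graph.opp (e₁, e₂, f₁, f₂)
  · have hc : componentCount X.graph.att (oppGlueTwice X.graph.opp (e₁, e₂, f₁, f₂)) =
        componentCount Y.graph.att
          (oppGlueTwice Y.graph.opp (φ.onH e₁, φ.onH e₂, φ.onH f₁, φ.onH f₂)) :=
      Nat.card_congr ((φ.glue e₁ e₂ hq.1).glue f₁ f₂ hq.2.2.2).components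
    rw [hc]
    by_cases h2 : componentCount Y.graph.att
        (oppGlueTwice Y.graph.opp (φ.onH e₁, φ.onH e₂, φ.onH f₁, φ.onH f₂)) = 2
    · rw [if_pos h2, if_pos h2]
      exact h1
    · rw [if_neg h2, if_neg h2, smul_zero]
  -- Without gluability there is no induced isomorphism to compare the component counts, but both
  -- summands vanish.
  · have h0 : fuseTwice X (e₁, e₂, f₁, f₂) = 0 := dif_neg hq
    have h2 : φ.sign • fuseTwice Y (φ.onH e₁, φ.onH e₂, φ.onH f₁, φ.onH f₂) = 0 :=
      h1.symm.trans h0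
    rw [h0, ite_self, smul_ite, h2, smul_zero, ite_self]

/-- The fusion of a graph with the fission of another graph. -/
theorem phi2_componentProjection_right (X Y : LabelledGraph O)
    (hX : ∀ b, Subsingleton (X.graph.ComponentsWithout b)) :
    ((-1 : ℤ) ^ Nat.card X.graph.V) •
        phi2 (graphClass X) (componentProjection 2 (partial2 (graphClass Y))) =
      ∑ p : Y.graph.H × Y.graph.H, ∑ f : (X.graph.H ⊕ Y.graph.H) × (X.graph.H ⊕ Y.graph.H),
        if f.1.isLeft ≠ f.2.isLeft then
          fissionTerm (X.disjUnion Y) (Sum.inr p.1, Sum.inr p.2, f.1, f.2) else 0 := by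
  -- Interchanging the factors reduces to fission in the left one. The resulting sign is that of
  -- `Iso.swap`, which reappears when the disjoint union is put back in its original order.
  have h1 : ((-1 : ℤ) ^ Nat.card X.graph.V) •
        phi2 (graphClass X) (componentProjection 2 (partial2 (graphClass Y))) =
      ((-1 : ℤ) ^ (Nat.card X.graph.V * Nat.card Y.graph.V)) •
        phi2 (componentProjection 2 (partial2 (graphClass Y))) (graphClass X) := by
    rw [componentProjection_partial2, map_sum, map_sum, LinearMap.sum_apply, Finset.smul_sum,
      Finset.smul_sum]
    refine Finset.sum_congr rfl fun p _ => ?_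
    split_ifs
    · exact smul_phi2_fuseClass_comm X Y p.1 p.2
    · simp
  rw [h1, phi2_componentProjection_left Y X hX, Finset.smul_sum]
  refine Finset.sum_congr rfl fun p _ => ?_
  rw [Finset.smul_sum]
  refine Fintype.sum_equiv (Equiv.prodCongr (Equiv.sumComm Y.graph.H X.graph.H)
    (Equiv.sumComm Y.graph.H X.graph.H)) _ _ ?_
  rintro ⟨f₁, f₂⟩
  have hs : ∀ f, (Iso.swap X.graph Y.graph).onH (Equiv.sumComm Y.graph.H X.graph.H f) = f := by
    rintro (f | f) <;> rfl
  have h := (fissionTerm_iso (X := X.disjUnion Y) (Y := Y.disjUnion X)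
    (Iso.swap X.graph Y.graph) (swap_label X Y) (Sum.inr p.1) (Sum.inr p.2)
    (Equiv.sumComm Y.graph.H X.graph.H f₁) (Equiv.sumComm Y.graph.H X.graph.H f₂)).trans
      (congrArg₂ (fun (c : ℤ) z => c • z) (Iso.sign_swap X.graph Y.graph)
        (congrArg₂ (fun a b : Y.graph.H ⊕ X.graph.H =>
          fissionTerm (Y.disjUnion X) (Sum.inl p.1, Sum.inl p.2, a, b)) (hs f₁) (hs f₂)))
  have hiff : (Equiv.sumComm Y.graph.H X.graph.H f₁).isLeft ≠
      (Equiv.sumComm Y.graph.H X.graph.H f₂).isLeft ↔ f₁.isLeft ≠ f₂.isLeft := by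
    rw [isLeft_sumComm, isLeft_sumComm]
    cases f₁.isLeft <;> cases f₂.isLeft <;> decide
  by_cases hf : f₁.isLeft ≠ f₂.isLeft
  · exact (congrArg _ (if_pos hf)).trans (h.symm.trans (if_pos (hiff.2 hf)).symm)
  · exact ((congrArg _ (if_neg hf)).trans (smul_zero _)).trans
      (if_neg fun h1 => hf (hiff.1 h1)).symm

/-- Splits the first pair of half-edges according to whether it is mixed, within the first part or
within the second: these are the three terms of the identity. -/
theorem sum_ne_isLeft {α β M : Type*} [Fintype α] [Fintype β] [AddCommMonoid M]
    (F G : (α ⊕ β) × (α ⊕ β) → M) :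
    ∑ p, (if p.1.isLeft ≠ p.2.isLeft then F p else G p) =
      ∑ p, (if p.1.isLeft ≠ p.2.isLeft then F p else 0) +
        (∑ p : α × α, G (Sum.inl p.1, Sum.inl p.2) +
          ∑ p : β × β, G (Sum.inr p.1, Sum.inr p.2)) := by
  have h : ∀ p : (α ⊕ β) × (α ⊕ β), (if p.1.isLeft ≠ p.2.isLeft then F p else G p) =
      (if p.1.isLeft ≠ p.2.isLeft then F p else 0) +
        (if p.1.isLeft ≠ p.2.isLeft then 0 else G p) := by
    intro p
    split_ifs <;> simp
  simp only [h, Finset.sum_add_distrib]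
  congr 1
  simp [Fintype.sum_prod_type]

/-- The sum over all pairs of squares that join the two parts of a disjoint union vanishes. -/
theorem sum_fissionTerm_disjUnion (X Y : LabelledGraph O) :
    ∑ e : (X.graph.H ⊕ Y.graph.H) × (X.graph.H ⊕ Y.graph.H),
      (if e.1.isLeft ≠ e.2.isLeft then
        ∑ f : (X.graph.H ⊕ Y.graph.H) × (X.graph.H ⊕ Y.graph.H),
          fissionTerm (X.disjUnion Y) (e.1, e.2, f.1, f.2)
      else ∑ f : (X.graph.H ⊕ Y.graph.H) × (X.graph.H ⊕ Y.graph.H),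
        if f.1.isLeft ≠ f.2.isLeft then
          fissionTerm (X.disjUnion Y) (e.1, e.2, f.1, f.2) else 0) = 0 := by
  let o : X.graph.H ⊕ Y.graph.H → X.graph.H ⊕ Y.graph.H := (X.disjUnion Y).graph.opp
  have hs : ∀ h, (o h).isLeft = h.isLeft := by
    rintro (h | h) <;> rfl
  -- Only the disjunction is invariant under `exchange`: with three edges involved, a mixed first
  -- pair may be exchanged for an unmixed one. This is why the three terms cancel only together.
  let P : (X.graph.H ⊕ Y.graph.H) × (X.graph.H ⊕ Y.graph.H) × (X.graph.H ⊕ Y.graph.H) ×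
      (X.graph.H ⊕ Y.graph.H) → Prop := fun q =>
    (q.1.isLeft ≠ q.2.1.isLeft ∨ q.2.2.1.isLeft ≠ q.2.2.2.isLeft) ∧
      componentCount (X.disjUnion Y).graph.att (oppGlueTwice o q) = 2
  have hP : ∀ q, Gluable o q → P q → P (exchange o q) := by
    intro q hq h
    refine ⟨?_, ?_⟩
    · exact ne_or_ne_exchange (X.disjUnion Y).graph.opp_opp _ hs hq h.1
    · exact (congrArg (componentCount (X.disjUnion Y).graph.att) (funext (oppGlueTwice_exchange
        (X.disjUnion Y).graph.opp_opp (X.disjUnion Y).graph.opp_ne hq))).trans h.2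
  have key := sum_fuseTwice_eq_zero (X.disjUnion Y) P hP
  refine Eq.trans ?_ key
  have hsplit : ∀ F : (X.graph.H ⊕ Y.graph.H) × (X.graph.H ⊕ Y.graph.H) × (X.graph.H ⊕ Y.graph.H)
      × (X.graph.H ⊕ Y.graph.H) → GraphSpace O,
      ∑ q, F q = ∑ e : (X.graph.H ⊕ Y.graph.H) × (X.graph.H ⊕ Y.graph.H),
        ∑ f : (X.graph.H ⊕ Y.graph.H) × (X.graph.H ⊕ Y.graph.H), F (e.1, e.2, f.1, f.2) := by
    intro F
    simp only [Fintype.sum_prod_type]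
  refine Eq.trans ?_ (hsplit _).symm
  refine Finset.sum_congr rfl fun e _ => ?_
  by_cases he : e.1.isLeft ≠ e.2.isLeft
  · rw [if_pos he]
    refine Finset.sum_congr rfl fun f _ => ite_zero_congr fun _ => ?_
    exact (and_iff_right (Or.inl he)).symm
  · rw [if_neg he]
    refine Finset.sum_congr rfl fun f _ => ?_
    by_cases hf : f.1.isLeft ≠ f.2.isLeft
    · rw [if_pos hf]
      exact ite_zero_congr fun _ => (and_iff_right (Or.inr hf)).symm
    · rw [if_neg hf]
      exact (if_neg fun h => h.1.elim he hf).symm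

theorem componentProjection_partial2_phi2 (X Y : LabelledGraph O) :
    componentProjection 2 (partial2 (phi2 (graphClass X) (graphClass Y))) =
      ∑ e : (X.graph.H ⊕ Y.graph.H) × (X.graph.H ⊕ Y.graph.H),
        if e.1.isLeft ≠ e.2.isLeft then
          ∑ f : (X.graph.H ⊕ Y.graph.H) × (X.graph.H ⊕ Y.graph.H),
            fissionTerm (X.disjUnion Y) (e.1, e.2, f.1, f.2) else 0 := by
  rw [phi2_graphClass]
  unfold fusionSum
  rw [map_sum, map_sum]
  refine Finset.sum_congr rfl fun e _ => ?_
  split_ifs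
  · exact componentProjection_partial2_fuseClass 2 (X.disjUnion Y) e.1 e.2
  · rw [map_zero, map_zero]

/-- The compatibility of the fusion and the fission for connected graphs without separating
edges. -/
theorem theta2_phi2_graphClass (X Y : LabelledGraph O)
    (hX : ∀ b, Subsingleton (X.graph.ComponentsWithout b))
    (hY : ∀ b, Subsingleton (Y.graph.ComponentsWithout b)) :
    theta2 (phi2 (graphClass X) (graphClass Y)) + phi2 (theta2 (graphClass X)) (graphClass Y) +
      (-1 : k) ^ Nat.card X.graph.V • phi2 (graphClass X) (theta2 (graphClass Y)) = 0 := by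
  have h1 := componentProjection_partial2_phi2 X Y
  have h2 := phi2_componentProjection_left X Y hY
  have h3 := phi2_componentProjection_right X Y hX
  have h0 := sum_fissionTerm_disjUnion X Y
  rw [sum_ne_isLeft, ← h1, ← h2, ← h3] at h0
  -- Signs of orientations are integer scalars, whereas the sign in the identity lies in `k`.
  have hz : ((-1 : ℤ) ^ Nat.card X.graph.V) •
      phi2 (graphClass X) (componentProjection 2 (partial2 (graphClass Y))) =
      (-1 : k) ^ Nat.card X.graph.V •
        phi2 (graphClass X) (componentProjection 2 (partial2 (graphClass Y))) := by
    rw [← Int.cast_smul_eq_zsmul k]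
    simp
  rw [hz] at h0
  unfold theta2
  simp only [LinearMap.smul_apply, LinearMap.comp_apply, map_smul]
  rw [smul_comm ((-1 : k) ^ Nat.card X.graph.V), ← smul_add, ← smul_add, add_assoc, h0, smul_zero]

end

end

theorem theorem3 {k : Type u} [Field k] (h2 : (2 : k) ≠ 0) (O : CyclicOperad.{u, w} k)
    (x y : ℕ) (X Y : GraphSpace O)
    (hX : X ∈ irreducibleSpace O x) (hY : Y ∈ irreducibleSpace O y) :
    theta2 (phi2 X Y) + phi2 (theta2 X) Y + (-1 : k) ^ x • phi2 X (theta2 Y) = 0 := by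
  unfold irreducibleSpace at hX hY
  -- With `x` fixed, the left-hand side is bilinear, so it suffices to treat connected graphs
  -- without separating edges.
  refine Submodule.span_induction₂ (p := fun X Y _ _ => theta2 (phi2 X Y) + phi2 (theta2 X) Y +
    (-1 : k) ^ x • phi2 X (theta2 Y) = 0) ?_ ?_ ?_ ?_ ?_ ?_ ?_ hX hY
  · rintro _ _ ⟨X, h1, h1', rfl, rfl⟩ ⟨Y, h3, h3', -, rfl⟩
    exact theta2_phi2_graphClass X Y (OGraph.subsingleton_componentsWithout h1 h1')
      (OGraph.subsingleton_componentsWithout h3 h3')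
  · intros
    simp
  · intros
    simp
  · intro X X' Y _ _ _ h h'
    simp only [map_add, LinearMap.add_apply, smul_add]
    rw [← add_zero (0 : GraphSpace O)]
    nth_rw 1 [← h, ← h']
    abel
  · intro X Y Y' _ _ _ h h'
    simp only [map_add, smul_add]
    rw [← add_zero (0 : GraphSpace O)]
    nth_rw 1 [← h, ← h']
    abel
  · intro r X Y _ _ h
    simp only [map_smul, LinearMap.smul_apply]
    rw [smul_comm ((-1 : k) ^ x), ← smul_add, ← smul_add, h, smul_zero]
  · intro r X Y _ _ h
    simp only [map_smul]
    rw [smul_comm ((-1 : k) ^ x), ← smul_add, ← smul_add, h, smul_zero]
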